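/- Let $\Gamma$ be a finite commutative group of order $n$ with an embedding $\iota:\Gamma\hookrightarrow\mathbb C^*$; identify $\Gamma$ with its image. **Notation.** Let $X=\{x_\sigma\}_{\sigma\in\Gamma\cup\{0\}}$, $y_{m,\nu}=x_0^{m-1}x_\nu$ and $Y=\{y_{m,\nu}\}_{m\ge1,\nu\in\Gamma}$. For a $\mathbb Q$-algebra $k$, let $k\langle\langle X\rangle\rangle\supset k\langle\langle Y\rangle\rangle$ be the algebras of noncommutative series, $(\Phi|w)$ the coefficient of the word $w$ in $\Phi$, and $\pi_Y:k\langle\langle X\rangle\rangle\to k\langle\langle Y\rangle\rangle$ the projection killing the words that end in $x_0$. Let $q_s$ be the continuous linear automorphism of $k\langle\langle Y\rangle\rangle$ with $$q_s(y_{s_1,\sigma_1}\cdots y_{s_r,\sigma_r})=y_{s_1,\sigma_1}y_{s_2,\sigma_2\sigma_1^{-1}}\cdots y_{s_r,\sigma_r\sigma_{r-1}^{-1}}.$$ Let $\Delta$ and $\Delta_*$ be the continuous algebra morphisms on $k\langle\langle X\rangle\rangle$ and $k\langle\langle Y\rangle\rangle$ (with values in the completed tensor squares) given by $\Delta x_\sigma=1\otimes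 x_\sigma+x_\sigma\otimes1$ and $\Delta_*y_{m,\nu}=\sum_{i+j=m,\ \kappa\lambda=\nu}y_{i,\kappa}\otimes y_{j,\lambda}$, where $y_{0,1}=1$ and $y_{0,\nu}=0$ for $\nu\ne1$. A series is group-like for a coproduct $D$ if its constant term is $1$ and $D\Phi=\Phi\otimes\Phi$. **The two series.** For $0<a<b<1$ put $$I_{[a,b]}(a_1,\dots,a_p)=\int_a^b\omega_{a_1}(t_1)\int_a^{t_1}\omega_{a_2}(t_2)\cdots\int_a^{t_{p-1}}\omega_{a_p}(t_p),\qquad \omega_0=\frac{dt}{t},\quad \omega_\sigma=\frac{dt}{\sigma^{-1}-t}\ (\sigma\in\Gamma).$$ Let $\mathcal I\in\mathbb C\langle\langle X\rangle\rangle$ be the group-like series for $\Delta$ whose coefficients at $x_0$ and $x_1$ are $0$ and whose coefficient at every word $x_{a_1}\cdots x_{a_p}$ that does not begin with $x_1$ and does not end with $x_0$ is $\lim_{a\to0^+,\,b\to1^-}I_{[a,b]}(a_1,\dots,a_p)$. Let $\mathcal L\in\mathbb C\langle\langle Y\rangle\rangle$ be the group-like series for $\Delta_*$ whose coefficient at $y_{1,1}$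 is $0$ and whose coefficient at every word $y_{s_1,\sigma_1}\cdots y_{s_r,\sigma_r}$ that does not begin with $y_{1,1}$ is $$\lim_{N\to\infty}\sum_{N>n_1>\cdots>n_r>0}\frac{\sigma_1^{n_1}\cdots\sigma_r^{n_r}}{n_1^{s_1}\cdots n_r^{s_r}}.$$ **The set $\mathrm{DMRD}(\iota)(k)$.** It consists of the $\Phi\in k\langle\langle X\rangle\rangle$ such that: 1. $(\Phi|1)=1$ and $(\Phi|x_0)=(\Phi|x_1)=0$. 2. $\Phi$ is group-like for $\Delta$, and $\Phi_*=\exp\Big(\sum_{m\ge2}\frac{(-1)^{m-1}}m(\pi_Y(\Phi)|y_{m,1})\,y_{1,1}^m\Big)\cdot q_s\pi_Y(\Phi)$ is group-like for $\Delta_*$. 3. (Weight one; a void condition if $n\le2$.) $(\Phi|x_{\xi^j}-x_{\xi^{-j}})=\frac{n-2j}{n-2}(\Phi|x_\xi-x_{\xi^{-1}})$ for $1\le j\le n/2$, where $\iota(\xi)=e^{2i\pi/n}$. 4. (Distribution.) For every divisor $d$ of $n$, $\ p^d_*(\Phi)=\exp\Big(\sum_{\sigma^d=1}(\Phi|x_\sigma)\,x_1\Big)\cdot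 i_d^*(\Phi)$ in $k\langle\langle X_{\Gamma^d}\rangle\rangle$. Here $\Gamma^d=\{\sigma^d:\sigma\in\Gamma\}$, and $X_{\Gamma^d}=\{x_\sigma\}_{\sigma\in\Gamma^d\cup\{0\}}$. The substitution $p^d_*$ sends $x_0\mapsto d\,x_0$ and $x_\sigma\mapsto x_{\sigma^d}$. The substitution $i_d^*$ sends $x_0\mapsto x_0$, $x_\sigma\mapsto x_\sigma$ if $\sigma\in\Gamma^d$, and $x_\sigma\mapsto0$ for the other $\sigma\in\Gamma$. **Statement.** The series $\mathcal I$ and $\mathcal L$ exist (in particular all the limits above exist) and are unique. They satisfy the regularisation relation $$\mathcal L=\exp\Big(\sum_{m\ge2}\frac{(-1)^{m-1}\zeta(m)}{m}\,y_{1,1}^m\Big)\cdot q_s\pi_Y(\mathcal I),$$ and $\mathcal I\in\mathrm{DMRD}(\iota)(\mathbb C)$. -/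

import Mathlib

/-!
Noncommutative formal power series, the two coproducts of double shuffle theory, iterated integrals
and iterated sums at roots of unity, and the scheme `DMRD`.

A word in an alphabet `A` is an element of `FreeMonoid A`. All alphabets below carry a weight for
which there are finitely many words of each weight, so a series is an arbitrary function on words.
-/

namespace Racinet

noncomputable section

/-- Noncommutative formal power series `k⟪A⟫`; `Φ w` is the coefficient `(Φ|w)`. -/
abbrev Series (k A : Type*) := FreeMonoid A → k

section SeriesOps

variable {k A : Type*} [CommRing k]

/-- The (concatenation) product of series: `(ΦΨ|w) = ∑_{w = uv} (Φ|u)(Ψ|v)`. -/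
def mul (Φ Ψ : Series k A) : Series k A := fun w =>
  ∑ i ∈ Finset.range (w.length + 1),
    Φ (FreeMonoid.ofList (w.toList.take i)) * Ψ (FreeMonoid.ofList (w.toList.drop i))

open Classical in
/-- The unit series `1`. -/
def one : Series k A := fun w => if w = 1 then 1 else 0

/-- Powers of a series. -/
def pow (Φ : Series k A) : ℕ → Series k A
  | 0 => one
  | m + 1 => mul (pow Φ m) Φ

/-- The exponential `∑_m Φ^m / m!` of a series without constant term: then the coefficient of `w`
in `Φ^m` vanishes for `m` larger than the length of `w`. -/
def exp [Algebra ℚ k] (Φ : Series k A) : Series k A := fun w =>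
  ∑ m ∈ Finset.range (w.length + 1), algebraMap ℚ k (1 / (m.factorial : ℚ)) * pow Φ m w

/-- The extension to series of the algebra morphism `k⟨A⟩ → k[M]` given on generators by `f`:
the coefficient at `m` of `∑_w (Φ|w) f(w)`. For all the `f` used below, `f a` is homogeneous of the
same weight as `a` and the sum is finite, see `finite_support_extend`. -/
def extend {M : Type*} [Monoid M] (f : A → MonoidAlgebra k M) (Φ : Series k A) : M → k := fun m =>
  ∑ᶠ w : FreeMonoid A, Φ w * (FreeMonoid.lift f w).coeff m

/-- If `f a` is homogeneous of degree `wt a` and there are finitely many words of each weight, then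
the sum defining `extend` is finite. -/
theorem finite_support_extend {M : Type*} [Monoid M] (f : A → MonoidAlgebra k M) (wt : A → ℕ)
    (hfin : ∀ n, {w : FreeMonoid A | (w.toList.map wt).sum = n}.Finite)
    (deg : M → ℕ) (deg_one : deg 1 = 0) (deg_mul : ∀ x y, deg (x * y) = deg x + deg y)
    (hf : ∀ a m, (f a).coeff m ≠ 0 → deg m = wt a) (Φ : Series k A) (m : M) :
    (Function.support fun w : FreeMonoid A => Φ w * (FreeMonoid.lift f w).coeff m).Finite := by
  classical
  have key : ∀ w : FreeMonoid A, ∀ m, (FreeMonoid.lift f w).coeff m ≠ 0 →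
      deg m = (w.toList.map wt).sum := by
    intro w
    induction w using FreeMonoid.recOn with
    | one =>
      intro m hm
      by_cases h : m = 1
      · subst h; simpa using deg_one
      · exfalso; apply hm
        rw [map_one, MonoidAlgebra.one_def]
        simp [Ne.symm h]
    | of_mul a w ih =>
      intro m hm
      rw [map_mul, FreeMonoid.lift_eval_of] at hm
      have hm' : m ∈ (f a * FreeMonoid.lift f w).coeff.support := by simpa using hm
      have := MonoidAlgebra.support_coeff_mul_subset _ _ hm'
      obtain ⟨x, hx, y, hy, rfl⟩ := Finset.mem_mul.1 this
      rw [deg_mul, hf a x (by simpa using hx), ih y (by simpa using hy)]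
      simp
  refine (hfin (deg m)).subset fun w hw => ?_
  have : (FreeMonoid.lift f w).coeff m ≠ 0 := fun h => hw (by simp [h])
  exact (key w m this).symm

/-- `a ⊗ b`, where `k⟨A⟩ ⊗ k⟨A⟩` is the algebra of the monoid of pairs of words. -/
def tens (a b : MonoidAlgebra k (FreeMonoid A)) : MonoidAlgebra k (FreeMonoid A × FreeMonoid A) :=
  MonoidAlgebra.mapDomain (fun u => (u, 1)) a * MonoidAlgebra.mapDomain (fun v => (1, v)) b

/-- A generator, as a noncommutative polynomial. -/
def gen (a : A) : MonoidAlgebra k (FreeMonoid A) := MonoidAlgebra.single (FreeMonoid.of a) 1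

/-- `Φ` is group-like for the coproduct `Δ` (extended to series) that is the algebra morphism given
on generators by `f`: its constant term is `1` and `ΔΦ = Φ ⊗ Φ`. -/
def IsGroupLike (f : A → MonoidAlgebra k (FreeMonoid A × FreeMonoid A)) (Φ : Series k A) : Prop :=
  Φ 1 = 1 ∧ ∀ u v : FreeMonoid A, extend f Φ (u, v) = Φ u * Φ v

end SeriesOps

section Alphabets

variable {Γ : Type*} [CommGroup Γ] {k : Type*} [CommRing k]

/-- The alphabet `X = {x_σ}`, indexed by `Γ ∪ {0}`. -/
abbrev X (Γ : Type*) := WithZero Γ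

/-- The alphabet `Y = {y_{n,ν}}`, indexed by `ℕ* × Γ`. -/
abbrev Y (Γ : Type*) := ℕ+ × Γ

/-- The one-letter word `x_σ`, `σ ∈ Γ ∪ {0}`. -/
def x (σ : X Γ) : FreeMonoid (X Γ) := FreeMonoid.of σ

/-- The one-letter word `y_{n,ν}`. -/
def y (n : ℕ+) (ν : Γ) : FreeMonoid (Y Γ) := FreeMonoid.of (n, ν)

/-- The word in `X` that a word in `Y` stands for: `y_{n,ν} = x_0^{n-1} x_ν`. -/
def toX : FreeMonoid (Y Γ) →* FreeMonoid (X Γ) :=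
  FreeMonoid.lift fun p => x 0 ^ ((p.1 : ℕ) - 1) * x (p.2 : X Γ)

/-- The projection `π_Y : k⟪X⟫ → k⟪Y⟫` that kills the words ending in `x_0`. -/
def piY (Φ : Series k (X Γ)) : Series k (Y Γ) := fun w => Φ (toX w)

/-- The coproduct `Δ` on generators: every `x_σ` is primitive. -/
def delta (σ : X Γ) : MonoidAlgebra k (FreeMonoid (X Γ) × FreeMonoid (X Γ)) :=
  tens 1 (gen σ) + tens (gen σ) 1

open Classical in
/-- `y_{n,ν}` for `n ≥ 0`, with `y_{0,1} = 1` and `y_{0,ν} = 0` for `ν ≠ 1`. -/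
def yPoly (n : ℕ) (ν : Γ) : MonoidAlgebra k (FreeMonoid (Y Γ)) :=
  if h : 0 < n then gen (⟨n, h⟩, ν) else if ν = 1 then 1 else 0

/-- The coproduct `Δ_*` on generators:
`Δ_* y_{n,ν} = ∑_{i+j=n, κλ=ν} y_{i,κ} ⊗ y_{j,λ}`, with `Γ` finite. -/
def deltaStar (p : Y Γ) : MonoidAlgebra k (FreeMonoid (Y Γ) × FreeMonoid (Y Γ)) :=
  ∑ i ∈ Finset.range ((p.1 : ℕ) + 1), ∑ᶠ κ : Γ,
    tens (yPoly i κ) (yPoly ((p.1 : ℕ) - i) (κ⁻¹ * p.2))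

/-- Successive products, starting from `g`. -/
def psAux : Γ → List (Y Γ) → List (Y Γ)
  | _, [] => []
  | g, (s, σ) :: w => (s, g * σ) :: psAux (g * σ) w

/-- Successive quotients, starting from `g`. -/
def qsAux : Γ → List (Y Γ) → List (Y Γ)
  | _, [] => []
  | g, (s, σ) :: w => (s, σ * g⁻¹) :: qsAux σ w

theorem psAux_qsAux (g : Γ) (w : List (Y Γ)) : psAux g (qsAux g w) = w := by
  induction w generalizing g with
  | nil => rfl
  | cons p w ih => obtain ⟨s, σ⟩ := p; simp [psAux, qsAux, ih]

theorem qsAux_psAux (g : Γ) (w : List (Y Γ)) : qsAux g (psAux g w) = w := by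
  induction w generalizing g with
  | nil => rfl
  | cons p w ih => obtain ⟨s, σ⟩ := p; simp [psAux, qsAux, ih]

/-- The bijection on words
`y_{s₁,σ₁} y_{s₂,σ₂} ⋯ y_{s_r,σ_r} ↦ y_{s₁,σ₁} y_{s₂,σ₂σ₁⁻¹} ⋯ y_{s_r,σ_rσ_{r-1}⁻¹}`,
whose inverse takes successive products. -/
def qsWord : FreeMonoid (Y Γ) ≃ FreeMonoid (Y Γ) where
  toFun w := FreeMonoid.ofList (qsAux 1 w.toList)
  invFun w := FreeMonoid.ofList (psAux 1 w.toList)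
  left_inv w := by simp [psAux_qsAux]
  right_inv w := by simp [qsAux_psAux]

/-- The linear automorphism `q_s` of `k⟪Y⟫`: `q_s (∑_w (Ψ|w) w) = ∑_w (Ψ|w) q_s(w)`. -/
def qs (Ψ : Series k (Y Γ)) : Series k (Y Γ) := fun w => Ψ (qsWord.symm w)

open Classical in
/-- The series `∑_{n ≥ 2} ((-1)^{n-1} / n) c_n y_{1,1}^n`. -/
def corrLog [Algebra ℚ k] (c : ℕ → k) : Series k (Y Γ) := fun w =>
  if 2 ≤ w.length ∧ w = y 1 1 ^ w.length then
    algebraMap ℚ k ((-1) ^ (w.length - 1) / (w.length : ℚ)) * c w.length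
  else 0

end Alphabets

section Functoriality

variable {G G' : Type*} [CommGroup G] [CommGroup G'] {k : Type*} [CommRing k]

/-- The substitution `φ_* : k⟪X_G⟫ → k⟪X_G'⟫`: `x_0 ↦ d x_0` with `d` the order of `ker φ`, and
`x_σ ↦ x_{φ(σ)}` for `σ ∈ G`. -/
def push (φ : G →* G') : Series k (X G) → Series k (X G') :=
  extend (WithZero.recZeroCoe (MonoidAlgebra.single (x 0) (Nat.card φ.ker : k))
    fun σ => gen (φ σ : X G'))

/-- The substitution `φ^* : k⟪X_G'⟫ → k⟪X_G⟫`: `x_0 ↦ x_0`, and `x_σ ↦ ∑_{φ(τ) = σ} x_τ` for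
`σ ∈ G'`, with `G` finite. -/
def pull (φ : G →* G') : Series k (X G') → Series k (X G) :=
  extend (WithZero.recZeroCoe (gen 0) fun σ => ∑ᶠ (τ : G) (_ : φ τ = σ), gen (τ : X G))

end Functoriality

section Scheme

variable {Γ : Type*} [CommGroup Γ] {k : Type*} [CommRing k] [Algebra ℚ k]

/-- `Φ_* = exp(∑_{n ≥ 2} ((-1)^{n-1}/n) (π_Y Φ|y_{n,1}) y_{1,1}^n) · q_s π_Y Φ`. -/
def star (Φ : Series k (X Γ)) : Series k (Y Γ) :=
  mul (exp (corrLog fun n => if h : 0 < n then piY Φ (y ⟨n, h⟩ 1) else 0)) (qs (piY Φ))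

variable (Γ k) in
/-- The `k`-points of `DMR(Γ)` (double shuffles and regularisation). -/
def DMR : Set (Series k (X Γ)) :=
  {Φ | Φ 1 = 1 ∧ Φ (x 0) = 0 ∧ Φ (x 1) = 0 ∧ IsGroupLike delta Φ ∧ IsGroupLike deltaStar (star Φ)}

/-- The `k`-points of `DMR'(ι)`: those of `DMR(Γ)` that satisfy the weight one relations
`(Φ|x_{ξ^j} - x_{ξ^{-j}}) = ((n-2j)/(n-2)) (Φ|x_ξ - x_{ξ⁻¹})` for `1 ≤ j ≤ n/2`, where `n` is the
order of `Γ` and `ι ξ = exp(2πi/n)` (for `n ≤ 2` they say nothing). -/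
def DMRP (ι : Γ →* ℂˣ) (k : Type*) [CommRing k] [Algebra ℚ k] : Set (Series k (X Γ)) :=
  {Φ | Φ ∈ DMR Γ k ∧
    ∀ ξ : Γ, (ι ξ : ℂ) = Complex.exp (2 * Real.pi * Complex.I / (Nat.card Γ : ℂ)) →
      ∀ j : ℕ, 1 ≤ j → 2 * j ≤ Nat.card Γ →
        Φ (x ((ξ ^ j : Γ) : X Γ)) - Φ (x (((ξ ^ j)⁻¹ : Γ) : X Γ)) =
          algebraMap ℚ k (((Nat.card Γ : ℚ) - 2 * j) / ((Nat.card Γ : ℚ) - 2)) *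
            (Φ (x (ξ : X Γ)) - Φ (x ((ξ⁻¹ : Γ) : X Γ)))}

open Classical in
/-- The series `c x_1`. -/
def smulX1 {G : Type*} [CommGroup G] (c : k) : Series k (X G) := fun w => if w = x 1 then c else 0

/-- The distribution relation for `d`: with `p^d : Γ → Γ^d`, `σ ↦ σ^d`, and `i_d : Γ^d → Γ` the
inclusion, `p^d_*(Φ) = exp(∑_{σ^d = 1} (Φ|x_σ) x_1) · i_d^*(Φ)`. -/
def Distribution (Φ : Series k (X Γ)) (d : ℕ) : Prop :=
  push (powMonoidHom d : Γ →* Γ).rangeRestrict Φ =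
    mul (exp (smulX1 (∑ᶠ (σ : Γ) (_ : σ ^ d = 1), Φ (x (σ : X Γ)))))
      (pull (powMonoidHom d : Γ →* Γ).range.subtype Φ)

/-- The `k`-points of `DMRD(ι)`: those of `DMR'(ι)` that satisfy the distribution relations for all
divisors `d` of the order of `Γ`. -/
def DMRD (ι : Γ →* ℂˣ) (k : Type*) [CommRing k] [Algebra ℚ k] : Set (Series k (X Γ)) :=
  {Φ | Φ ∈ DMRP ι k ∧ ∀ d : ℕ, d ∣ Nat.card Γ → Distribution Φ d}

end Scheme

section Analytic

variable {Γ : Type*} [CommGroup Γ] (ι : Γ →* ℂˣ)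

/-- The density of the form `ω_a`: `dt / t` for `a = 0` and `dt / (a⁻¹ - t)` for `a = ι σ`. -/
def omega (a : X Γ) (t : ℝ) : ℂ :=
  WithZero.recZeroCoe (1 / (t : ℂ)) (fun σ => 1 / ((ι σ : ℂ)⁻¹ - t)) a

/-- The iterated integral along the segment `[a,b]`:
`I_{[a,b]}(a₁,…,a_p) = ∫_a^b ω_{a₁}(t₁) ∫_a^{t₁} ω_{a₂}(t₂) ⋯ ∫_a^{t_{p-1}} ω_{a_p}(t_p)`. -/
def iterInt (a : ℝ) : List (X Γ) → ℝ → ℂ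
  | [], _ => 1
  | c :: w, b => ∫ t in a..b, omega ι c t * iterInt a w t

/-- The truncated iterated sum
`L^N_{s₁,…,s_r}(σ₁,…,σ_r) = ∑_{N > n₁ > ⋯ > n_r > 0} ι(σ₁)^{n₁} ⋯ ι(σ_r)^{n_r} / (n₁^{s₁} ⋯ n_r^{s_r})`. -/
def iterSum : List (Y Γ) → ℕ → ℂ
  | [], _ => 1
  | (s, σ) :: w, N =>
      ∑ n ∈ Finset.Ico 1 N, (ι σ : ℂ) ^ n / (n : ℂ) ^ (s : ℕ) * iterSum w n

/-- The regularised generating series `I` of iterated integrals: the series that is group-like for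
`Δ`, whose coefficients at the words not starting with `x_1` and not ending with `x_0` are the
convergent iterated integrals from `0` to `1`, and whose coefficients at `x_0` and `x_1` vanish. -/
def IsRegIntegralSeries (Φ : Series ℂ (X Γ)) : Prop :=
  IsGroupLike delta Φ ∧
  (∀ w : FreeMonoid (X Γ), w.toList.head? ≠ some 1 → w.toList.getLast? ≠ some 0 →
    Filter.Tendsto (fun p : ℝ × ℝ => iterInt ι p.1 w.toList p.2)
      (nhdsWithin 0 (Set.Ioi 0) ×ˢ nhdsWithin 1 (Set.Iio 1)) (nhds (Φ w))) ∧
  Φ (x 0) = 0 ∧ Φ (x 1) = 0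

/-- The regularised generating series `L` of iterated sums: the series that is group-like for `Δ_*`,
whose coefficients at the words not starting with `y_{1,1}` are the convergent iterated sums, and
whose coefficient at `y_{1,1}` vanishes. -/
def IsRegSumSeries (Ψ : Series ℂ (Y Γ)) : Prop :=
  IsGroupLike deltaStar Ψ ∧
  (∀ w : FreeMonoid (Y Γ), w.toList.head? ≠ some (1, 1) →
    Filter.Tendsto (fun N : ℕ => iterSum ι w.toList N) Filter.atTop (nhds (Ψ w))) ∧
  Ψ (y 1 1) = 0

end Analytic

end

end Racinet

/-! Both group-like conditions become identities on words: $\Phi(u)\Phi(v)$ is the sum of $\Phi$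
over the quasi-shuffles of $u$ and $v$, where letters never contract for $\Delta$, and
$y_{i,\kappa},y_{j,\lambda}$ contract to $y_{i+j,\kappa\lambda}$ for $\Delta_*$ (`isGroupLike_iff`).
Iterated integrals over $[a,b]$ satisfy the first kind, by differentiation in $b$; sums truncated at
$N$ satisfy the second, by induction on $N$.

Regularisation is linear algebra. The product of a letter $x$ with a word $w$ is a positive multiple
of $xw$ plus words with fewer leading $x$. So on the set of group-like series with zero coefficient
at $x$, evaluation at any word is one fixed linear combination of evaluations at convergent words
(`evalAt_mem_span_of_lead`, `evalAt_mem_span_of_shuffle`). Uniqueness, limits and rates of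
convergence pass through it. Truncated objects enter this set after multiplication by some
$\exp(-c\,x)$, which leaves the convergent coefficients unchanged.

For the regularisation relation, let $E$ be the part of $\mathcal L$ on powers of $y_{1,1}$ and
$S=E^{-1}\mathcal L$. Newton's identities give $E=\exp\sum_{m\ge2}\frac{(-1)^{m-1}\zeta(m)}m
y_{1,1}^m$. The series of sums truncated at $N$ is, up to $O(N^{-1/4})$, its own part on powers of
$y_{1,1}$ times $S$. Multiple polylogarithms at $z$ are the Abel means of truncated sums, and their
part on powers of $y_{1,1}$ is $\exp(\mathrm{Li}_1(z)y_{1,1})$. Hence the polylogarithm series is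
$\exp(\mathrm{Li}_1(z)y_{1,1})S+O((1-z)^{1/8})$. Multiplying by $\exp(-\mathrm{Li}_1(z)y_{1,1})$
costs only powers of $\log(1-z)$, and $z\to1$ gives $S=q_s\pi_Y(\mathcal I)$ (`strippedSum_eq`).
Since $(\pi_Y\mathcal I|y_{m,1})=\zeta(m)$ for $m\ge2$, also $\mathcal I_*=\mathcal L$, which is
group-like for $\Delta_*$.

In weight one the coefficient at $x_\sigma$, $\sigma\ne1$, is $-\log(1-\sigma)$, and the relations
read off the argument of $1-e^{i\theta}$. The distribution relations come from $t\mapsto t^d$,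
because $\sum_{\tau^d=\sigma}\frac1{\tau^{-1}-t}=\frac{d\,t^{d-1}}{\sigma^{-1}-t^d}$. The
exponential factor measures the mismatch of the normalisations at $x_1$ and is identified by the
coefficient at $x_1$. -/

namespace Racinet

noncomputable section

open scoped Classical
open Finset.HasAntidiagonal (antidiagonal)

/-! ### Concatenation product on words, and power series in one letter. -/

section Words

variable {k A : Type*} [CommRing k]

/-- The sum of `H u v` over the factorisations `w = uv`. -/
def splitSum (H : List A → List A → k) : List A → k
  | [] => H [] []
  | a :: w => H [] (a :: w) + splitSum (fun u v => H (a :: u) v) w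

/-- The concatenation product of functions on words. -/
def lmul (Φ Ψ : List A → k) : List A → k := splitSum fun u v => Φ u * Ψ v

theorem splitSum_add (H K : List A → List A → k) (w : List A) :
    splitSum (fun u v => H u v + K u v) w = splitSum H w + splitSum K w := by
  induction w generalizing H K with
  | nil => rfl
  | cons a w ih => simp only [splitSum, ih]; ring

theorem splitSum_mul_left (c : k) (H : List A → List A → k) (w : List A) :
    splitSum (fun u v => c * H u v) w = c * splitSum H w := by
  induction w generalizing H with
  | nil => rfl
  | cons a w ih => simp only [splitSum, ih, mul_add]

theorem splitSum_mul_right (c : k) (H : List A → List A → k) (w : List A) :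
    splitSum (fun u v => H u v * c) w = splitSum H w * c := by
  simp only [mul_comm _ c, splitSum_mul_left]

theorem splitSum_zero (w : List A) : splitSum (fun _ _ => (0 : k)) w = 0 := by
  induction w with
  | nil => rfl
  | cons a w ih => simp [splitSum, ih]

theorem splitSum_eq_sum_range (H : List A → List A → k) (w : List A) :
    splitSum H w = ∑ i ∈ Finset.range (w.length + 1), H (w.take i) (w.drop i) := by
  induction w generalizing H with
  | nil => simp [splitSum]
  | cons a w ih => rw [splitSum, ih, List.length_cons, Finset.sum_range_succ' _ (w.length + 1), add_comm]; simp

/-- `FreeMonoid A` unfolds to `List A`, so series and functions on lists are compared with no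
transport map. The file uses this identification throughout. -/
theorem mul_eq_lmul (Φ Ψ : Series k A) : mul Φ Ψ = lmul (A := A) Φ Ψ :=
  funext fun w => (splitSum_eq_sum_range (fun u v : List A => Φ u * Ψ v) w).symm

@[simp] theorem lmul_nil (Φ Ψ : List A → k) : lmul Φ Ψ [] = Φ [] * Ψ [] := rfl

theorem lmul_cons (Φ Ψ : List A → k) (a : A) (w : List A) :
    lmul Φ Ψ (a :: w) = Φ [] * Ψ (a :: w) + lmul (fun v => Φ (a :: v)) Ψ w := rfl

theorem lmul_add_left (Φ Φ' Ψ : List A → k) (w : List A) :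
    lmul (fun v => Φ v + Φ' v) Ψ w = lmul Φ Ψ w + lmul Φ' Ψ w := by
  simp only [lmul, add_mul, splitSum_add]

theorem lmul_add_right (Φ Ψ Ψ' : List A → k) (w : List A) :
    lmul Φ (fun v => Ψ v + Ψ' v) w = lmul Φ Ψ w + lmul Φ Ψ' w := by
  simp only [lmul, mul_add, splitSum_add]

theorem lmul_smul_left (c : k) (Φ Ψ : List A → k) (w : List A) :
    lmul (fun v => c * Φ v) Ψ w = c * lmul Φ Ψ w := by
  simp only [lmul, mul_assoc, splitSum_mul_left]

theorem lmul_smul_right (c : k) (Φ Ψ : List A → k) (w : List A) :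
    lmul Φ (fun v => c * Ψ v) w = c * lmul Φ Ψ w := by
  simp only [lmul, mul_left_comm _ c, splitSum_mul_left]

theorem lmul_zero_left (Ψ : List A → k) (w : List A) : lmul (fun _ => 0) Ψ w = 0 := by
  simp only [lmul, zero_mul, splitSum_zero]

theorem lmul_assoc (Φ Ψ Ξ : List A → k) : lmul (lmul Φ Ψ) Ξ = lmul Φ (lmul Ψ Ξ) := by
  funext w
  induction w generalizing Φ with
  | nil => simp [mul_assoc]
  | cons a w ih =>
    have h : (fun v => lmul Φ Ψ (a :: v)) =
        fun v => Φ [] * Ψ (a :: v) + lmul (fun v => Φ (a :: v)) Ψ v := rfl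
    rw [lmul_cons, h, lmul_add_left, lmul_smul_left, ih, lmul_cons Φ, lmul_cons Ψ, lmul_nil]
    ring

/-- The series `∑ p_m x^m`. -/
def letterSeries (x : A) (p : ℕ → k) : List A → k
  | [] => p 0
  | a :: w => if a = x then letterSeries x (fun n => p (n + 1)) w else 0

@[simp] theorem letterSeries_nil (x : A) (p : ℕ → k) : letterSeries x p [] = p 0 := rfl

theorem letterSeries_cons (x : A) (p : ℕ → k) (a : A) (w : List A) :
    letterSeries x p (a :: w) = if a = x then letterSeries x (fun n => p (n + 1)) w else 0 := rfl

theorem letterSeries_eq_ite (x : A) (p : ℕ → k) (w : List A) :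
    letterSeries x p w = if w = List.replicate w.length x then p w.length else 0 := by
  induction w generalizing p with
  | nil => simp
  | cons a w ih =>
    rw [letterSeries_cons, ih]
    by_cases h : a = x <;> simp [h, List.replicate_succ]

theorem letterSeries_zero (x : A) : letterSeries x (fun _ => (0 : k)) = fun _ => 0 := by
  funext w; simp [letterSeries_eq_ite]

theorem letterSeries_add (x : A) (p q : ℕ → k) (w : List A) :
    letterSeries x (fun n => p n + q n) w = letterSeries x p w + letterSeries x q w := by
  simp only [letterSeries_eq_ite]; split_ifs <;> simp

theorem letterSeries_smul (x : A) (c : k) (q : ℕ → k) (w : List A) :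
    letterSeries x (fun n => c * q n) w = c * letterSeries x q w := by
  simp only [letterSeries_eq_ite]; split_ifs <;> simp

theorem lmul_letterSeries_cons (x : A) (p : ℕ → k) (Ψ : List A → k) (a : A) (w : List A) :
    lmul (letterSeries x p) Ψ (a :: w) = p 0 * Ψ (a :: w) +
      if a = x then lmul (letterSeries x fun n => p (n + 1)) Ψ w else 0 := by
  rw [lmul_cons]
  by_cases h : a = x <;> simp [h, letterSeries_cons, lmul_zero_left]

/-- Left multiplication by a power series in `x` does not change the coefficients at words that do
not start with `x`, up to the constant term. -/
theorem lmul_letterSeries_of_head (x : A) (p : ℕ → k) (Ψ : List A → k) (w : List A)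
    (h : w.head? ≠ some x) : lmul (letterSeries x p) Ψ w = p 0 * Ψ w := by
  cases w with
  | nil => rfl
  | cons a w => rw [lmul_letterSeries_cons, if_neg (by simpa using h), add_zero]

theorem lmul_letterSeries_letterSeries (x : A) (p q : ℕ → k) :
    lmul (letterSeries x p) (letterSeries x q) =
      letterSeries x fun n => ∑ ij ∈ antidiagonal n, p ij.1 * q ij.2 := by
  funext w
  induction w generalizing p with
  | nil => simp
  | cons a w ih =>
    rw [lmul_letterSeries_cons, letterSeries_cons, letterSeries_cons]
    by_cases h : a = x
    · simp only [h, if_true, ih, Finset.Nat.antidiagonal_succ, Finset.sum_cons, Finset.sum_map]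
      rw [letterSeries_add, letterSeries_smul]; rfl
    · simp [h]

/-- The restriction of `p • Ψ` to powers of `x`. -/
theorem lmul_letterSeries_replicate (x : A) (p : ℕ → k) (Ψ : List A → k) (n : ℕ) :
    lmul (letterSeries x p) Ψ (List.replicate n x) =
      ∑ ij ∈ antidiagonal n, p ij.1 * Ψ (List.replicate ij.2 x) := by
  induction n generalizing p with
  | zero => simp
  | succ n ih =>
    rw [List.replicate_succ, lmul_letterSeries_cons, if_pos rfl, ih,
      Finset.Nat.antidiagonal_succ, Finset.sum_cons, Finset.sum_map]
    simp [List.replicate_succ]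

/-- The series `∑ p_m x^m` attached to a power series `p`. -/
def powSeries (x : A) (p : PowerSeries k) : List A → k := letterSeries x fun n => p.coeff n

theorem lmul_powSeries (x : A) (p q : PowerSeries k) :
    lmul (powSeries x p) (powSeries x q) = powSeries x (p * q) := by
  simp only [powSeries, lmul_letterSeries_letterSeries, PowerSeries.coeff_mul]

theorem one_eq_powSeries (x : A) : (one : Series k A) = powSeries x (1 : PowerSeries k) := by
  have h : ∀ w : List A, w ≠ [] → 0 = powSeries x (1 : PowerSeries k) w := by
    intro w hw
    rw [powSeries, letterSeries_eq_ite, PowerSeries.coeff_one,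
      if_neg (mt List.length_eq_zero_iff.1 hw), ite_self]
  funext w
  unfold one
  split_ifs with hw
  · subst hw
    exact (PowerSeries.coeff_zero_one (R := k)).symm
  · exact h w hw

theorem lmul_one_left (x : A) (Ψ : List A → k) : lmul (powSeries x 1) Ψ = Ψ := by
  funext w
  cases w with
  | nil => simp [powSeries]
  | cons a w =>
    rw [powSeries, lmul_letterSeries_cons]
    simp [PowerSeries.coeff_one, letterSeries_zero, lmul_zero_left]

theorem pow_powSeries (x : A) (p : PowerSeries k) (m : ℕ) :
    pow (powSeries x p : Series k A) m = powSeries x (p ^ m) := by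
  induction m with
  | zero => rw [pow_zero]; exact one_eq_powSeries x
  | succ m ih =>
    have h : pow (powSeries x p : Series k A) (m + 1) =
      mul (pow (powSeries x p : Series k A) m) (powSeries x p) := rfl
    rw [h, ih, pow_succ, ← lmul_powSeries]
    exact mul_eq_lmul _ _

/-- The exponential of a power series without constant term. -/
def expPS [Algebra ℚ k] (p : PowerSeries k) : PowerSeries k := PowerSeries.mk fun n =>
  ∑ m ∈ Finset.range (n + 1), algebraMap ℚ k (1 / (m.factorial : ℚ)) * (p ^ m).coeff n

theorem exp_powSeries [Algebra ℚ k] (x : A) (p : PowerSeries k) :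
    exp (powSeries x p : Series k A) = powSeries x (expPS p) := by
  have h : ∀ w : List A, ∑ m ∈ Finset.range (w.length + 1),
      algebraMap ℚ k (1 / (m.factorial : ℚ)) * powSeries x (p ^ m) w = powSeries x (expPS p) w := by
    intro w
    simp only [powSeries, letterSeries_eq_ite, expPS, PowerSeries.coeff_mk]
    split_ifs <;> simp
  refine funext fun w => Eq.trans ?_ (h w)
  refine Finset.sum_congr rfl fun m _ => congrArg _ (congrFun (pow_powSeries x p m) w)

theorem coeff_pow_eq_zero (p : PowerSeries k) (hp : p.coeff 0 = 0) {m n : ℕ} (h : n < m) :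
    (p ^ m).coeff n = 0 := by
  refine PowerSeries.coeff_of_lt_order _ ?_
  have h1 : (1 : ℕ∞) ≤ p.order := by
    rw [PowerSeries.one_le_order_iff_constCoeff_eq_zero]; simpa using hp
  calc (n : ℕ∞) < m := by exact_mod_cast h
    _ ≤ m • p.order := by simpa using mul_le_mul_right h1 (m : ℕ∞)
    _ ≤ _ := PowerSeries.le_order_pow _ _

/-- The differential equation `E' = p' E` satisfied by `E = exp p`. -/
theorem succ_mul_coeff_expPS [Algebra ℚ k] (p : PowerSeries k) (hp : p.coeff 0 = 0) (n : ℕ) :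
    ((n : k) + 1) * (expPS p).coeff (n + 1) = ∑ ij ∈ antidiagonal n,
      ((ij.1 : k) + 1) * p.coeff (ij.1 + 1) * (expPS p).coeff ij.2 := by
  have hder : ∀ m : ℕ, (p ^ (m + 1)).coeff (n + 1) * ((n : k) + 1) = ((m : k) + 1) *
      ∑ ij ∈ antidiagonal n, ((ij.1 : k) + 1) * p.coeff (ij.1 + 1) * (p ^ m).coeff ij.2 := by
    intro m
    have := congrArg (PowerSeries.coeff n) (Derivation.leibniz_pow (PowerSeries.derivative k) p (m + 1))
    rw [PowerSeries.coeff_derivative] at this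
    rw [this, Nat.add_sub_cancel, nsmul_eq_mul, smul_eq_mul, mul_comm (p ^ m)]
    rw [← map_natCast (PowerSeries.C (R := k)), PowerSeries.coeff_C_mul, PowerSeries.coeff_mul]
    push_cast
    congr 1
    refine Finset.sum_congr rfl fun ij _ => ?_
    rw [PowerSeries.coeff_derivative]; ring
  have hE : ∀ j ≤ n, (expPS p).coeff j = ∑ m ∈ Finset.range (n + 1),
      algebraMap ℚ k (1 / (m.factorial : ℚ)) * (p ^ m).coeff j := by
    intro j hj
    rw [expPS, PowerSeries.coeff_mk]
    -- The truncation in `expPS` depends on the degree. All degrees up to $n$ can share the range of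
    -- degree $n$, since $p^m$ has order at least $m$.
    refine Finset.sum_subset (by intro i; simp; omega) fun m _ hm => ?_
    rw [coeff_pow_eq_zero p hp (by simpa using hm), mul_zero]
  have hfac : ∀ m : ℕ, algebraMap ℚ k (1 / ((m + 1).factorial : ℚ)) * ((m : k) + 1) =
      algebraMap ℚ k (1 / (m.factorial : ℚ)) := by
    intro m
    have : ((m : k) + 1) = algebraMap ℚ k ((m : ℚ) + 1) := by simp
    rw [this, ← map_mul]
    congr 1
    have : (m.factorial : ℚ) ≠ 0 := by exact_mod_cast m.factorial_ne_zero
    rw [Nat.factorial_succ]; push_cast; field_simp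
  rw [expPS, PowerSeries.coeff_mk, ← expPS, Finset.sum_range_succ', pow_zero, PowerSeries.coeff_one,
    if_neg (by omega), mul_zero, add_zero, Finset.mul_sum]
  trans ∑ ij ∈ antidiagonal n, ((ij.1 : k) + 1) * p.coeff (ij.1 + 1) * ∑ m ∈ Finset.range (n + 1),
      algebraMap ℚ k (1 / (m.factorial : ℚ)) * (p ^ m).coeff ij.2
  swap
  · refine Finset.sum_congr rfl fun ij hij => ?_
    rw [hE ij.2 (by have := Finset.HasAntidiagonal.mem_antidiagonal.1 hij; omega)]
  simp only [Finset.mul_sum]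
  rw [Finset.sum_comm]
  refine Finset.sum_congr rfl fun m _ => ?_
  rw [mul_left_comm, mul_comm _ (PowerSeries.coeff _ _), hder, ← mul_assoc, hfac, Finset.mul_sum]
  refine Finset.sum_congr rfl fun ij _ => by ring

theorem coeff_zero_expPS [Algebra ℚ k] (p : PowerSeries k) : (expPS p).coeff 0 = 1 := by
  simp [expPS]

end Words

/-! ### Quasi-shuffles and group-like functions on words. -/

section QuasiShuffle

variable {k A : Type*} [CommRing k]

/-- The quasi-shuffle product of two words, as a list of words, for a partially defined contraction
`m` of pairs of letters. -/
def qsh (m : A → A → Option A) : List A → List A → List (List A)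
  | [], v => [v]
  | a :: u, [] => [a :: u]
  | a :: u, b :: v => (qsh m u (b :: v)).map (a :: ·) ++ ((qsh m (a :: u) v).map (b :: ·) ++
      (m a b).elim [] fun c => (qsh m u v).map (c :: ·))
termination_by u v => u.length + v.length

/-- The pairing of a series with the quasi-shuffle product of two words. -/
def qshPair (m : A → A → Option A) (Φ : List A → k) (u v : List A) : k := ((qsh m u v).map Φ).sum

variable (m : A → A → Option A)

@[simp] theorem qsh_nil_left (v : List A) : qsh m [] v = [v] := by rw [qsh]

@[simp] theorem qsh_nil_right (u : List A) : qsh m u [] = [u] := by cases u <;> rw [qsh]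

theorem qsh_cons_cons (a b : A) (u v : List A) : qsh m (a :: u) (b :: v) =
    (qsh m u (b :: v)).map (a :: ·) ++ ((qsh m (a :: u) v).map (b :: ·) ++
      (m a b).elim [] fun c => (qsh m u v).map (c :: ·)) := by rw [qsh]

@[simp] theorem qshPair_nil_left (Φ : List A → k) (v : List A) : qshPair m Φ [] v = Φ v := by
  simp [qshPair]

@[simp] theorem qshPair_nil_right (Φ : List A → k) (u : List A) : qshPair m Φ u [] = Φ u := by
  simp [qshPair]

theorem qshPair_cons_cons (Φ : List A → k) (a b : A) (u v : List A) :
    qshPair m Φ (a :: u) (b :: v) = qshPair m (fun w => Φ (a :: w)) u (b :: v) +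
      (qshPair m (fun w => Φ (b :: w)) (a :: u) v +
      (m a b).elim 0 fun c => qshPair m (fun w => Φ (c :: w)) u v) := by
  simp only [qshPair, qsh_cons_cons, List.map_append, List.sum_append, List.map_map]
  cases m a b <;> simp [Function.comp_def]

theorem qshPair_add (Φ Ψ : List A → k) (u v : List A) :
    qshPair m (fun w => Φ w + Ψ w) u v = qshPair m Φ u v + qshPair m Ψ u v := by
  simp [qshPair, List.sum_map_add]

theorem qshPair_smul (c : k) (Φ : List A → k) (u v : List A) :
    qshPair m (fun w => c * Φ w) u v = c * qshPair m Φ u v := by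
  simp [qshPair, List.sum_map_mul_left]

theorem qshPair_zero (u v : List A) : qshPair m (fun _ => (0 : k)) u v = 0 := by
  simp [qshPair]

/-- Multiplicativity of the dual coproduct. -/
theorem qshPair_lmul (Φ Ψ : List A → k) (u v : List A) :
    qshPair m (lmul Φ Ψ) u v = splitSum (fun u₁ u₂ =>
      splitSum (fun v₁ v₂ => qshPair m Φ u₁ v₁ * qshPair m Ψ u₂ v₂) v) u := by
  match u, v with
  | [], v => simp [splitSum, lmul]
  | a :: u, [] => simp [splitSum, lmul]
  | a :: u, b :: v =>
    have hd : ∀ c, (fun w => lmul Φ Ψ (c :: w)) =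
        fun w => Φ [] * Ψ (c :: w) + lmul (fun w => Φ (c :: w)) Ψ w := fun c => rfl
    have h1 := fun Φ => qshPair_lmul Φ Ψ u (b :: v)
    have h2 := fun Φ => qshPair_lmul Φ Ψ (a :: u) v
    have h3 := fun Φ => qshPair_lmul Φ Ψ u v
    have hm : ((m a b).elim 0 fun c => qshPair m (fun w => lmul Φ Ψ (c :: w)) u v) =
        Φ [] * ((m a b).elim 0 fun c => qshPair m (fun w => Ψ (c :: w)) u v) +
        splitSum (fun u₁ u₂ => splitSum (fun v₁ v₂ =>
          ((m a b).elim 0 fun c => qshPair m (fun w => Φ (c :: w)) u₁ v₁) *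
            qshPair m Ψ u₂ v₂) v) u := by
      cases m a b with
      | none => simp [splitSum_zero]
      | some c => simp only [Option.elim_some, hd, qshPair_add, qshPair_smul, h3]
    rw [qshPair_cons_cons, hm]
    simp only [hd, qshPair_add, qshPair_smul, h1, h2]
    simp only [splitSum, qshPair_nil_left, qshPair_nil_right, qshPair_cons_cons, splitSum_add,
      add_mul]
    ring
termination_by u.length + v.length

/-- Group-like functions on words. -/
def GroupLike (Φ : List A → k) : Prop := Φ [] = 1 ∧ ∀ u v, qshPair m Φ u v = Φ u * Φ v

variable {m}

theorem GroupLike.lmul {Φ Ψ : List A → k} (hΦ : GroupLike m Φ) (hΨ : GroupLike m Ψ) :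
    GroupLike m (lmul Φ Ψ) := by
  refine ⟨by simp [hΦ.1, hΨ.1], fun u v => ?_⟩
  rw [qshPair_lmul]
  have : ∀ u₁ u₂ v₁ v₂, qshPair m Φ u₁ v₁ * qshPair m Ψ u₂ v₂ =
      (Φ u₁ * Ψ u₂) * (Φ v₁ * Ψ v₂) := fun u₁ u₂ v₁ v₂ => by rw [hΦ.2, hΨ.2]; ring
  simp only [this, splitSum_mul_left, splitSum_mul_right]
  rfl

/-- As no contraction produces `x`, only the honest shuffles of $x^i$ and $x^j$ contribute: there
are $\binom{i+j}i$ of them, all equal to $x^{i+j}$. The recursion is Pascal's rule. -/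
theorem qshPair_letterSeries {x : A} (hx : ∀ a b, m a b ≠ some x) (p : ℕ → k) (u v : List A) :
    qshPair m (letterSeries x p) u v =
      if u = List.replicate u.length x ∧ v = List.replicate v.length x then
        ((u.length + v.length).choose u.length : k) * p (u.length + v.length) else 0 := by
  match u, v with
  | [], v => simp [letterSeries_eq_ite]
  | a :: u, [] => simp [letterSeries_eq_ite]
  | a :: u, b :: v =>
    have hm : ((m a b).elim 0 fun c => qshPair m (fun w => letterSeries x p (c :: w)) u v) = 0 := by
      cases h : m a b with
      | none => rfl
      | some c =>
        have : c ≠ x := fun h' => hx a b (h' ▸ h)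
        simp [letterSeries_cons, this, qshPair_zero]
    have h1 := qshPair_letterSeries hx (fun n => p (n + 1)) u (b :: v)
    have h2 := qshPair_letterSeries hx (fun n => p (n + 1)) (a :: u) v
    rw [qshPair_cons_cons, hm, add_zero]
    simp only [letterSeries_cons]
    by_cases ha : a = x <;> by_cases hb : b = x <;>
      simp only [ha, hb, if_true, if_false, qshPair_zero, zero_add, add_zero, List.length_cons,
        List.replicate_succ, List.cons.injEq, true_and, false_and, and_false]
    · rw [hb] at h1
      rw [ha] at h2
      rw [h1, h2]
      simp only [List.length_cons, List.replicate_succ, List.cons.injEq, true_and]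
      split_ifs with h
      · have e1 : u.length + (v.length + 1) = u.length + v.length + 1 := by ring
        have e2 : u.length + 1 + v.length = u.length + v.length + 1 := by ring
        have e3 : u.length + 1 + (v.length + 1) = u.length + v.length + 1 + 1 := by ring
        rw [e1, e2, e3, Nat.choose_succ_succ (u.length + v.length + 1)]
        push_cast
        ring
      · simp
    · rw [h1, if_neg (by simp [List.replicate_succ, hb])]
    · rw [h2, if_neg (by simp [List.replicate_succ, ha])]
termination_by u.length + v.length

/-- The coefficients of `exp(c x)`. -/
def expCoeff [Algebra ℚ k] (c : k) (n : ℕ) : k := algebraMap ℚ k (1 / (n.factorial : ℚ)) * c ^ n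

theorem algebraMap_inv_factorial_mul_choose [Algebra ℚ k] (i j : ℕ) :
    algebraMap ℚ k (1 / ((i + j).factorial : ℚ)) * ((i + j).choose i : k) =
      algebraMap ℚ k (1 / (i.factorial : ℚ)) * algebraMap ℚ k (1 / (j.factorial : ℚ)) := by
  rw [← map_natCast (algebraMap ℚ k), ← map_mul, ← map_mul]
  congr 1
  have h0 : ∀ n : ℕ, (n.factorial : ℚ) ≠ 0 := fun n => by exact_mod_cast n.factorial_ne_zero
  have := h0 i; have := h0 j; have := h0 (i + j)
  field_simp
  rw [Nat.choose_symm_add]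
  exact_mod_cast Nat.add_choose_mul_factorial_mul_factorial i j

theorem choose_mul_expCoeff [Algebra ℚ k] (c : k) (i j : ℕ) :
    ((i + j).choose i : k) * expCoeff c (i + j) = expCoeff c i * expCoeff c j := by
  have h := algebraMap_inv_factorial_mul_choose (k := k) i j
  simp only [expCoeff]
  linear_combination c ^ (i + j) * h

/-- By the binomial count, the condition on powers of `x` is $\binom{i+j}ip_{i+j}=p_ip_j$, satisfied
by $c^n/n!$. Multiplying by this factor changes the coefficient at `x` without leaving the
group-like functions. -/
theorem groupLike_letterSeries_expCoeff [Algebra ℚ k] {x : A} (hx : ∀ a b, m a b ≠ some x) (c : k) :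
    GroupLike m (letterSeries x (expCoeff c)) := by
  refine ⟨by simp [expCoeff], fun u v => ?_⟩
  rw [qshPair_letterSeries hx, letterSeries_eq_ite, letterSeries_eq_ite]
  rw [ite_zero_mul_ite_zero, choose_mul_expCoeff]

theorem sum_antidiagonal_expCoeff [Algebra ℚ k] (c d : k) (n : ℕ) :
    ∑ ij ∈ antidiagonal n, expCoeff c ij.1 * expCoeff d ij.2 = expCoeff (c + d) n := by
  rw [expCoeff, add_pow, Finset.mul_sum, Finset.Nat.sum_antidiagonal_eq_sum_range_succ_mk]
  refine Finset.sum_congr rfl fun i hi => ?_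
  obtain ⟨j, rfl⟩ := Nat.exists_eq_add_of_le (Nat.lt_succ_iff.1 (Finset.mem_range.1 hi))
  have h := algebraMap_inv_factorial_mul_choose (k := k) i j
  simp only [expCoeff, Nat.add_sub_cancel_left]
  linear_combination -(c ^ i * d ^ j) * h

theorem expCoeff_mul_expCoeff [Algebra ℚ k] (x : A) (c d : k) :
    lmul (letterSeries x (expCoeff c)) (letterSeries x (expCoeff d)) =
      letterSeries x (expCoeff (c + d)) := by
  rw [lmul_letterSeries_letterSeries]
  exact congrArg _ (funext fun n => sum_antidiagonal_expCoeff c d n)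

theorem lmul_expCoeff_zero [Algebra ℚ k] (x : A) (Ψ : List A → k) :
    lmul (letterSeries x (expCoeff 0)) Ψ = Ψ := by
  have : (expCoeff (0 : k)) = fun n => (1 : PowerSeries k).coeff n := by
    funext n; cases n <;> simp [expCoeff, PowerSeries.coeff_one]
  rw [this]; exact lmul_one_left x Ψ

end QuasiShuffle

/-! ### Coproducts of series as pairings with quasi-shuffles. -/

section Coproduct

open FreeMonoid (ofList of)

variable {k A : Type*} [CommRing k]

/-- `f` is the coproduct on letters dual to the quasi-shuffle product of contraction `m`. -/
def IsDualTo (m : A → A → Option A)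
    (f : A → MonoidAlgebra k (FreeMonoid A × FreeMonoid A)) : Prop :=
  ∀ (c : A) (Z : MonoidAlgebra k (FreeMonoid A × FreeMonoid A)),
    (f c * Z).coeff (ofList [], ofList []) = 0 ∧
    (∀ a u, (f c * Z).coeff (ofList (a :: u), ofList []) =
      if a = c then Z.coeff (ofList u, ofList []) else 0) ∧
    (∀ b v, (f c * Z).coeff (ofList [], ofList (b :: v)) =
      if b = c then Z.coeff (ofList [], ofList v) else 0) ∧
    ∀ a u b v, (f c * Z).coeff (ofList (a :: u), ofList (b :: v)) =
      (if a = c then Z.coeff (ofList u, ofList (b :: v)) else 0) +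
      ((if b = c then Z.coeff (ofList (a :: u), ofList v) else 0) +
      if m a b = some c then Z.coeff (ofList u, ofList v) else 0)

theorem count_cons_map (a c : A) (w : List A) (l : List (List A)) :
    (l.map (a :: ·)).count (c :: w) = if a = c then l.count w else 0 := by
  split_ifs with h
  · subst h
    exact List.count_map_of_injective l _ (List.cons_injective) w
  · rw [List.count_eq_zero]
    simp [h]

theorem count_nil_map (a : A) (l : List (List A)) : (l.map (a :: ·)).count [] = 0 := by
  rw [List.count_eq_zero]; simp

/-- Removing the first letter `c` of `w` removes a factor `f c`. By `IsDualTo`, coefficients then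
follow the three branches of the quasi-shuffle recursion: `c` comes from `u`, from `v`, or from a
contraction. -/
theorem coeff_lift_eq_count {m : A → A → Option A}
    {f : A → MonoidAlgebra k (FreeMonoid A × FreeMonoid A)} (hf : IsDualTo m f)
    (w u v : List A) :
    (FreeMonoid.lift f (ofList w)).coeff (ofList u, ofList v) = ((qsh m u v).count w : k) := by
  induction w generalizing u v with
  | nil =>
    have h1 : FreeMonoid.lift f (ofList []) = 1 := map_one _
    rw [h1, MonoidAlgebra.one_def, MonoidAlgebra.coeff_single, Finsupp.single_apply]
    rcases u with _ | ⟨a, u⟩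
    · rcases v with _ | ⟨b, v⟩
      · rw [if_pos (show (1 : FreeMonoid A × FreeMonoid A) = (ofList [], ofList []) from rfl)]; simp
      · rw [if_neg (fun h => List.cons_ne_nil b v (Prod.ext_iff.1 h).2.symm)]; simp
    · rw [if_neg (fun h => List.cons_ne_nil a u (Prod.ext_iff.1 h).1.symm)]
      rcases v with _ | ⟨b, v⟩
      · simp
      · rw [qsh_cons_cons]
        cases m a b <;> simp [List.count_append, count_nil_map]
  | cons c w ih =>
    rw [FreeMonoid.ofList_cons, map_mul, FreeMonoid.lift_eval_of]
    obtain ⟨h1, h2, h3, h4⟩ := hf c (FreeMonoid.lift f (ofList w))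
    rcases u with _ | ⟨a, u⟩
    · rcases v with _ | ⟨b, v⟩
      · rw [h1]; simp
      · rw [h3, ih]; simp [List.count_cons]; split_ifs <;> simp_all
    · rcases v with _ | ⟨b, v⟩
      · rw [h2, ih]; simp [List.count_cons]; split_ifs <;> simp_all
      · rw [h4, ih, ih, ih, qsh_cons_cons, List.count_append, List.count_append, count_cons_map,
          count_cons_map]
        cases h : m a b with
        | none => simp
        | some d => simp [count_cons_map]

theorem extend_eq_qshPair {m : A → A → Option A}
    {f : A → MonoidAlgebra k (FreeMonoid A × FreeMonoid A)} (hf : IsDualTo m f)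
    (Φ : Series k A) (u v : List A) :
    extend f Φ (ofList u, ofList v) = qshPair (A := A) m Φ u v := by
  unfold extend qshPair
  refine Eq.trans ?_ (Finset.sum_list_map_count (qsh m u v) (M := k) Φ).symm
  trans ∑ᶠ w : List A, Φ (ofList w) * ((qsh m u v).count w : k)
  · exact finsum_congr fun w => congrArg _ (coeff_lift_eq_count hf w u v)
  · rw [finsum_eq_sum_of_support_subset (s := (qsh m u v).toFinset)]
    · refine Finset.sum_congr rfl fun w _ => ?_
      rw [nsmul_eq_mul, mul_comm, lawful_beq_subsingleton (List.instBEq : BEq (List A))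
        instBEqOfDecidableEq]
      rfl
    · intro w hw
      by_contra h
      apply hw
      have : w ∉ qsh m u v := by simpa using h
      simp [List.count_eq_zero_of_not_mem this]

theorem isGroupLike_iff {m : A → A → Option A}
    {f : A → MonoidAlgebra k (FreeMonoid A × FreeMonoid A)} (hf : IsDualTo m f) (Φ : Series k A) :
    IsGroupLike f Φ ↔ GroupLike (A := A) m Φ := by
  refine and_congr Iff.rfl (forall₂_congr fun u v => ?_)
  have := extend_eq_qshPair hf Φ u v
  exact ⟨fun h => this.symm.trans h, fun h => this.trans h⟩

theorem tens_single (u v : FreeMonoid A) (r s : k) :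
    tens (MonoidAlgebra.single u r) (MonoidAlgebra.single v s) =
      MonoidAlgebra.single (u, v) (r * s) := by
  simp [tens, MonoidAlgebra.single_mul_single]

theorem coeff_single_mul_cons (x y : FreeMonoid A × FreeMonoid A)
    (Z : MonoidAlgebra k (FreeMonoid A × FreeMonoid A)) :
    (MonoidAlgebra.single x 1 * Z).coeff (x * y) = Z.coeff y := by
  rw [MonoidAlgebra.coeff_single_mul_eq_mul_coeff y, one_mul]
  exact fun m' _ => mul_right_inj x

theorem coeff_left_letter_nil (a : A) (v : List A)
    (Z : MonoidAlgebra k (FreeMonoid A × FreeMonoid A)) :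
    (tens (gen a) 1 * Z).coeff (ofList [], ofList v) = 0 := by
  rw [gen, MonoidAlgebra.one_def, tens_single, mul_one]
  refine MonoidAlgebra.coeff_single_mul_of_forall_mul_ne _ _ fun d h => ?_
  exact List.cons_ne_nil _ _ (Prod.ext_iff.1 h).1

theorem coeff_left_letter_cons (c a : A) (u v : List A)
    (Z : MonoidAlgebra k (FreeMonoid A × FreeMonoid A)) :
    (tens (gen c) 1 * Z).coeff (ofList (a :: u), ofList v) =
      if a = c then Z.coeff (ofList u, ofList v) else 0 := by
  rw [gen, MonoidAlgebra.one_def, tens_single, mul_one]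
  split_ifs with h
  · subst h
    exact coeff_single_mul_cons (of a, 1) (ofList u, ofList v) Z
  · refine MonoidAlgebra.coeff_single_mul_of_forall_mul_ne _ _ fun d h' => h ?_
    exact (List.cons.inj (Prod.ext_iff.1 h').1).1.symm

theorem coeff_right_letter_nil (a : A) (u : List A)
    (Z : MonoidAlgebra k (FreeMonoid A × FreeMonoid A)) :
    (tens 1 (gen a) * Z).coeff (ofList u, ofList []) = 0 := by
  rw [gen, MonoidAlgebra.one_def, tens_single, mul_one]
  refine MonoidAlgebra.coeff_single_mul_of_forall_mul_ne _ _ fun d h => ?_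
  exact List.cons_ne_nil _ _ (Prod.ext_iff.1 h).2

theorem coeff_right_letter_cons (c b : A) (u v : List A)
    (Z : MonoidAlgebra k (FreeMonoid A × FreeMonoid A)) :
    (tens 1 (gen c) * Z).coeff (ofList u, ofList (b :: v)) =
      if b = c then Z.coeff (ofList u, ofList v) else 0 := by
  rw [gen, MonoidAlgebra.one_def, tens_single, mul_one]
  split_ifs with h
  · subst h
    exact coeff_single_mul_cons (1, of b) (ofList u, ofList v) Z
  · refine MonoidAlgebra.coeff_single_mul_of_forall_mul_ne _ _ fun d h' => h ?_
    exact (List.cons.inj (Prod.ext_iff.1 h').2).1.symm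

theorem coeff_both_letters_nil_left (c d : A) (v : List A)
    (Z : MonoidAlgebra k (FreeMonoid A × FreeMonoid A)) :
    (tens (gen c) (gen d) * Z).coeff (ofList [], ofList v) = 0 := by
  rw [gen, gen, tens_single, mul_one]
  refine MonoidAlgebra.coeff_single_mul_of_forall_mul_ne _ _ fun d h => ?_
  exact List.cons_ne_nil _ _ (Prod.ext_iff.1 h).1

theorem coeff_both_letters_nil_right (c d : A) (u : List A)
    (Z : MonoidAlgebra k (FreeMonoid A × FreeMonoid A)) :
    (tens (gen c) (gen d) * Z).coeff (ofList u, ofList []) = 0 := by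
  rw [gen, gen, tens_single, mul_one]
  refine MonoidAlgebra.coeff_single_mul_of_forall_mul_ne _ _ fun d h => ?_
  exact List.cons_ne_nil _ _ (Prod.ext_iff.1 h).2

theorem coeff_both_letters_cons (c d a b : A) (u v : List A)
    (Z : MonoidAlgebra k (FreeMonoid A × FreeMonoid A)) :
    (tens (gen c) (gen d) * Z).coeff (ofList (a :: u), ofList (b :: v)) =
      if a = c ∧ b = d then Z.coeff (ofList u, ofList v) else 0 := by
  rw [gen, gen, tens_single, mul_one]
  split_ifs with h
  · obtain ⟨rfl, rfl⟩ := h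
    exact coeff_single_mul_cons (of a, of b) (ofList u, ofList v) Z
  · refine MonoidAlgebra.coeff_single_mul_of_forall_mul_ne _ _ fun d h' => h ?_
    exact ⟨(List.cons.inj (Prod.ext_iff.1 h').1).1.symm, (List.cons.inj (Prod.ext_iff.1 h').2).1.symm⟩

end Coproduct

/-! ### The coproducts $\Delta$ and $\Delta_*$ in this framework. -/

section Deltas

/-- The contraction of the shuffle product. -/
def noContraction {A : Type*} (_ _ : A) : Option A := none

theorem isDualTo_delta {Γ k : Type*} [CommRing k] :
    IsDualTo noContraction (delta (Γ := Γ) (k := k)) := by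
  refine fun c Z => ⟨?_, fun a u => ?_, fun b v => ?_, fun a u b v => ?_⟩ <;>
  simp only [delta, add_mul, MonoidAlgebra.coeff_add, Finsupp.add_apply, coeff_left_letter_nil,
    coeff_left_letter_cons, coeff_right_letter_nil, coeff_right_letter_cons, add_zero, zero_add,
    noContraction, reduceCtorEq, if_false]
  exact add_comm _ _

variable {Γ : Type*} [CommGroup Γ] {k : Type*} [CommRing k]

/-- The contraction of the quasi-shuffle product of `Y`. -/
def yContraction (a b : Y Γ) : Option (Y Γ) := some (a.1 + b.1, a.2 * b.2)

/-- In the extreme terms $i=0$ and $i=s$ the convention on $y_{0,\nu}$ leaves a single $\kappa$.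
These terms form the primitive part; the remaining ones have a genuine letter on both sides. -/
theorem deltaStar_eq [Fintype Γ] (p : Y Γ) : deltaStar (k := k) p =
    tens (gen p) 1 + tens 1 (gen p) + ∑ i ∈ Finset.Ico 1 (p.1 : ℕ), ∑ κ : Γ,
      tens (yPoly i κ) (yPoly ((p.1 : ℕ) - i) (κ⁻¹ * p.2)) := by
  obtain ⟨s, ν⟩ := p
  have hs : 0 < (s : ℕ) := s.pos
  unfold deltaStar
  simp only [finsum_eq_sum_of_fintype]
  rw [Finset.sum_range_succ, Finset.range_eq_Ico, Finset.sum_eq_sum_Ico_succ_bot hs]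
  have h0 : ∑ κ : Γ, tens (yPoly (k := k) 0 κ) (yPoly ((s : ℕ) - 0) (κ⁻¹ * ν)) =
      tens 1 (gen (s, ν)) := by
    rw [Finset.sum_eq_single 1]
    · simp [yPoly, hs]; rfl
    · intro κ _ hκ
      simp [yPoly, hκ, tens]
    · simp
  have h1 : ∑ κ : Γ, tens (yPoly (k := k) s κ) (yPoly ((s : ℕ) - s) (κ⁻¹ * ν)) =
      tens (gen (s, ν)) 1 := by
    rw [Finset.sum_eq_single ν]
    · simp [yPoly]; rfl
    · intro κ _ hκ
      have : κ⁻¹ * ν ≠ 1 := fun h => hκ (inv_mul_eq_one.1 h)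
      simp [yPoly, this, tens]
    · simp
  rw [h0, h1]
  abel

theorem yPoly_of_pos (n : ℕ) (h : 0 < n) (ν : Γ) : yPoly (k := k) n ν = gen (⟨n, h⟩, ν) := by
  rw [yPoly, dif_pos h]

theorem coeff_sum_apply {ι M : Type*} (s : Finset ι) (g : ι → MonoidAlgebra k M) (x : M) :
    (∑ i ∈ s, g i).coeff x = ∑ i ∈ s, (g i).coeff x := by
  induction s using Finset.induction_on with
  | empty => rfl
  | insert i s hi ih => rw [Finset.sum_insert hi, Finset.sum_insert hi, ← ih]; rfl

theorem isDualTo_deltaStar [Finite Γ] :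
    IsDualTo yContraction (deltaStar (Γ := Γ) (k := k)) := by
  have := Fintype.ofFinite Γ
  have hl : ∀ (c : Y Γ) (Z : MonoidAlgebra k (FreeMonoid (Y Γ) × FreeMonoid (Y Γ))) (x),
      (deltaStar c * Z).coeff x = (tens (gen c) 1 * Z).coeff x + (tens 1 (gen c) * Z).coeff x +
      ∑ i ∈ Finset.Ico 1 (c.1 : ℕ), ∑ κ : Γ,
        (tens (yPoly i κ) (yPoly ((c.1 : ℕ) - i) (κ⁻¹ * c.2)) * Z).coeff x := by
    intro c Z x
    rw [deltaStar_eq, add_mul, add_mul, Finset.sum_mul]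
    simp only [Finset.sum_mul, MonoidAlgebra.coeff_add, Finsupp.add_apply, coeff_sum_apply]
  have hgen : ∀ (c : Y Γ) (i : ℕ) (hi : i ∈ Finset.Ico 1 (c.1 : ℕ)) (κ : Γ),
      tens (yPoly (k := k) i κ) (yPoly ((c.1 : ℕ) - i) (κ⁻¹ * c.2)) =
        tens (gen (⟨i, (Finset.mem_Ico.1 hi).1⟩, κ))
          (gen (⟨(c.1 : ℕ) - i, Nat.sub_pos_of_lt (Finset.mem_Ico.1 hi).2⟩, κ⁻¹ * c.2)) := by
    intro c i hi κ
    rw [yPoly_of_pos, yPoly_of_pos]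
  refine fun c Z => ⟨?_, fun a u => ?_, fun b v => ?_, fun a u b v => ?_⟩
  · rw [hl, coeff_left_letter_nil, coeff_right_letter_nil, Finset.sum_eq_zero, add_zero, add_zero]
    intro i hi
    exact Finset.sum_eq_zero fun κ _ => by rw [hgen c i hi, coeff_both_letters_nil_left]
  · rw [hl, coeff_left_letter_cons, coeff_right_letter_nil, Finset.sum_eq_zero, add_zero, add_zero]
    intro i hi
    exact Finset.sum_eq_zero fun κ _ => by rw [hgen c i hi, coeff_both_letters_nil_right]
  · rw [hl, coeff_left_letter_nil, coeff_right_letter_cons, Finset.sum_eq_zero, add_zero, zero_add]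
    intro i hi
    exact Finset.sum_eq_zero fun κ _ => by rw [hgen c i hi, coeff_both_letters_nil_left]
  · rw [hl, coeff_left_letter_cons, coeff_right_letter_cons, add_assoc]
    congr 2
    obtain ⟨s, ν⟩ := c
    obtain ⟨⟨i, hi⟩, κ⟩ := a
    obtain ⟨⟨j, hj⟩, l⟩ := b
    obtain ⟨s, hs⟩ := s
    -- The pair of letters `a`, `b` can only come from the summand whose index is the weight and
    -- character of `a`, and it does so exactly when it contracts to `c`.
    by_cases h : yContraction ((⟨i, hi⟩, κ) : Y Γ) (⟨j, hj⟩, l) = some (⟨s, hs⟩, ν)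
    · rw [if_pos h]
      obtain ⟨h1, h2⟩ := Prod.ext_iff.1 (Option.some.inj h)
      have h1' : i + j = s := congrArg PNat.val h1
      have h2' : κ * l = ν := h2
      have hmem : i ∈ Finset.Ico 1 s := Finset.mem_Ico.2 ⟨hi, by omega⟩
      rw [Finset.sum_eq_single i, Finset.sum_eq_single κ]
      · rw [hgen (⟨s, hs⟩, ν) i hmem, coeff_both_letters_cons, if_pos]
        refine ⟨rfl, Prod.ext (PNat.eq ?_) ?_⟩
        · exact (by omega : j = s - i)
        · exact (by rw [← h2']; group : l = κ⁻¹ * ν)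
      · intro κ' _ hne
        rw [hgen (⟨s, hs⟩, ν) i hmem, coeff_both_letters_cons, if_neg]
        rintro ⟨h, -⟩
        exact hne (Prod.ext_iff.1 h).2.symm
      · simp
      · intro i' hi' hne
        refine Finset.sum_eq_zero fun κ' _ => ?_
        rw [hgen (⟨s, hs⟩, ν) i' hi', coeff_both_letters_cons, if_neg]
        rintro ⟨h, -⟩
        exact hne (congrArg PNat.val (Prod.ext_iff.1 h).1).symm
      · exact fun h => (h hmem).elim
    · rw [if_neg h]
      refine Finset.sum_eq_zero fun i' hi' => Finset.sum_eq_zero fun κ' _ => ?_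
      rw [hgen (⟨s, hs⟩, ν) i' hi', coeff_both_letters_cons, if_neg]
      rintro ⟨h1, h2⟩
      apply h
      have e1 : i = i' := congrArg PNat.val (Prod.ext_iff.1 h1).1
      have e2 : j = s - i' := congrArg PNat.val (Prod.ext_iff.1 h2).1
      have e3 : κ = κ' := (Prod.ext_iff.1 h1).2
      have e4 : l = κ'⁻¹ * ν := (Prod.ext_iff.1 h2).2
      have := Finset.mem_Ico.1 hi'
      refine congrArg some (Prod.ext (PNat.eq ?_) ?_)
      · change i + j = s
        simp only at this
        change 1 ≤ i' ∧ i' < s at this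
        omega
      · change κ * l = ν
        rw [e4, e3]; group

end Deltas

/-! ### Regularisation: every word reduces linearly to convergent words. -/

section Regularisation

variable {k A : Type*} [Field k] {m : A → A → Option A} {x : A}

/-- The number of letters `x` at the beginning of a word. -/
def lead (x : A) : List A → ℕ
  | [] => 0
  | a :: w => if a = x then lead x w + 1 else 0

theorem lead_cons_of_ne {a : A} (h : a ≠ x) (w : List A) : lead x (a :: w) = 0 := if_neg h

theorem lead_cons_self (w : List A) : lead x (x :: w) = lead x w + 1 := if_pos rfl

/-- The quasi-shuffle product of a letter with a word. -/
theorem exists_qshPair_letter_eq (hx : ∀ a b, m a b ≠ some x) (w : List A) :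
    ∃ R : List (List A), (∀ Φ : List A → k, qshPair m Φ [x] w =
      ((lead x w : k) + 1) * Φ (x :: w) + (R.map Φ).sum) ∧
      ∀ w' ∈ R, w' ∈ qsh m [x] w ∧ lead x w' ≤ lead x w := by
  induction w with
  | nil => exact ⟨[], by simp [lead], by simp⟩
  | cons b v ih =>
    obtain ⟨R, hR, hR'⟩ := ih
    -- A contracted letter is never `x`, so contracted words have no leading `x`.
    have hC : ∃ C : List (List A),
        (∀ Φ : List A → k, ((m x b).elim 0 fun c => qshPair m (fun w => Φ (c :: w)) [] v) =
          (C.map Φ).sum) ∧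
        ∀ w' ∈ C, w' ∈ qsh m [x] (b :: v) ∧ lead x w' = 0 := by
      cases h : m x b with
      | none => exact ⟨[], by simp, by simp⟩
      | some c =>
        refine ⟨[c :: v], by simp, ?_⟩
        rintro w' hw'
        obtain rfl : w' = c :: v := by simpa using hw'
        exact ⟨by simp [qsh_cons_cons, h], lead_cons_of_ne (fun h' => hx x b (by rw [h, h'])) v⟩
    obtain ⟨C, hC, hC'⟩ := hC
    by_cases hb : b = x
    · refine ⟨R.map (x :: ·) ++ C, fun Φ => ?_, ?_⟩
      · rw [qshPair_cons_cons, hC, hR, hb, lead_cons_self]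
        simp [Function.comp_def]
        ring
      · intro w' hw'
        rcases List.mem_append.1 hw' with h | h
        · obtain ⟨w'', hw'', rfl⟩ := List.mem_map.1 h
          refine ⟨?_, ?_⟩
          · rw [qsh_cons_cons]
            exact List.mem_append_right _ (List.mem_append_left _
              (List.mem_map.2 ⟨w'', (hR' w'' hw'').1, by rw [hb]⟩))
          · rw [hb, lead_cons_self, lead_cons_self]
            exact Nat.succ_le_succ (hR' w'' hw'').2
        · exact ⟨(hC' w' h).1, (hC' w' h).2.le.trans (Nat.zero_le _)⟩
    · refine ⟨(qsh m [x] v).map (b :: ·) ++ C, fun Φ => ?_, ?_⟩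
      · rw [qshPair_cons_cons, hC, lead_cons_of_ne hb]
        simp [Function.comp_def, qshPair]
      · intro w' hw'
        rcases List.mem_append.1 hw' with h | h
        · refine ⟨?_, ?_⟩
          · rw [qsh_cons_cons]
            exact List.mem_append_right _ (List.mem_append_left _ h)
          · obtain ⟨w'', -, rfl⟩ := List.mem_map.1 h
            rw [lead_cons_of_ne hb]; exact Nat.zero_le _
        · exact ⟨(hC' w' h).1, (hC' w' h).2.le.trans (Nat.zero_le _)⟩

/-- Evaluation at a word, as a function on a set of series. -/
def evalAt (V : Set (List A → k)) (w : List A) : V → k := fun Φ => Φ.1 w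

theorem list_sum_evalAt_mem {V : Set (List A → k)} (p : Submodule k (V → k))
    (R : List (List A)) (h : ∀ w ∈ R, evalAt V w ∈ p) :
    (fun Φ : V => (R.map Φ.1).sum) ∈ p := by
  induction R with
  | nil => exact p.zero_mem
  | cons w R ih =>
    have := p.add_mem (h w (by simp)) (ih fun w hw => h w (by simp [hw]))
    simpa [evalAt, Pi.add_def] using this

/-- The constant `c` and the list `R` are the same for all members of `V`, so the relation can be
solved for the evaluation at `w` inside the space of functions on `V`. -/
theorem evalAt_mem_of_relation {V : Set (List A → k)} (p : Submodule k (V → k)) (w : List A)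
    (c : k) (hc : c ≠ 0) (R : List (List A)) (h : ∀ w ∈ R, evalAt V w ∈ p)
    (hrel : ∀ Φ ∈ V, 0 = c * Φ w + (R.map Φ).sum) : evalAt V w ∈ p := by
  have : evalAt V w = (-c⁻¹) • fun Φ : V => (R.map Φ.1).sum := by
    funext Φ
    have := hrel Φ.1 Φ.2
    simp only [evalAt, Pi.smul_apply, smul_eq_mul]
    rw [show (R.map Φ.1).sum = -(c * Φ.1 w) by linear_combination -this]
    field_simp
  rw [this]
  exact p.smul_mem _ (list_sum_evalAt_mem p R h)

/-- Regularisation at the first letter. -/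
theorem evalAt_mem_span_of_lead [CharZero k] (hx : ∀ a b, m a b ≠ some x) {V : Set (List A → k)}
    (hV : ∀ Φ ∈ V, GroupLike m Φ ∧ Φ [x] = 0) {D : Set (List A)}
    (hD : ∀ w, x :: w ∈ D → ∀ w' ∈ qsh m [x] w, w' ∈ D) (w : List A) (hw : w ∈ D) :
    evalAt V w ∈ Submodule.span k (evalAt V '' {w ∈ D | w.head? ≠ some x}) := by
  induction h : lead x w using Nat.strong_induction_on generalizing w with
  | _ n ih =>
    by_cases hh : w.head? = some x
    · obtain ⟨w, rfl⟩ : ∃ v, w = x :: v := by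
        cases w with
        | nil => simp at hh
        | cons a w => exact ⟨w, by simpa using hh⟩
      rw [lead_cons_self] at h
      obtain ⟨R, hR, hR'⟩ := exists_qshPair_letter_eq (k := k) hx w
      refine evalAt_mem_of_relation _ _ ((lead x w : k) + 1) (Nat.cast_add_one_ne_zero _)
        R (fun w' hw' => ?_) fun Φ hΦ => ?_
      -- The words of `R` have at most `lead x w` leading letters `x`, fewer than `x :: w`.
      · exact ih _ (by have := (hR' w' hw').2; omega) w' (hD w hw w' (hR' w' hw').1) rfl
      · rw [← hR, (hV Φ hΦ).1.2, (hV Φ hΦ).2, zero_mul]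
    · exact Submodule.subset_span ⟨w, ⟨hw, hh⟩, rfl⟩

/-- Inserting `x` in the final block of `n` letters `x` has `n + 1` positions, all with the same
result. Inserting it earlier, before the last letter of `w`, leaves exactly `n` final letters `x`.
This is the reduction at the right end. -/
theorem exists_qshPair_letter_append_eq (w : List A) (n : ℕ) (hw : w.getLast? ≠ some x) :
    ∃ R : List (List A), (∀ Φ : List A → k,
      qshPair noContraction Φ [x] (w ++ List.replicate n x) =
      ((n : k) + 1) * Φ (w ++ List.replicate (n + 1) x) + (R.map Φ).sum) ∧
      ∀ w' ∈ R, ∃ u, w' = u ++ List.replicate n x ∧ u ≠ [] ∧ u.getLast? ≠ some x := by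
  induction w with
  | nil =>
    refine ⟨[], fun Φ => ?_, by simp⟩
    induction n generalizing Φ with
    | zero => simp
    | succ n ih =>
      have := ih fun w => Φ (x :: w)
      simp only [List.nil_append, List.replicate_succ, List.map_nil, List.sum_nil, add_zero] at this ⊢
      rw [qshPair_cons_cons, this]
      simp [noContraction]
      ring
  | cons b v ih =>
    have hv : v.getLast? ≠ some x := by
      cases v with
      | nil => simp
      | cons c v => rwa [List.getLast?_cons_cons] at hw
    obtain ⟨R, hR, hR'⟩ := ih hv
    refine ⟨(x :: b :: v ++ List.replicate n x) :: R.map (b :: ·), fun Φ => ?_, ?_⟩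
    · rw [List.cons_append, qshPair_cons_cons, hR]
      simp [noContraction, Function.comp_def]
      ring
    · intro w' hw'
      rcases List.mem_cons.1 hw' with rfl | h
      · exact ⟨x :: b :: v, rfl, by simp, by rwa [List.getLast?_cons_cons]⟩
      · obtain ⟨w'', hw'', rfl⟩ := List.mem_map.1 h
        obtain ⟨u, rfl, hu, hu'⟩ := hR' w'' hw''
        refine ⟨b :: u, rfl, by simp, ?_⟩
        cases u with
        | nil => exact (hu rfl).elim
        | cons c u => rwa [List.getLast?_cons_cons]

theorem exists_eq_append_replicate (x : A) (w : List A) :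
    ∃ u n, w = u ++ List.replicate n x ∧ u.getLast? ≠ some x := by
  induction w using List.reverseRecOn with
  | nil => exact ⟨[], 0, by simp, by simp⟩
  | append_singleton w a ih =>
    by_cases h : a = x
    · obtain ⟨u, n, rfl, hu⟩ := ih
      exact ⟨u, n + 1, by rw [List.replicate_succ', h, List.append_assoc], hu⟩
    · exact ⟨w ++ [a], 0, by simp, by simpa using h⟩

/-- Inserting a letter other than `x₀` cannot create a final `x₀`, so regularisation at the first
letter stays among words not ending in `x₀`. -/
theorem getLast?_of_mem_qsh_letter {x₀ : A} (h01 : x ≠ x₀) (w : List A)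
    (hw : w.getLast? ≠ some x₀) : ∀ w' ∈ qsh noContraction [x] w, w'.getLast? ≠ some x₀ ∧ w' ≠ [] := by
  induction w with
  | nil => simpa using h01
  | cons b v ih =>
    have hv : v.getLast? ≠ some x₀ := by
      cases v with
      | nil => simp
      | cons c v => rwa [List.getLast?_cons_cons] at hw
    intro w' hw'
    simp only [qsh_cons_cons, noContraction, qsh_nil_left, List.map_cons, List.map_nil,
      Option.elim_none, List.append_nil, List.cons_append, List.nil_append, List.mem_cons] at hw'
    rcases hw' with rfl | h
    · exact ⟨by rwa [List.getLast?_cons_cons], by simp⟩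
    · obtain ⟨w'', hw'', rfl⟩ := List.mem_map.1 h
      refine ⟨?_, by simp⟩
      obtain ⟨h1, h2⟩ := ih hv w'' hw''
      cases w'' with
      | nil => exact (h2 rfl).elim
      | cons c u => rwa [List.getLast?_cons_cons]

/-- Regularisation at both ends, for the shuffle product. -/
theorem evalAt_mem_span_of_shuffle [CharZero k] {x₀ : A} (h01 : x ≠ x₀) {V : Set (List A → k)}
    (hV : ∀ Φ ∈ V, GroupLike noContraction Φ ∧ Φ [x₀] = 0 ∧ Φ [x] = 0) (w : List A) :
    evalAt V w ∈ Submodule.span k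
      (evalAt V '' {w | w.head? ≠ some x ∧ w.getLast? ≠ some x₀}) := by
  obtain ⟨u, n, rfl, hu⟩ := exists_eq_append_replicate x₀ w
  -- Final letters `x₀` are removed first, by induction on their number; the base case removes
  -- leading letters `x`, which preserves what has been gained at the right end.
  induction n generalizing u with
  | zero =>
    rw [List.replicate_zero, List.append_nil]
    have := evalAt_mem_span_of_lead (m := noContraction) (x := x) (by simp [noContraction])
      (fun Φ hΦ => ⟨(hV Φ hΦ).1, (hV Φ hΦ).2.2⟩) (D := {w | w.getLast? ≠ some x₀}) ?_ u hu
    · refine Submodule.span_mono (Set.image_mono ?_) this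
      exact fun w hw => ⟨hw.2, hw.1⟩
    · intro w hw w' hw'
      refine (getLast?_of_mem_qsh_letter h01 w ?_ w' hw').1
      cases w with
      | nil => simp
      | cons c v => rwa [Set.mem_ofPred_eq, List.getLast?_cons_cons] at hw
  | succ n ih =>
    obtain ⟨R, hR, hR'⟩ := exists_qshPair_letter_append_eq (k := k) u n hu
    refine evalAt_mem_of_relation _ _ ((n : k) + 1) (Nat.cast_add_one_ne_zero _)
        R (fun w' hw' => ?_) fun Φ hΦ => ?_
    · obtain ⟨u', rfl, -, hu'⟩ := hR' w' hw'
      exact ih u' hu'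
    · rw [← hR, (hV Φ hΦ).1.2, (hV Φ hΦ).2.1, zero_mul]

end Regularisation

/-! ### Passing equalities and limits from convergent words to all words. -/

section Transfer

variable {k A : Type*} [Field k] {V : Set (List A → k)} {C : Set (List A)}

theorem eq_of_evalAt_mem_span {Φ Ψ : List A → k} (hΦ : Φ ∈ V) (hΨ : Ψ ∈ V)
    (hC : ∀ w ∈ C, Φ w = Ψ w) (w : List A) (hw : evalAt V w ∈ Submodule.span k (evalAt V '' C)) :
    Φ w = Ψ w := by
  have : ∀ f ∈ Submodule.span k (evalAt V '' C), f ⟨Φ, hΦ⟩ = f ⟨Ψ, hΨ⟩ := by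
    intro f hf
    induction hf using Submodule.span_induction with
    | mem f hf => obtain ⟨w, hw, rfl⟩ := hf; exact hC w hw
    | zero => rfl
    | add f g _ _ hf hg => rw [Pi.add_apply, Pi.add_apply, hf, hg]
    | smul c f _ hf => rw [Pi.smul_apply, Pi.smul_apply, hf]
  exact this _ hw

theorem exists_tendsto_of_evalAt_mem_span [TopologicalSpace k] [IsTopologicalRing k]
    {ι : Type*} {l : Filter ι} {F : ι → List A → k} (hF : ∀ᶠ i in l, F i ∈ V)
    (hC : ∀ w ∈ C, ∃ a, Filter.Tendsto (fun i => F i w) l (nhds a)) (w : List A)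
    (hw : evalAt V w ∈ Submodule.span k (evalAt V '' C)) :
    ∃ a, Filter.Tendsto (fun i => F i w) l (nhds a) := by
  -- `F i` lies in `V` only eventually, so functions on `V` are extended by zero elsewhere.
  have : ∀ f ∈ Submodule.span k (evalAt V '' C),
      ∃ a, Filter.Tendsto (fun i => if h : F i ∈ V then f ⟨F i, h⟩ else 0) l (nhds a) := by
    intro f hf
    induction hf using Submodule.span_induction with
    | mem f hf =>
      obtain ⟨w, hw, rfl⟩ := hf
      obtain ⟨a, ha⟩ := hC w hw
      refine ⟨a, ha.congr' ?_⟩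
      filter_upwards [hF] with i hi
      rw [dif_pos hi]; rfl
    | zero => exact ⟨0, tendsto_const_nhds.congr fun i => by simp⟩
    | add f g _ _ hf hg =>
      obtain ⟨a, ha⟩ := hf
      obtain ⟨b, hb⟩ := hg
      exact ⟨a + b, (ha.add hb).congr fun i => by split_ifs <;> simp⟩
    | smul c f _ hf =>
      obtain ⟨a, ha⟩ := hf
      exact ⟨c * a, (ha.const_mul c).congr fun i => by split_ifs <;> simp⟩
  obtain ⟨a, ha⟩ := this _ hw
  refine ⟨a, ha.congr' ?_⟩
  filter_upwards [hF] with i hi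
  rw [dif_pos hi]; rfl

/-- A pointwise limit of group-like functions is group-like. -/
theorem GroupLike.of_tendsto [TopologicalSpace k] [IsTopologicalRing k] [T2Space k]
    {ι : Type*} {l : Filter ι} [l.NeBot] {m : A → A → Option A} {F : ι → List A → k}
    {Φ : List A → k} (hF : ∀ᶠ i in l, GroupLike m (F i))
    (h : ∀ w, Filter.Tendsto (fun i => F i w) l (nhds (Φ w))) : GroupLike m Φ := by
  have hs : ∀ R : List (List A),
      Filter.Tendsto (fun i => (R.map (F i)).sum) l (nhds (R.map Φ).sum) := by
    intro R
    induction R with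
    | nil => simp
    | cons w R ih => simpa using (h w).add ih
  refine ⟨tendsto_nhds_unique (h []) (tendsto_const_nhds.congr' ?_), fun u v => ?_⟩
  · filter_upwards [hF] with i hi using hi.1.symm
  · refine tendsto_nhds_unique (hs (qsh m u v)) (((h u).mul (h v)).congr' ?_)
    filter_upwards [hF] with i hi using (hi.2 u v).symm

end Transfer

open Filter Topology

/-! ### Convergence with rate $N^{-1/2}$, and summation by parts. -/

section Rates

/-- `f N = c + O(N^{-1/2})`. -/
def HasRate (f : ℕ → ℂ) (c : ℂ) : Prop :=
  ∃ C : ℝ, ∀ N : ℕ, ‖f N - c‖ ≤ C * ((N : ℝ) + 1) ^ (-(1 / 2) : ℝ)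

theorem tendsto_rpow_neg_atTop {s : ℝ} (hs : 0 < s) :
    Tendsto (fun N : ℕ => ((N : ℝ) + 1) ^ (-s)) atTop (𝓝 0) :=
  (_root_.tendsto_rpow_neg_atTop hs).comp
    (tendsto_atTop_add_const_right _ _ tendsto_natCast_atTop_atTop)

theorem HasRate.tendsto {f : ℕ → ℂ} {c : ℂ} (h : HasRate f c) : Tendsto f atTop (𝓝 c) := by
  obtain ⟨C, hC⟩ := h
  rw [tendsto_iff_norm_sub_tendsto_zero]
  refine squeeze_zero (fun _ => norm_nonneg _) hC ?_
  simpa using (tendsto_rpow_neg_atTop (s := 1 / 2) (by norm_num)).const_mul C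

theorem HasRate.zero : HasRate 0 0 := ⟨0, by simp⟩

theorem HasRate.add {f g : ℕ → ℂ} {c d : ℂ} (hf : HasRate f c) (hg : HasRate g d) :
    HasRate (fun N => f N + g N) (c + d) := by
  obtain ⟨C, hC⟩ := hf
  obtain ⟨D, hD⟩ := hg
  refine ⟨C + D, fun N => ?_⟩
  rw [add_sub_add_comm, add_mul]
  exact (norm_add_le _ _).trans (add_le_add (hC N) (hD N))

theorem HasRate.const_mul {f : ℕ → ℂ} {c : ℂ} (hf : HasRate f c) (a : ℂ) :
    HasRate (fun N => a * f N) (a * c) := by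
  obtain ⟨C, hC⟩ := hf
  refine ⟨‖a‖ * C, fun N => ?_⟩
  rw [← mul_sub, norm_mul, mul_assoc]
  exact mul_le_mul_of_nonneg_left (hC N) (norm_nonneg _)

theorem exists_hasRate_of_evalAt_mem_span {A : Type*} {V : Set (List A → ℂ)} {C : Set (List A)}
    {F : ℕ → List A → ℂ} (hF : ∀ i, F i ∈ V)
    (hC : ∀ w ∈ C, ∃ a, HasRate (fun i => F i w) a) (w : List A)
    (hw : evalAt V w ∈ Submodule.span ℂ (evalAt V '' C)) :
    ∃ a, HasRate (fun i => F i w) a := by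
  have : ∀ f ∈ Submodule.span ℂ (evalAt V '' C), ∃ a, HasRate (fun i => f ⟨F i, hF i⟩) a := by
    intro f hf
    induction hf using Submodule.span_induction with
    | mem f hf => obtain ⟨w, hw, rfl⟩ := hf; exact hC w hw
    | zero => exact ⟨0, HasRate.zero⟩
    | add f g _ _ hf hg =>
      obtain ⟨a, ha⟩ := hf; obtain ⟨b, hb⟩ := hg; exact ⟨a + b, ha.add hb⟩
    | smul c f _ hf => obtain ⟨a, ha⟩ := hf; exact ⟨c * a, ha.const_mul c⟩
  exact this _ hw

/-- Split $7/4=1/2+5/4$. At index $n+N$ the first power is bounded by the desired rate at $N$, and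
the second by a term summable in $n$. -/
theorem exists_hasRate_sum {d : ℕ → ℂ} {C : ℝ}
    (hd : ∀ n : ℕ, ‖d n‖ ≤ C * ((n : ℝ) + 1) ^ (-(7 / 4) : ℝ)) :
    ∃ c, HasRate (fun N => ∑ n ∈ Finset.range N, d n) c := by
  have hC : 0 ≤ C := by simpa using (norm_nonneg _).trans (hd 0)
  have hs : Summable fun n : ℕ => ((n : ℝ) + 1) ^ (-(5 / 4) : ℝ) := by
    have := (summable_nat_add_iff 1).2 (Real.summable_nat_rpow.2 (by norm_num : (-(5 / 4) : ℝ) < -1))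
    simpa using this
  have hpos : ∀ n : ℕ, (0 : ℝ) < (n : ℝ) + 1 := fun n => by positivity
  have hb : ∀ N n : ℕ, ‖d (n + N)‖ ≤
      C * ((N : ℝ) + 1) ^ (-(1 / 2) : ℝ) * ((n : ℝ) + 1) ^ (-(5 / 4) : ℝ) := by
    intro N n
    refine (hd _).trans ?_
    rw [mul_assoc]
    refine mul_le_mul_of_nonneg_left ?_ hC
    have h : (-(7 / 4) : ℝ) = -(1 / 2) + -(5 / 4) := by norm_num
    rw [h, Real.rpow_add (hpos _)]
    gcongr ?_ * ?_
    · refine Real.rpow_le_rpow_of_nonpos (hpos _) ?_ (by norm_num)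
      push_cast; linarith [(Nat.cast_nonneg n : (0 : ℝ) ≤ n)]
    · refine Real.rpow_le_rpow_of_nonpos (hpos _) ?_ (by norm_num)
      push_cast; linarith [(Nat.cast_nonneg N : (0 : ℝ) ≤ N)]
  have hsum : Summable d := by
    refine Summable.of_norm_bounded (hs.mul_left _) (hb 0)
  refine ⟨∑' n, d n, C * ∑' n : ℕ, ((n : ℝ) + 1) ^ (-(5 / 4) : ℝ), fun N => ?_⟩
  rw [← hsum.sum_add_tsum_nat_add N, sub_add_cancel_left, norm_neg]
  refine (tsum_of_norm_bounded (hs.mul_left _).hasSum (hb N)).trans (le_of_eq ?_)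
  rw [tsum_mul_left]; ring

theorem exists_hasRate_of_norm_le {f : ℕ → ℂ} {C s : ℝ} (hs : s ≤ -(1 / 2)) (hC : 0 ≤ C)
    (hd : ∀ n : ℕ, ‖f n‖ ≤ C * ((n : ℝ) + 1) ^ s) : HasRate f 0 := by
  refine ⟨C, fun N => ?_⟩
  rw [sub_zero]
  refine (hd N).trans (mul_le_mul_of_nonneg_left ?_ hC)
  exact Real.rpow_le_rpow_of_exponent_le (by linarith [(Nat.cast_nonneg N : (0 : ℝ) ≤ N)]) hs

/-- Summation by parts. -/
theorem exists_hasRate_sum_pow_mul {z : ℂ} (hz : ‖z‖ = 1) (hz1 : z ≠ 1) {a : ℕ → ℂ} {C : ℝ}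
    (ha0 : a 0 = 0) (ha : ∀ n : ℕ, ‖a n‖ ≤ C * ((n : ℝ) + 1) ^ (-(3 / 4) : ℝ))
    (ha' : ∀ n : ℕ, ‖a (n + 1) - a n‖ ≤ C * ((n : ℝ) + 1) ^ (-(7 / 4) : ℝ)) :
    ∃ c, HasRate (fun N => ∑ n ∈ Finset.range N, z ^ n * a n) c := by
  have hC : 0 ≤ C := by simpa using (norm_nonneg _).trans (ha 0)
  obtain ⟨c, hc⟩ := exists_hasRate_sum (d := fun n => z ^ (n + 1) * (a (n + 1) - a n)) (C := C)
    fun n => by simpa [hz] using ha' n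
  have hb : HasRate (fun n => z ^ n * a n) 0 :=
    exists_hasRate_of_norm_le (s := -(3 / 4)) (by norm_num) hC fun n => by simpa [hz] using ha n
  -- Since $a_0=0$, $(1-z)\sum_{n<N}z^na_n=\sum_{n<N}z^{n+1}(a_{n+1}-a_n)-z^Na_N$, and the boundary
  -- term tends to $0$ at the required rate.
  refine ⟨(1 - z)⁻¹ * (c + -1 * 0), ?_⟩
  convert (hc.add (hb.const_mul (-1))).const_mul (1 - z)⁻¹ using 2 with N
  rw [eq_inv_mul_iff_mul_eq₀ (sub_ne_zero.2 hz1.symm)]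
  induction N with
  | zero => simp [ha0]
  | succ N ih =>
    rw [Finset.sum_range_succ, mul_add, ih, Finset.sum_range_succ (fun n => z ^ (n + 1) * _)]
    ring

end Rates

/-! ### Growth of harmonic sums. -/

section Harmonic

/-- The harmonic sum over `0 < n < N`. -/
def harm (N : ℕ) : ℝ := ∑ n ∈ Finset.Ico 1 N, 1 / (n : ℝ)

theorem harm_nonneg (N : ℕ) : 0 ≤ harm N := Finset.sum_nonneg fun _ _ => by positivity

theorem harm_mono : Monotone harm := fun _ _ h =>
  Finset.sum_le_sum_of_subset_of_nonneg (Finset.Ico_subset_Ico_right h) fun _ _ _ => by positivity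

theorem harm_le (N : ℕ) : harm N ≤ 1 + Real.log ((N : ℝ) + 1) := by
  have h : harm N = (harmonic (N - 1) : ℚ) := by
    rw [harm, Finset.sum_Ico_eq_sum_range, harmonic]
    push_cast
    exact Finset.sum_congr rfl fun i _ => by rw [one_div, add_comm]
  rw [h]
  refine (harmonic_le_one_add_log _).trans (add_le_add_right ?_ _)
  rcases Nat.eq_zero_or_pos (N - 1) with h0 | h0
  · rw [h0]; simp only [Nat.cast_zero, Real.log_zero]
    exact Real.log_nonneg (by linarith [(Nat.cast_nonneg N : (0 : ℝ) ≤ N)])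
  · refine Real.log_le_log (by exact_mod_cast h0) ?_
    have : N - 1 ≤ N + 1 := by omega
    exact_mod_cast this

theorem exists_harm_pow_le (j : ℕ) {δ : ℝ} (hδ : 0 < δ) :
    ∃ C : ℝ, 0 ≤ C ∧ ∀ N : ℕ, harm N ^ j ≤ C * ((N : ℝ) + 1) ^ δ := by
  -- From $\log u\le u^\varepsilon/\varepsilon$ the $j$-th power costs exponent $\varepsilon
  -- j<\delta$; the denominator $j+1$ also covers $j=0$.
  set ε : ℝ := δ / (j + 1) with hε
  have hε0 : 0 < ε := by positivity
  refine ⟨(1 + 1 / ε) ^ j, by positivity, fun N => ?_⟩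
  have hN : (1 : ℝ) ≤ (N : ℝ) + 1 := by linarith [(Nat.cast_nonneg N : (0 : ℝ) ≤ N)]
  have h1 : harm N ≤ (1 + 1 / ε) * ((N : ℝ) + 1) ^ ε := by
    refine (harm_le N).trans ?_
    have := Real.log_le_rpow_div (by linarith : (0 : ℝ) ≤ (N : ℝ) + 1) hε0
    have h2 := Real.one_le_rpow hN hε0.le
    rw [add_mul, one_mul, one_div_mul_eq_div]
    exact add_le_add h2 this
  calc harm N ^ j ≤ ((1 + 1 / ε) * ((N : ℝ) + 1) ^ ε) ^ j := by
        gcongr; exact harm_nonneg N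
    _ = (1 + 1 / ε) ^ j * ((N : ℝ) + 1) ^ (ε * j) := by
        rw [mul_pow, Real.rpow_mul_natCast (by linarith)]
    _ ≤ _ := by
        gcongr
        rw [hε, div_mul_eq_mul_div, div_le_iff₀ (by positivity)]
        nlinarith

/-- Replaces $n$ by $n+1$ at the cost of a factor $2$. At $n=0$ the left side is $0$ by the
convention on division. -/
theorem one_div_le_two_mul_rpow (n : ℕ) : 1 / (n : ℝ) ≤ 2 * ((n : ℝ) + 1) ^ (-1 : ℝ) := by
  rw [Real.rpow_neg_one]
  rcases Nat.eq_zero_or_pos n with rfl | h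
  · simp
  · have : (1 : ℝ) ≤ n := by exact_mod_cast h
    rw [← div_eq_mul_inv, div_le_div_iff₀ (by linarith) (by linarith)]
    linarith

end Harmonic

/-! ### Truncated iterated sums: quasi-shuffle relations, bounds and convergence. -/

section IterSum

variable {Γ : Type*} [CommGroup Γ] (ι : Γ →* ℂˣ)

/-- The factor `ι(σ)^n / n^s`. -/
def sumFactor (p : Y Γ) (n : ℕ) : ℂ := (ι p.2 : ℂ) ^ n / (n : ℂ) ^ (p.1 : ℕ)

/-- The extra summand $n=0$ vanishes, because $s\ge1$ makes the denominator zero and division by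
zero gives $0$. Ranges are then easier to handle than intervals starting at $1$. -/
theorem iterSum_cons (p : Y Γ) (w : List (Y Γ)) (N : ℕ) :
    iterSum ι (p :: w) N = ∑ n ∈ Finset.range N, sumFactor ι p n * iterSum ι w n := by
  obtain ⟨s, σ⟩ := p
  rw [iterSum]
  refine Finset.sum_subset (fun n hn => ?_) fun n hn hn' => ?_
  · exact Finset.mem_range.2 (Finset.mem_Ico.1 hn).2
  · obtain rfl : n = 0 := by
      simp only [Finset.mem_Ico, Finset.mem_range] at hn hn'; omega
    simp

theorem iterSum_cons_zero (p : Y Γ) (w : List (Y Γ)) : iterSum ι (p :: w) 0 = 0 := by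
  simp [iterSum_cons]

theorem iterSum_cons_succ (p : Y Γ) (w : List (Y Γ)) (N : ℕ) :
    iterSum ι (p :: w) (N + 1) = iterSum ι (p :: w) N + sumFactor ι p N * iterSum ι w N := by
  rw [iterSum_cons, iterSum_cons, Finset.sum_range_succ]

theorem sumFactor_mul (a b : Y Γ) (N : ℕ) :
    sumFactor ι (a.1 + b.1, a.2 * b.2) N = sumFactor ι a N * sumFactor ι b N := by
  simp only [sumFactor, map_mul, Units.val_mul, mul_pow, PNat.add_coe, pow_add]
  rw [div_mul_div_comm]

/-- Passing from $N$ to $N+1$ adds the terms in which the largest index equals $N$. It is attained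
in the sum of `u` only, of `v` only, or in both, which gives the three quasi-shuffle branches, with
shorter words and the same $N$. -/
theorem qshPair_iterSum (u v : List (Y Γ)) (N : ℕ) :
    qshPair yContraction (fun w => iterSum ι w N) u v = iterSum ι u N * iterSum ι v N := by
  match u, v with
  | [], v => simp [iterSum]
  | a :: u, [] => simp [iterSum]
  | a :: u, b :: v =>
    induction N with
    | zero => simp [qshPair_cons_cons, iterSum_cons_zero, qshPair_zero, yContraction]
    | succ N ih =>
      have h1 := qshPair_iterSum u (b :: v) N
      have h2 := qshPair_iterSum (a :: u) v N
      have h3 := qshPair_iterSum u v N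
      rw [qshPair_cons_cons] at ih ⊢
      simp only [yContraction, Option.elim_some, iterSum_cons_succ, qshPair_add, qshPair_smul,
        sumFactor_mul] at ih h1 h2 h3 ⊢
      linear_combination ih + sumFactor ι a N * h1 + sumFactor ι b N * h2 +
        sumFactor ι a N * sumFactor ι b N * h3
termination_by u.length + v.length

theorem groupLike_iterSum (N : ℕ) : GroupLike yContraction fun w => iterSum ι w N :=
  ⟨rfl, fun u v => qshPair_iterSum ι u v N⟩

variable [Finite Γ]

theorem norm_character (σ : Γ) : ‖(ι σ : ℂ)‖ = 1 := by
  refine Complex.norm_eq_one_of_pow_eq_one (n := Nat.card Γ) ?_ Nat.card_pos.ne'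
  rw [← Units.val_pow_eq_pow_val, ← map_pow, pow_card_eq_one', map_one, Units.val_one]

theorem norm_sumFactor (p : Y Γ) (n : ℕ) : ‖sumFactor ι p n‖ = 1 / (n : ℝ) ^ (p.1 : ℕ) := by
  simp [sumFactor, norm_character]

theorem norm_sumFactor_le (p : Y Γ) (n : ℕ) : ‖sumFactor ι p n‖ ≤ 1 / (n : ℝ) := by
  rw [norm_sumFactor]
  rcases Nat.eq_zero_or_pos n with rfl | h
  · simp [p.1.ne_zero]
  · have : (1 : ℝ) ≤ n := by exact_mod_cast h
    exact one_div_le_one_div_of_le (by linarith) (le_self_pow₀ this p.1.ne_zero)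

theorem norm_iterSum_le (w : List (Y Γ)) (N : ℕ) : ‖iterSum ι w N‖ ≤ harm N ^ w.length := by
  induction w generalizing N with
  | nil => simp [iterSum]
  | cons p w ih =>
    obtain ⟨s, σ⟩ := p
    rw [iterSum, List.length_cons, pow_succ']
    conv_rhs => rw [harm, Finset.sum_mul]
    refine norm_sum_le_of_le _ fun n hn => ?_
    rw [norm_mul]
    refine mul_le_mul (norm_sumFactor_le ι (s, σ) n) ((ih n).trans ?_) (norm_nonneg _) (by positivity)
    exact pow_le_pow_left₀ (harm_nonneg n) (harm_mono (Finset.mem_Ico.1 hn).2.le) _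

theorem exists_norm_iterSum_le (w : List (Y Γ)) :
    ∃ C : ℝ, 0 ≤ C ∧ ∀ N : ℕ, ‖iterSum ι w N‖ ≤ C * ((N : ℝ) + 1) ^ (1 / 4 : ℝ) := by
  obtain ⟨C, hC, h⟩ := exists_harm_pow_le w.length (δ := 1 / 4) (by norm_num)
  exact ⟨C, hC, fun N => (norm_iterSum_le ι w N).trans (h N)⟩

/-- The bound for a summand of an iterated sum. -/
theorem exists_norm_sumFactor_mul_iterSum_le (p : Y Γ) (w : List (Y Γ)) :
    ∃ C : ℝ, 0 ≤ C ∧ ∀ n : ℕ,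
      ‖sumFactor ι p n * iterSum ι w n‖ ≤ C * ((n : ℝ) + 1) ^ (-(3 / 4) : ℝ) := by
  obtain ⟨C, hC, h⟩ := exists_norm_iterSum_le ι w
  refine ⟨2 * C, by positivity, fun n => ?_⟩
  have hn : (0 : ℝ) < (n : ℝ) + 1 := by positivity
  rw [norm_mul]
  calc _ ≤ (2 * ((n : ℝ) + 1) ^ (-1 : ℝ)) * (C * ((n : ℝ) + 1) ^ (1 / 4 : ℝ)) :=
        mul_le_mul ((norm_sumFactor_le ι p n).trans (one_div_le_two_mul_rpow n)) (h n)
          (norm_nonneg _) (by positivity)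
    _ = _ := by
        rw [show (-(3 / 4) : ℝ) = -1 + 1 / 4 by norm_num, Real.rpow_add hn]; ring

/-- The summand is $O(n^{-2}\cdot n^{1/4})$, the inner sum growing slower than $n^{1/4}$. -/
theorem exists_hasRate_iterSum_of_two_le (p : Y Γ) (w : List (Y Γ)) (hp : 2 ≤ (p.1 : ℕ)) :
    ∃ c, HasRate (iterSum ι (p :: w)) c := by
  obtain ⟨C, hC, h⟩ := exists_norm_iterSum_le ι w
  have := exists_hasRate_sum (d := fun n => sumFactor ι p n * iterSum ι w n) (C := 4 * C) ?_
  · obtain ⟨c, hc⟩ := this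
    refine ⟨c, ?_⟩
    rwa [show iterSum ι (p :: w) = _ from funext (iterSum_cons ι p w)]
  intro n
  have hn : (0 : ℝ) < (n : ℝ) + 1 := by positivity
  have h1 : ‖sumFactor ι p n‖ ≤ (1 / (n : ℝ)) ^ 2 := by
    rw [norm_sumFactor, div_pow, one_pow]
    rcases Nat.eq_zero_or_pos n with rfl | h
    · simp [p.1.ne_zero]
    · have : (1 : ℝ) ≤ n := by exact_mod_cast h
      exact one_div_le_one_div_of_le (by positivity) (pow_le_pow_right₀ this hp)
  have h2 : (1 / (n : ℝ)) ^ 2 ≤ (2 * ((n : ℝ) + 1) ^ (-1 : ℝ)) ^ 2 :=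
    pow_le_pow_left₀ (by positivity) (one_div_le_two_mul_rpow n) 2
  rw [norm_mul]
  calc _ ≤ (2 * ((n : ℝ) + 1) ^ (-1 : ℝ)) ^ 2 * (C * ((n : ℝ) + 1) ^ (1 / 4 : ℝ)) :=
        mul_le_mul (h1.trans h2) (h n) (norm_nonneg _) (by positivity)
    _ = _ := by
        rw [show (-(7 / 4) : ℝ) = -1 + -1 + 1 / 4 by norm_num, Real.rpow_add hn, Real.rpow_add hn]
        ring

/-- Summation by parts applies with $a_n$ the inner sum divided by $n$: its increments are
$O(n^{-7/4})$, as the inner sum grows slower than $n^{1/4}$ and its increments are $O(n^{-3/4})$. -/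
theorem exists_hasRate_iterSum_of_ne_one (σ : Γ) (w : List (Y Γ)) (hσ : (ι σ : ℂ) ≠ 1) :
    ∃ c, HasRate (iterSum ι ((1, σ) :: w)) c := by
  obtain ⟨C, hC, h⟩ := exists_norm_iterSum_le ι w
  set a : ℕ → ℂ := fun n => iterSum ι w n / n with ha
  have hstep : ∃ D : ℝ, 0 ≤ D ∧ ∀ n : ℕ, 0 < n →
      ‖iterSum ι w (n + 1) - iterSum ι w n‖ ≤ D * ((n : ℝ) + 1) ^ (-(3 / 4) : ℝ) := by
    cases w with
    | nil => exact ⟨0, le_rfl, fun n _ => by simp [iterSum]⟩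
    | cons p w =>
      obtain ⟨D, hD, h⟩ := exists_norm_sumFactor_mul_iterSum_le ι p w
      exact ⟨D, hD, fun n _ => by rw [iterSum_cons_succ, add_sub_cancel_left]; exact h n⟩
  obtain ⟨D, hD, hstep⟩ := hstep
  have hpos : ∀ n : ℕ, (0 : ℝ) < (n : ℝ) + 1 := fun n => by positivity
  -- The term `‖a 1‖` serves the increment at $n=0$, where `a 0` is $0$ by division by zero and the
  -- general estimate does not apply.
  set E := 2 * C + D + ‖a 1‖ with hE
  have := exists_hasRate_sum_pow_mul (z := (ι σ : ℂ)) (norm_character ι σ) hσ (a := a) (C := E)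
    (by simp [ha]) (fun n => ?_) fun n => ?_
  · obtain ⟨c, hc⟩ := this
    refine ⟨c, ?_⟩
    have : iterSum ι ((1, σ) :: w) = fun N => ∑ n ∈ Finset.range N, (ι σ : ℂ) ^ n * a n := by
      funext N
      rw [iterSum_cons]
      refine Finset.sum_congr rfl fun n _ => ?_
      simp [sumFactor, ha]; ring
    rwa [this]
  · calc ‖a n‖ ≤ (C * ((n : ℝ) + 1) ^ (1 / 4 : ℝ)) * (2 * ((n : ℝ) + 1) ^ (-1 : ℝ)) := by
          rw [ha, norm_div, div_eq_mul_one_div, Complex.norm_natCast]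
          exact mul_le_mul (h n) (one_div_le_two_mul_rpow n) (by positivity)
            (mul_nonneg hC (by positivity))
      _ = (2 * C) * ((n : ℝ) + 1) ^ (-(3 / 4) : ℝ) := by
          rw [show (-(3 / 4) : ℝ) = -1 + 1 / 4 by norm_num, Real.rpow_add (hpos n)]; ring
      _ ≤ _ := by
          gcongr
          rw [hE]; linarith [norm_nonneg (a 1)]
  · rcases Nat.eq_zero_or_pos n with rfl | hn
    · have h0 : a 0 = 0 := by simp [ha]
      have h1 : ((0 : ℕ) : ℝ) + 1 = 1 := by simp
      rw [h0, sub_zero, h1, Real.one_rpow, mul_one, zero_add, hE]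
      linarith
    · have hn0 : (n : ℂ) ≠ 0 := by exact_mod_cast hn.ne'
      have hn1 : ((n : ℂ) + 1) ≠ 0 := by exact_mod_cast Nat.succ_ne_zero n
      have heq : a (n + 1) - a n = (iterSum ι w (n + 1) - iterSum ι w n) * ((n : ℂ) + 1)⁻¹ -
          iterSum ι w n * (1 / (n : ℂ)) * ((n : ℂ) + 1)⁻¹ := by
        simp only [ha]; push_cast; field_simp; ring
      have hinv : ‖((n : ℂ) + 1)⁻¹‖ = ((n : ℝ) + 1) ^ (-1 : ℝ) := by
        rw [Real.rpow_neg_one, norm_inv]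
        congr 1
        exact_mod_cast Complex.norm_natCast (n + 1)
      calc ‖a (n + 1) - a n‖ ≤ (D * ((n : ℝ) + 1) ^ (-(3 / 4) : ℝ)) * ((n : ℝ) + 1) ^ (-1 : ℝ) +
            (C * ((n : ℝ) + 1) ^ (1 / 4 : ℝ)) * (2 * ((n : ℝ) + 1) ^ (-1 : ℝ)) *
              ((n : ℝ) + 1) ^ (-1 : ℝ) := by
            rw [heq]
            refine (norm_sub_le _ _).trans (add_le_add ?_ ?_)
            · rw [norm_mul, hinv]
              exact mul_le_mul_of_nonneg_right (hstep n hn) (Real.rpow_nonneg (hpos n).le _)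
            · rw [norm_mul, norm_mul, hinv, norm_div, norm_one, Complex.norm_natCast]
              refine mul_le_mul_of_nonneg_right ?_ (Real.rpow_nonneg (hpos n).le _)
              exact mul_le_mul (h n) (one_div_le_two_mul_rpow n) (by positivity)
                (mul_nonneg hC (by positivity))
        _ = (2 * C + D) * ((n : ℝ) + 1) ^ (-(7 / 4) : ℝ) := by
            rw [show (-(7 / 4) : ℝ) = -1 + -1 + 1 / 4 by norm_num,
              show (-(3 / 4) : ℝ) = -1 + 1 / 4 by norm_num]
            simp only [Real.rpow_add (hpos n)]; ring
        _ ≤ _ := by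
            gcongr
            rw [hE]; linarith [norm_nonneg (a 1)]

end IterSum

/-! ### Regularised sums: existence, uniqueness and rate. -/

section RegSum

variable {Γ : Type*} [CommGroup Γ]

/-- The letter `y_{n+1,1}`. -/
def yOne (n : ℕ) : Y Γ := (n.succPNat, 1)

/-- A contracted letter has weight at least $2$, so the regularisation lemmas apply to the letter
$y_{1,1}$. -/
theorem yContraction_ne (a b : Y Γ) : yContraction a b ≠ some (yOne 0) := by
  intro h
  have h1 : a.1 + b.1 = 1 := (Prod.ext_iff.1 (Option.some.inj h)).1
  have h2 : (a.1 : ℕ) + b.1 = 1 := congrArg PNat.val h1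
  have := a.1.pos
  have := b.1.pos
  omega

theorem yContraction_yOne (i : ℕ) : yContraction (yOne i) (yOne (Γ := Γ) 0) = some (yOne (i + 1)) := by
  refine congrArg some (Prod.ext (PNat.eq ?_) (mul_one 1))
  rfl

/-! ### Newton's identities for the powers of $y_{1,1}$. -/

section Newton

variable {k : Type*} [CommRing k]

/-- The sum of the values of `Φ` at the words obtained by inserting the letter `a` in `b^j`. -/
def insertSum {A : Type*} (a b : A) : (List A → k) → ℕ → k
  | Φ, 0 => Φ [a]
  | Φ, j + 1 => Φ (a :: List.replicate (j + 1) b) + insertSum a b (fun w => Φ (b :: w)) j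

theorem insertSum_self {A : Type*} (b : A) (Φ : List A → k) (j : ℕ) :
    insertSum b b Φ j = ((j : k) + 1) * Φ (List.replicate (j + 1) b) := by
  induction j generalizing Φ with
  | zero => simp [insertSum]
  | succ j ih => rw [insertSum, ih]; simp [List.replicate_succ]; ring

/-- The letter $y_{i+1,1}$ is either inserted among the $j+1$ letters $y_{1,1}$, or merged with one
of them, which inserts $y_{i+2,1}$ among the $j$ others. -/
theorem qshPair_yOne_replicate (Φ : List (Y Γ) → k) (i j : ℕ) :
    qshPair yContraction Φ [yOne i] (List.replicate (j + 1) (yOne 0)) =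
      insertSum (yOne i) (yOne 0) Φ (j + 1) + insertSum (yOne (i + 1)) (yOne 0) Φ j := by
  induction j generalizing Φ with
  | zero =>
    simp [List.replicate_succ, qshPair_cons_cons, yContraction_yOne, insertSum]
    ring
  | succ j ih =>
    rw [List.replicate_succ, qshPair_cons_cons, ih, yContraction_yOne, insertSum, insertSum,
      insertSum]
    simp [List.replicate_succ, insertSum]
    ring

/-- The merged words of one term are the inserted words of the next, so the alternating sum
telescopes. -/
theorem sum_qshPair_yOne (Φ : List (Y Γ) → k) (n i : ℕ) :
    ∑ p ∈ antidiagonal n, (-1) ^ p.1 *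
      qshPair yContraction Φ [yOne (i + p.1)] (List.replicate p.2 (yOne 0)) =
      insertSum (yOne i) (yOne 0) Φ n := by
  induction n generalizing i with
  | zero => simp [insertSum]
  | succ n ih =>
    rw [Finset.Nat.antidiagonal_succ, Finset.sum_cons, Finset.sum_map]
    have := ih (i + 1)
    simp only [add_assoc, add_comm 1] at this
    simp only [Function.Embedding.prodMap, Function.Embedding.coeFn_mk, Prod.map,
      Function.Embedding.refl_apply, pow_succ, mul_neg, mul_one, neg_mul, Finset.sum_neg_distrib,
      Nat.succ_eq_add_one, this, qshPair_yOne_replicate, pow_zero, one_mul, add_zero]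
    ring

/-- Newton's identities in the quasi-shuffle algebra. -/
theorem GroupLike.newton {Φ : List (Y Γ) → k} (hΦ : GroupLike yContraction Φ) (n : ℕ) :
    ((n : k) + 1) * Φ (List.replicate (n + 1) (yOne 0)) = ∑ p ∈ antidiagonal n,
      (-1) ^ p.1 * Φ [yOne p.1] * Φ (List.replicate p.2 (yOne 0)) := by
  rw [← insertSum_self, ← sum_qshPair_yOne]
  refine Finset.sum_congr rfl fun p _ => ?_
  rw [zero_add, hΦ.2, mul_assoc]

variable [Algebra ℚ k]

/-- The power series `∑_{n ≥ 2} ((-1)^{n-1} / n) c_n T^n`. -/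
def corrPS (c : ℕ → k) : PowerSeries k := PowerSeries.mk fun n =>
  if 2 ≤ n then algebraMap ℚ k ((-1) ^ (n - 1) / (n : ℚ)) * c n else 0

theorem corrLog_eq (c : ℕ → k) :
    (corrLog c : Series k (Y Γ)) = powSeries (A := Y Γ) (yOne 0) (corrPS c) := by
  have hpow : ∀ n : ℕ, (y 1 1 : FreeMonoid (Y Γ)) ^ n =
      FreeMonoid.ofList (List.replicate n (yOne 0)) := by
    intro n
    induction n with
    | zero => rfl
    | succ n ih => rw [pow_succ', ih]; rfl
  have h : ∀ w : List (Y Γ), corrLog c (FreeMonoid.ofList w) =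
      powSeries (A := Y Γ) (yOne 0) (corrPS c) w := by
    intro w
    rw [powSeries, letterSeries_eq_ite, corrPS, PowerSeries.coeff_mk]
    unfold corrLog
    have hl : (FreeMonoid.ofList w).length = w.length := rfl
    rw [hl, hpow]
    by_cases h1 : 2 ≤ w.length
    · by_cases h2 : w = List.replicate w.length (yOne 0)
      · rw [if_pos ⟨h1, congrArg FreeMonoid.ofList h2⟩, if_pos h2, if_pos h1]
      · rw [if_neg (fun h => h2 h.2), if_neg h2]
    · rw [if_neg (fun h => h1 h.1), if_neg h1, ite_self]
  exact funext h

theorem exp_corrLog (c : ℕ → k) :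
    (exp (corrLog c) : Series k (Y Γ)) = powSeries (A := Y Γ) (yOne 0) (expPS (corrPS c)) := by
  rw [corrLog_eq]; exact exp_powSeries _ _

end Newton

/-- The coefficients of a group-like series at the powers of `y_{1,1}`. -/
theorem GroupLike.apply_replicate_yOne {Φ : List (Y Γ) → ℂ} (hΦ : GroupLike yContraction Φ)
    (h1 : Φ [yOne 0] = 0) {c : ℕ → ℂ} (hc : ∀ n, 1 ≤ n → Φ [yOne n] = c (n + 1)) (n : ℕ) :
    Φ (List.replicate n (yOne 0)) = (expPS (corrPS c)).coeff n := by
  induction n using Nat.strong_induction_on with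
  | _ n ih =>
    cases n with
    | zero => rw [coeff_zero_expPS]; exact hΦ.1
    | succ n =>
      have hn : ((n : ℂ) + 1) ≠ 0 := Nat.cast_add_one_ne_zero n
      refine mul_left_cancel₀ hn ?_
      -- Newton's identities and the differential equation $E'=p'E$ are the same recursion, since
      -- $(i+1)\cdot\frac{(-1)^i}{i+1}c_{i+1}=(-1)^ic_{i+1}$.
      rw [hΦ.newton, succ_mul_coeff_expPS _ (by simp [corrPS])]
      refine Finset.sum_congr rfl fun p hp => ?_
      have hp' := Finset.HasAntidiagonal.mem_antidiagonal.1 hp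
      rw [ih p.2 (by omega)]
      congr 1
      -- The term $i=0$ vanishes on both sides: $\Phi$ has no coefficient at $y_{1,1}$, and `corrPS`
      -- starts in degree $2$.
      rcases Nat.eq_zero_or_pos p.1 with h0 | h0
      · rw [h0, h1]; simp [corrPS]
      · have : ((p.1 : ℂ) + 1) ≠ 0 := Nat.cast_add_one_ne_zero _
        rw [hc _ h0, corrPS, PowerSeries.coeff_mk, if_pos (by omega)]
        simp
        field_simp

variable (ι : Γ →* ℂˣ)

/-- Truncated iterated sums, normalised so that the coefficient at `y_{1,1}` vanishes. -/
def regSum (N : ℕ) : List (Y Γ) → ℂ :=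
  lmul (letterSeries (yOne 0) (expCoeff (-iterSum ι [yOne 0] N))) fun w => iterSum ι w N

/-- Group-like series without coefficient at `y_{1,1}`. -/
def regY (Γ : Type*) [CommGroup Γ] : Set (List (Y Γ) → ℂ) :=
  {Φ | GroupLike yContraction Φ ∧ Φ [yOne 0] = 0}

theorem regSum_mem (N : ℕ) : regSum ι N ∈ regY Γ := by
  refine ⟨(groupLike_letterSeries_expCoeff yContraction_ne _).lmul (groupLike_iterSum ι N), ?_⟩
  rw [regSum, lmul_letterSeries_cons]
  simp [expCoeff, iterSum]

theorem regSum_of_head (N : ℕ) (w : List (Y Γ)) (hw : w.head? ≠ some (yOne 0)) :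
    regSum ι N w = iterSum ι w N := by
  rw [regSum, lmul_letterSeries_of_head _ _ _ _ hw]; simp [expCoeff]

theorem isRegSumSeries_iff [Finite Γ] (L : Series ℂ (Y Γ)) : IsRegSumSeries ι L ↔
    (L : List (Y Γ) → ℂ) ∈ regY Γ ∧ ∀ w : List (Y Γ), w.head? ≠ some (yOne 0) →
      Tendsto (iterSum ι w) atTop (𝓝 (L w)) := by
  unfold IsRegSumSeries
  rw [isGroupLike_iff isDualTo_deltaStar]
  exact ⟨fun h => ⟨⟨h.1, h.2.2⟩, h.2.1⟩, fun h => ⟨h.1.1, h.2, h.1.2⟩⟩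

variable [Finite Γ]

/-- A convergent first letter has weight at least $2$, or weight $1$ with $\sigma\ne1$; in the
latter case injectivity gives $\iota(\sigma)\ne1$. -/
theorem exists_hasRate_iterSum (hι : Function.Injective ι) (w : List (Y Γ)) (hw : w.head? ≠ some (yOne 0)) :
    ∃ c, HasRate (iterSum ι w) c := by
  cases w with
  | nil => exact ⟨1, 0, by simp [iterSum]⟩
  | cons p w =>
    by_cases hp : 2 ≤ (p.1 : ℕ)
    · exact exists_hasRate_iterSum_of_two_le ι p w hp
    · obtain ⟨s, σ⟩ := p
      have hs : s = 1 := PNat.eq (by have := s.pos; simp only at hp; rw [PNat.one_coe]; omega)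
      subst hs
      refine exists_hasRate_iterSum_of_ne_one ι σ w fun h => hw ?_
      have : σ = 1 := hι (by rw [map_one]; exact Units.ext h)
      rw [this]; rfl

theorem exists_hasRate_regSum (hι : Function.Injective ι) (w : List (Y Γ)) :
    ∃ c, HasRate (fun N => regSum ι N w) c := by
  refine exists_hasRate_of_evalAt_mem_span (V := regY Γ) (regSum_mem ι)
    (C := {w ∈ Set.univ | w.head? ≠ some (yOne 0)}) (fun w hw => ?_) w
    (evalAt_mem_span_of_lead yContraction_ne (fun Φ hΦ => hΦ) (fun _ _ _ _ => trivial) w trivial)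
  obtain ⟨c, hc⟩ := exists_hasRate_iterSum ι hι w hw.2
  refine ⟨c, ?_⟩
  rwa [show (fun i => regSum ι i w) = iterSum ι w from
    funext fun N => regSum_of_head ι N w hw.2]

/-- The rate is recorded along with the limit: the comparison with integrals needs a power saving
that beats powers of logarithms. -/
theorem exists_isRegSumSeries (hι : Function.Injective ι) :
    ∃ L : Series ℂ (Y Γ), IsRegSumSeries ι L ∧
      ∀ w : List (Y Γ), HasRate (fun N => regSum ι N w) (L w) := by
  choose L hL using exists_hasRate_regSum ι hι
  refine ⟨L, (isRegSumSeries_iff ι L).2 ⟨⟨?_, ?_⟩, fun w hw => ?_⟩, hL⟩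
  · exact GroupLike.of_tendsto (Eventually.of_forall fun N => (regSum_mem ι N).1)
      fun w => (hL w).tendsto
  · refine tendsto_nhds_unique (hL _).tendsto (tendsto_const_nhds.congr fun N => ?_)
    exact (regSum_mem ι N).2.symm
  · exact (hL w).tendsto.congr fun N => regSum_of_head ι N w hw

theorem IsRegSumSeries.unique {L L' : Series ℂ (Y Γ)} (hL : IsRegSumSeries ι L)
    (hL' : IsRegSumSeries ι L') : L = L' := by
  rw [isRegSumSeries_iff] at hL hL'
  have h : ∀ w : List (Y Γ), L (FreeMonoid.ofList w) = L' (FreeMonoid.ofList w) := fun w =>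
    eq_of_evalAt_mem_span (V := regY Γ) (C := {w ∈ Set.univ | w.head? ≠ some (yOne 0)}) hL.1 hL'.1
      (fun w hw => tendsto_nhds_unique (hL.2 w hw.2) (hL'.2 w hw.2)) w
      (evalAt_mem_span_of_lead yContraction_ne (fun Φ hΦ => hΦ) (fun _ _ _ _ => trivial) w trivial)
  exact funext h

theorem existsUnique_isRegSumSeries (hι : Function.Injective ι) :
    ∃! L : Series ℂ (Y Γ), IsRegSumSeries ι L := by
  obtain ⟨L, hL, -⟩ := exists_isRegSumSeries ι hι
  exact ⟨L, hL, fun L' hL' => hL'.unique ι hL⟩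

theorem IsRegSumSeries.hasRate (hι : Function.Injective ι) {L : Series ℂ (Y Γ)} (hL : IsRegSumSeries ι L)
    (w : List (Y Γ)) : HasRate (fun N => regSum ι N w) (L w) := by
  obtain ⟨L', hL', h⟩ := exists_isRegSumSeries ι hι
  rw [hL.unique ι hL']
  exact h w

end RegSum

/-! ### Zeta values in the regularised sums. -/

section Zeta

variable {Γ : Type*} [CommGroup Γ] [Finite Γ] (ι : Γ →* ℂˣ)

theorem IsRegSumSeries.apply_yOne {L : Series ℂ (Y Γ)} (hL : IsRegSumSeries ι L) (n : ℕ)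
    (hn : 1 ≤ n) : L (FreeMonoid.ofList [yOne n]) = riemannZeta (n + 1 : ℕ) := by
  have h := ((isRegSumSeries_iff ι L).1 hL).2 [yOne n] (by
    intro h
    have h1 : n.succPNat = (0 : ℕ).succPNat := (Prod.ext_iff.1 (Option.some.inj h)).1
    have h2 : n + 1 = 1 := congrArg PNat.val h1
    omega)
  refine tendsto_nhds_unique h ?_
  rw [zeta_nat_eq_tsum_of_gt_one (by omega)]
  have hs : Summable fun m : ℕ => 1 / (m : ℂ) ^ (n + 1) := by
    rw [← summable_norm_iff]
    simpa using Real.summable_nat_pow_inv.2 (by omega : 1 < n + 1)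
  refine hs.hasSum.tendsto_sum_nat.congr fun N => ?_
  rw [iterSum_cons]
  refine Finset.sum_congr rfl fun m _ => ?_
  simp [sumFactor, yOne, iterSum]

/-- The part of `L` supported on the powers of `y_{1,1}`. -/
theorem IsRegSumSeries.apply_replicate {L : Series ℂ (Y Γ)} (hL : IsRegSumSeries ι L) (n : ℕ) :
    L (FreeMonoid.ofList (List.replicate n (yOne 0))) =
      (expPS (corrPS fun n => riemannZeta n)).coeff n :=
  GroupLike.apply_replicate_yOne (c := fun n => riemannZeta n) ((isRegSumSeries_iff ι L).1 hL).1.1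
    ((isRegSumSeries_iff ι L).1 hL).1.2 (fun n hn => hL.apply_yOne ι n hn) n

end Zeta

open Set MeasureTheory

/-! ### Iterated integrals over $[a,b]$ and their shuffle relations. -/

section Omega

variable {Γ : Type*} [CommGroup Γ] (ι : Γ →* ℂˣ)

theorem omega_zero (t : ℝ) : omega ι 0 t = 1 / (t : ℂ) := rfl

theorem omega_coe (σ : Γ) (t : ℝ) : omega ι (σ : X Γ) t = 1 / ((ι σ : ℂ)⁻¹ - t) := rfl

theorem iterInt_nil (a b : ℝ) : iterInt ι a [] b = 1 := rfl

theorem iterInt_cons (a b : ℝ) (c : X Γ) (w : List (X Γ)) :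
    iterInt ι a (c :: w) b = ∫ t in a..b, omega ι c t * iterInt ι a w t := rfl

theorem iterInt_cons_self (a : ℝ) (c : X Γ) (w : List (X Γ)) : iterInt ι a (c :: w) a = 0 := by
  rw [iterInt_cons, intervalIntegral.integral_same]

/-- The indefinite integral of a function that is continuous on the open unit interval. -/
theorem hasDerivAt_integral_of_continuousOn {g : ℝ → ℂ} (hg : ContinuousOn g (Ioo 0 1)) {a t : ℝ}
    (hi : IntervalIntegrable g volume a t) (ht : t ∈ Ioo (0 : ℝ) 1) :
    HasDerivAt (fun b => ∫ s in a..b, g s) (g t) t :=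
  intervalIntegral.integral_hasDerivAt_right hi
    (hg.stronglyMeasurableAtFilter isOpen_Ioo t ht) (hg.continuousAt (isOpen_Ioo.mem_nhds ht))

variable [Finite Γ]

theorem one_sub_le_norm_sub (σ : Γ) (t : ℝ) (ht : 0 ≤ t) : 1 - t ≤ ‖(ι σ : ℂ)⁻¹ - t‖ := by
  have := norm_sub_norm_le ((ι σ : ℂ)⁻¹) (t : ℂ)
  rwa [norm_inv, norm_character, inv_one, Complex.norm_real, Real.norm_of_nonneg ht] at this

theorem norm_omega_coe_le (σ : Γ) {t : ℝ} (ht : t ∈ Ico (0 : ℝ) 1) :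
    ‖omega ι (σ : X Γ) t‖ ≤ 1 / (1 - t) := by
  rw [omega_coe, norm_div, norm_one]
  exact one_div_le_one_div_of_le (by linarith [ht.2]) (one_sub_le_norm_sub ι σ t ht.1)

theorem norm_omega_le (c : X Γ) {t : ℝ} (ht : t ∈ Ioo (0 : ℝ) 1) :
    ‖omega ι c t‖ ≤ 1 / (t * (1 - t)) := by
  have h1 : 0 < 1 - t := by linarith [ht.2]
  induction c using WithZero.recZeroCoe with
  | zero =>
    rw [omega_zero, norm_div, norm_one, Complex.norm_real, Real.norm_of_nonneg ht.1.le]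
    exact one_div_le_one_div_of_le (mul_pos ht.1 h1) (by nlinarith [ht.1, ht.2])
  | coe σ =>
    refine (norm_omega_coe_le ι σ ⟨ht.1.le, ht.2⟩).trans ?_
    exact one_div_le_one_div_of_le (mul_pos ht.1 h1) (by nlinarith [ht.1, ht.2])

theorem continuousOn_omega (c : X Γ) : ContinuousOn (omega ι c) (Ioo 0 1) := by
  induction c using WithZero.recZeroCoe with
  | zero =>
    refine ContinuousOn.div continuousOn_const Complex.continuous_ofReal.continuousOn fun t ht => ?_
    exact_mod_cast ht.1.ne'
  | coe σ =>
    refine ContinuousOn.div continuousOn_const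
      (continuousOn_const.sub Complex.continuous_ofReal.continuousOn) fun t ht h => ?_
    have := one_sub_le_norm_sub ι σ t ht.1.le
    rw [h, norm_zero] at this
    linarith [ht.2]

/-- The pole $\sigma^{-1}$ lies on the unit circle, which meets $[0,1]$ only at $1$, so for
$\sigma\ne1$ the form is continuous on the compact segment. -/
theorem exists_norm_omega_le_of_ne_one (hι : Function.Injective ι) (σ : Γ) (hσ : σ ≠ 1) :
    ∃ K : ℝ, 0 ≤ K ∧ ∀ t ∈ Icc (0 : ℝ) 1, ‖omega ι (σ : X Γ) t‖ ≤ K := by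
  have hc : ContinuousOn (omega ι (σ : X Γ)) (Icc 0 1) := by
    refine ContinuousOn.div continuousOn_const
      (continuousOn_const.sub Complex.continuous_ofReal.continuousOn) fun t ht h => ?_
    have h1 : (ι σ : ℂ)⁻¹ = t := sub_eq_zero.1 h
    have h2 := congrArg norm h1
    rw [norm_inv, norm_character, inv_one, Complex.norm_real, Real.norm_of_nonneg ht.1] at h2
    rw [← h2, Complex.ofReal_one, inv_eq_one] at h1
    exact hσ (hι (by rw [map_one]; exact Units.ext h1))
  obtain ⟨K, hK⟩ := isCompact_Icc.exists_bound_of_continuousOn hc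
  exact ⟨K, (norm_nonneg _).trans (hK 0 ⟨le_rfl, zero_le_one⟩), hK⟩

theorem continuousOn_iterInt_of_mem {a : ℝ} (ha : a ∈ Ioo (0 : ℝ) 1) (w : List (X Γ)) :
    ContinuousOn (iterInt ι a w) (Ioo 0 1) := by
  induction w with
  | nil => exact continuousOn_const
  | cons c w ih =>
    intro t ht
    have hg := (continuousOn_omega ι c).mul ih
    refine (hasDerivAt_integral_of_continuousOn (a := a) hg ?_ ht).continuousAt.continuousWithinAt
    exact (hg.mono (ordConnected_Ioo.uIcc_subset ha ht)).intervalIntegrable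

theorem intervalIntegrable_of_mem {a t : ℝ} (ha : a ∈ Ioo (0 : ℝ) 1) (ht : t ∈ Ioo (0 : ℝ) 1)
    (c : X Γ) (w : List (X Γ)) :
    IntervalIntegrable (fun t => omega ι c t * iterInt ι a w t) volume a t :=
  (((continuousOn_omega ι c).mul (continuousOn_iterInt_of_mem ι ha w)).mono
    (ordConnected_Ioo.uIcc_subset ha ht)).intervalIntegrable

theorem hasDerivAt_iterInt {a t : ℝ} (ha : a ∈ Ioo (0 : ℝ) 1) (ht : t ∈ Ioo (0 : ℝ) 1)
    (c : X Γ) (w : List (X Γ)) :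
    HasDerivAt (iterInt ι a (c :: w)) (omega ι c t * iterInt ι a w t) t :=
  hasDerivAt_integral_of_continuousOn
    ((continuousOn_omega ι c).mul (continuousOn_iterInt_of_mem ι ha w))
    (intervalIntegrable_of_mem ι ha ht c w) ht

theorem hasDerivAt_qshPair_iterInt {a t : ℝ} (ha : a ∈ Ioo (0 : ℝ) 1) (ht : t ∈ Ioo (0 : ℝ) 1)
    (c : X Γ) (u v : List (X Γ)) :
    HasDerivAt (fun t => qshPair noContraction (fun w => iterInt ι a (c :: w) t) u v)
      (omega ι c t * qshPair noContraction (fun w => iterInt ι a w t) u v) t := by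
  unfold qshPair
  induction qsh noContraction u v with
  | nil => simpa using hasDerivAt_const t (0 : ℂ)
  | cons w R ih =>
    simp only [List.map_cons, List.sum_cons, mul_add]
    exact (hasDerivAt_iterInt ι ha ht c w).add ih

/-- The shuffle relations for iterated integrals. -/
theorem qshPair_iterInt {a : ℝ} (ha : a ∈ Ioo (0 : ℝ) 1) {b : ℝ} (hb : b ∈ Ioo (0 : ℝ) 1)
    (u v : List (X Γ)) : qshPair noContraction (fun w => iterInt ι a w b) u v =
      iterInt ι a u b * iterInt ι a v b := by
  match u, v with
  | [], v => simp [iterInt_nil]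
  | c :: u, [] => simp [iterInt_nil]
  | c :: u, d :: v =>
    -- The derivative of the defect `H` vanishes by the shuffle relations for shorter words, and `H`
    -- is $0$ at the lower end `a`.
    set H : ℝ → ℂ := fun t => qshPair noContraction (fun w => iterInt ι a w t) (c :: u) (d :: v) -
      iterInt ι a (c :: u) t * iterInt ι a (d :: v) t with hH
    have hd : ∀ t ∈ Ioo (0 : ℝ) 1, HasDerivAt H 0 t := by
      intro t ht
      have h1 := qshPair_iterInt ha ht u (d :: v)
      have h2 := qshPair_iterInt ha ht (c :: u) v
      have h := ((hasDerivAt_qshPair_iterInt ι ha ht c u (d :: v)).add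
        (hasDerivAt_qshPair_iterInt ι ha ht d (c :: u) v)).sub
        ((hasDerivAt_iterInt ι ha ht c u).mul (hasDerivAt_iterInt ι ha ht d v))
      rw [h1, h2] at h
      have hH' : H = (fun t => qshPair noContraction (fun w => iterInt ι a (c :: w) t) u (d :: v)) +
          (fun t => qshPair noContraction (fun w => iterInt ι a (d :: w) t) (c :: u) v) -
          iterInt ι a (c :: u) * iterInt ι a (d :: v) := by
        funext t
        simp [hH, qshPair_cons_cons, noContraction]
      rw [hH']
      refine h.congr_deriv ?_
      ring
    have hconst := isOpen_Ioo.is_const_of_deriv_eq_zero isPreconnected_Ioo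
      (fun t ht => (hd t ht).differentiableAt.differentiableWithinAt)
      (fun t ht => (hd t ht).deriv) hb ha
    have h0 : H a = 0 := by
      simp [hH, qshPair_cons_cons, noContraction, iterInt_cons_self, qshPair_zero]
    exact sub_eq_zero.1 (hconst.trans h0)
termination_by u.length + v.length

theorem groupLike_iterInt {a : ℝ} (ha : a ∈ Ioo (0 : ℝ) 1) {b : ℝ} (hb : b ∈ Ioo (0 : ℝ) 1) :
    GroupLike noContraction fun w => iterInt ι a w b :=
  ⟨rfl, qshPair_iterInt ι ha hb⟩

end Omega

/-! ### A majorant reproduced by integration against the forms. -/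

section Majorant

/-- The function `√(t / (1 - t))`, which dominates iterated integrals. -/
def majorant (t : ℝ) : ℝ := √(t / (1 - t))

/-- The derivative of `majorant`. -/
def majorantDeriv (t : ℝ) : ℝ := majorant t / (2 * (t * (1 - t)))

theorem majorant_nonneg (t : ℝ) : 0 ≤ majorant t := Real.sqrt_nonneg _

theorem majorantDeriv_nonneg {t : ℝ} (ht : t ∈ Ioo (0 : ℝ) 1) : 0 ≤ majorantDeriv t := by
  have h1 : 0 < 1 - t := by linarith [ht.2]
  exact div_nonneg (majorant_nonneg t) (by have := mul_pos ht.1 h1; linarith)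

/-- The point of $m=\sqrt{t/(1-t)}$ is $m'=m/(2t(1-t))$. As every form is bounded by $1/(t(1-t))$,
one has $|\omega_c|m\le2m'$, so each integration reproduces the bound up to a factor $2$. -/
theorem hasDerivAt_majorant {t : ℝ} (ht : t ∈ Ioo (0 : ℝ) 1) :
    HasDerivAt majorant (majorantDeriv t) t := by
  have h1 : 0 < 1 - t := by linarith [ht.2]
  have hq : 0 < t / (1 - t) := div_pos ht.1 h1
  have h := ((hasDerivAt_id t).div ((hasDerivAt_const t (1 : ℝ)).sub (hasDerivAt_id t)) h1.ne').sqrt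
    hq.ne'
  refine h.congr_deriv ?_
  have hs : √(t / (1 - t)) ^ 2 = t / (1 - t) := Real.sq_sqrt hq.le
  have hs0 : √(t / (1 - t)) ≠ 0 := (Real.sqrt_pos.2 hq).ne'
  have ht0 : t ≠ 0 := ht.1.ne'
  have h10 : (1 - t) ≠ 0 := h1.ne'
  simp only [majorantDeriv, majorant, id, Pi.sub_apply, Pi.div_apply]
  have hs' : √(t / (1 - t)) ^ 2 * (1 - t) = t := by rw [hs]; field_simp
  rw [div_div, div_eq_div_iff (by positivity) (by positivity)]
  linear_combination (-2 * (1 - t) ) * hs'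

theorem continuousOn_majorant : ContinuousOn majorant (Iio 1) := by
  refine (continuousOn_id.div (continuousOn_const.sub continuousOn_id) fun t ht => ?_).sqrt
  exact sub_ne_zero.2 (ne_of_gt ht)

/-- The derivative is unbounded at $0$, but a nonnegative derivative of a continuous function is
integrable. -/
theorem integrableOn_majorantDeriv {a t : ℝ} (ha : 0 ≤ a) (ht : t < 1) :
    IntegrableOn majorantDeriv (Ioc a t) :=
  intervalIntegral.integrableOn_deriv_of_nonneg
    (continuousOn_majorant.mono fun _ hs => lt_of_le_of_lt hs.2 ht)
    (fun _ hs => hasDerivAt_majorant ⟨ha.trans_lt hs.1, hs.2.trans ht⟩)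
    fun _ hs => majorantDeriv_nonneg ⟨ha.trans_lt hs.1, hs.2.trans ht⟩

theorem intervalIntegrable_majorantDeriv {a t : ℝ} (ha : 0 ≤ a) (hat : a ≤ t) (ht : t < 1) :
    IntervalIntegrable majorantDeriv volume a t :=
  (intervalIntegrable_iff_integrableOn_Ioc_of_le hat).2 (integrableOn_majorantDeriv ha ht)

theorem integral_majorantDeriv {a t : ℝ} (ha : 0 ≤ a) (hat : a ≤ t) (ht : t < 1) :
    ∫ s in a..t, majorantDeriv s = majorant t - majorant a :=
  intervalIntegral.integral_eq_sub_of_hasDerivAt_of_le hat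
    (continuousOn_majorant.mono fun _ hs => lt_of_le_of_lt hs.2 ht)
    (fun _ hs => hasDerivAt_majorant ⟨ha.trans_lt hs.1, hs.2.trans ht⟩)
    (intervalIntegrable_majorantDeriv ha hat ht)

/-- Starts the induction at the innermost form: it amounts to $t\le m(t)$, that is $t^2(1-t)\le t$.
-/
theorem one_div_one_sub_le {t : ℝ} (ht : t ∈ Ioo (0 : ℝ) 1) :
    1 / (1 - t) ≤ 2 * majorantDeriv t := by
  have h1 : 0 < 1 - t := by linarith [ht.2]
  have h : t ≤ majorant t := by
    refine Real.le_sqrt_of_sq_le ?_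
    rw [le_div_iff₀ h1]
    nlinarith [ht.1, ht.2, mul_pos ht.1 h1]
  have : 2 * majorantDeriv t = majorant t / t * (1 / (1 - t)) := by
    rw [majorantDeriv]; field_simp [ht.1.ne', h1.ne']
  rw [this]
  exact le_mul_of_one_le_left (by positivity) ((one_le_div ht.1).2 h)

theorem integrableOn_inv_sqrt : IntegrableOn (fun t : ℝ => 1 / √(t * (1 - t))) (Ioo 0 1) := by
  have h : IntegrableOn (fun t : ℝ => 1 / √(t * (1 - t))) (Ioc 0 1) := by
    -- $\arcsin(2t-1)$ is a primitive, continuous up to both ends, and the integrand is nonnegative.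
    refine intervalIntegral.integrableOn_deriv_of_nonneg (g := fun t => Real.arcsin (2 * t - 1))
      (by fun_prop) (fun t ht => ?_) fun t _ => by positivity
    have h1 : 0 < 1 - t := by linarith [ht.2]
    have h := (Real.hasDerivAt_arcsin (x := 2 * t - 1) (by linarith [ht.1]) (by linarith [ht.2])).comp t
      (((hasDerivAt_id t).const_mul 2).sub_const 1)
    refine h.congr_deriv ?_
    have : 1 - (2 * t - 1) ^ 2 = 2 ^ 2 * (t * (1 - t)) := by ring
    simp only [this, mul_one]
    rw [Real.sqrt_mul (by positivity), Real.sqrt_sq (by norm_num)]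
    have : √(t * (1 - t)) ≠ 0 := (Real.sqrt_pos.2 (mul_pos ht.1 h1)).ne'
    field_simp
  exact h.mono_set Ioo_subset_Ioc_self

theorem majorant_div {t : ℝ} (ht : t ∈ Ioo (0 : ℝ) 1) :
    majorant t / t = 1 / √(t * (1 - t)) := by
  have h1 : 0 < 1 - t := by linarith [ht.2]
  have hs := Real.sqrt_pos.2 (mul_pos ht.1 h1)
  rw [div_eq_div_iff ht.1.ne' hs.ne', majorant, ← Real.sqrt_mul (div_nonneg ht.1.le h1.le), one_mul]
  rw [show t / (1 - t) * (t * (1 - t)) = t ^ 2 by field_simp, Real.sqrt_sq ht.1.le]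

end Majorant

/-! ### Dominated convergence for convergent words. -/

section Bounds

variable {Γ : Type*} [CommGroup Γ] (ι : Γ →* ℂˣ)

/-- Moves integrals over variable intervals to the fixed domain $(0,1)$, where dominated convergence
applies. -/
theorem iterInt_cons_eq_setIntegral {a b : ℝ} (ha : 0 ≤ a) (hab : a ≤ b) (hb : b < 1) (c : X Γ)
    (w : List (X Γ)) : iterInt ι a (c :: w) b =
      ∫ s in Ioo 0 1, (Ioc a b).indicator (fun s => omega ι c s * iterInt ι a w s) s := by
  rw [setIntegral_indicator measurableSet_Ioc, inter_eq_right.2, iterInt_cons,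
    intervalIntegral.integral_of_le hab]
  exact fun s hs => ⟨ha.trans_lt hs.1, hs.2.trans_lt hb⟩

variable [Finite Γ]

theorem getLast?_tail_ne {A : Type*} {x c : A} {w : List A} (h : (c :: w).getLast? ≠ some x) :
    w.getLast? ≠ some x := by
  cases w with
  | nil => simp
  | cons d w => rwa [List.getLast?_cons_cons] at h

theorem intervalIntegrable_of_norm_le {g : ℝ → ℂ} (hg : ContinuousOn g (Ioo 0 1)) {C a t : ℝ}
    (ha : a ∈ Ico (0 : ℝ) 1) (ht : t ∈ Ioo (0 : ℝ) 1)
    (h : ∀ s ∈ Ioo (0 : ℝ) 1, a ≤ s → ‖g s‖ ≤ C * majorantDeriv s) :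
    IntervalIntegrable g volume a t := by
  rcases le_or_gt a t with hat | hat
  · rw [intervalIntegrable_iff_integrableOn_Ioc_of_le hat]
    have hsub : Ioc a t ⊆ Ioo 0 1 := fun s hs => ⟨ha.1.trans_lt hs.1, hs.2.trans_lt ht.2⟩
    refine Integrable.mono' ((integrableOn_majorantDeriv ha.1 ht.2).const_mul C)
      ((hg.mono hsub).aestronglyMeasurable measurableSet_Ioc) ?_
    exact (ae_restrict_iff' measurableSet_Ioc).2
      (Eventually.of_forall fun s hs => h s (hsub hs) hs.1.le)
  -- Here $t<a$, so $a>0$ and continuity on a compact segment of $(0,1)$ suffices; the bound is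
  -- needed only to the right of `a`, which may be $0$.
  · exact (hg.mono (ordConnected_Ioo.uIcc_subset ⟨ht.1.trans hat, ha.2⟩ ht)).intervalIntegrable

/-- The lower end $a=0$ is included: the last letter is not $x_0$, so the innermost form is
integrable at $0$. The two claims are proved together, since continuity of the next integral rests
on the integrability given by the bound. -/
theorem continuousOn_and_norm_integrand_le {a : ℝ} (ha : a ∈ Ico (0 : ℝ) 1) (w : List (X Γ))
    (hw : w.getLast? ≠ some 0) :
    ContinuousOn (iterInt ι a w) (Ioo 0 1) ∧ ∀ c, (c :: w).getLast? ≠ some 0 →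
      ∀ s ∈ Ioo (0 : ℝ) 1, a ≤ s →
        ‖omega ι c s * iterInt ι a w s‖ ≤ 2 ^ (w.length + 1) * majorantDeriv s := by
  induction w with
  | nil =>
    refine ⟨continuousOn_const, fun c hc s hs _ => ?_⟩
    induction c using WithZero.recZeroCoe with
    | zero => simp at hc
    | coe σ =>
      rw [iterInt_nil, mul_one, List.length_nil, zero_add, pow_one]
      exact (norm_omega_coe_le ι σ ⟨hs.1.le, hs.2⟩).trans (one_div_one_sub_le hs)
  | cons d w ih =>
    obtain ⟨hcont, hb⟩ := ih (getLast?_tail_ne hw)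
    have hb := hb d hw
    have hg := (continuousOn_omega ι d).mul hcont
    have hint : ∀ t ∈ Ioo (0 : ℝ) 1,
        IntervalIntegrable (fun s => omega ι d s * iterInt ι a w s) volume a t :=
      fun t ht => intervalIntegrable_of_norm_le hg ha ht hb
    refine ⟨fun t ht => (hasDerivAt_integral_of_continuousOn hg (hint t ht)
      ht).continuousAt.continuousWithinAt, fun c _ s hs has => ?_⟩
    have h1 : ‖iterInt ι a (d :: w) s‖ ≤ 2 ^ (w.length + 1) * majorant s := by
      calc ‖iterInt ι a (d :: w) s‖ ≤ ∫ t in a..s, 2 ^ (w.length + 1) * majorantDeriv t := by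
            refine intervalIntegral.norm_integral_le_of_norm_le has
              (Eventually.of_forall fun t ht => ?_)
              ((intervalIntegrable_majorantDeriv ha.1 has hs.2).const_mul _)
            exact hb t ⟨ha.1.trans_lt ht.1, ht.2.trans_lt hs.2⟩ ht.1.le
        _ = 2 ^ (w.length + 1) * (majorant s - majorant a) := by
            rw [intervalIntegral.integral_const_mul, integral_majorantDeriv ha.1 has hs.2]
        _ ≤ _ := by gcongr; linarith [majorant_nonneg a]
    have hpos := mul_pos hs.1 (by linarith [hs.2] : 0 < 1 - s)
    -- This is $|\omega_c|m\le m/(s(1-s))=2m'$.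
    calc _ ≤ 1 / (s * (1 - s)) * (2 ^ (w.length + 1) * majorant s) := by
          rw [norm_mul]
          exact mul_le_mul (norm_omega_le ι c hs) h1 (norm_nonneg _) (by positivity)
      _ = _ := by rw [majorantDeriv, List.length_cons]; field_simp; ring

theorem norm_iterInt_le {a : ℝ} (ha : a ∈ Ico (0 : ℝ) 1) (c : X Γ) (w : List (X Γ))
    (hw : (c :: w).getLast? ≠ some 0) {s : ℝ} (hs : s ∈ Ioo (0 : ℝ) 1) (has : a ≤ s) :
    ‖iterInt ι a (c :: w) s‖ ≤ 2 ^ (w.length + 1) * majorant s := by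
  calc ‖iterInt ι a (c :: w) s‖ ≤ ∫ t in a..s, 2 ^ (w.length + 1) * majorantDeriv t := by
        refine intervalIntegral.norm_integral_le_of_norm_le has
          (Eventually.of_forall fun t ht => ?_)
          ((intervalIntegrable_majorantDeriv ha.1 has hs.2).const_mul _)
        exact (continuousOn_and_norm_integrand_le ι ha w (getLast?_tail_ne hw)).2 c hw t
          ⟨ha.1.trans_lt ht.1, ht.2.trans_lt hs.2⟩ ht.1.le
    _ = 2 ^ (w.length + 1) * (majorant s - majorant a) := by
        rw [intervalIntegral.integral_const_mul, integral_majorantDeriv ha.1 has hs.2]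
    _ ≤ _ := by gcongr; linarith [majorant_nonneg a]

theorem aestronglyMeasurable_integrand {a : ℝ} (ha : a ∈ Ico (0 : ℝ) 1) (b : ℝ) (c : X Γ)
    (w : List (X Γ)) (hw : w.getLast? ≠ some 0) :
    AEStronglyMeasurable ((Ioc a b).indicator fun s => omega ι c s * iterInt ι a w s)
      (volume.restrict (Ioo 0 1)) :=
  ((((continuousOn_omega ι c).mul
    (continuousOn_and_norm_integrand_le ι ha w hw).1).aestronglyMeasurable
      measurableSet_Ioo).indicator measurableSet_Ioc)

theorem eventually_mem_Ioo_zero {t : ℝ} (ht : 0 < t) : ∀ᶠ a in 𝓝[>] (0 : ℝ), a ∈ Ioo 0 t :=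
  Ioo_mem_nhdsGT ht

/-- Convergence of iterated integrals at the lower end. -/
theorem tendsto_iterInt_nhdsGT_zero (w : List (X Γ)) (hw : w.getLast? ≠ some 0) {t : ℝ}
    (ht : t ∈ Ioo (0 : ℝ) 1) :
    Tendsto (fun a => iterInt ι a w t) (𝓝[>] 0) (𝓝 (iterInt ι 0 w t)) := by
  induction w generalizing t with
  | nil => exact tendsto_const_nhds
  | cons c w ih =>
    have hw' := getLast?_tail_ne hw
    have hev := eventually_mem_Ioo_zero ht.1
    rw [iterInt_cons_eq_setIntegral ι le_rfl ht.1.le ht.2]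
    refine Tendsto.congr' (f₁ := fun a => ∫ s in Ioo 0 1,
      (Ioc a t).indicator (fun s => omega ι c s * iterInt ι a w s) s) ?_ ?_
    · filter_upwards [hev] with a ha
      exact (iterInt_cons_eq_setIntegral ι ha.1.le ha.2.le ht.2 c w).symm
    refine tendsto_integral_filter_of_dominated_convergence
      ((Ioc 0 t).indicator fun s => 2 ^ (w.length + 1) * majorantDeriv s) ?_ ?_ ?_ ?_
    · filter_upwards [hev] with a ha
      exact aestronglyMeasurable_integrand ι ⟨ha.1.le, ha.2.trans ht.2⟩ t c w hw'
    · filter_upwards [hev] with a ha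
      refine (ae_restrict_iff' measurableSet_Ioo).2 (Eventually.of_forall fun s hs => ?_)
      by_cases hsa : s ∈ Ioc a t
      · rw [indicator_of_mem hsa, indicator_of_mem (show s ∈ Ioc 0 t from ⟨hs.1, hsa.2⟩)]
        exact (continuousOn_and_norm_integrand_le ι ⟨ha.1.le, ha.2.trans ht.2⟩ w hw').2 c hw s hs
          hsa.1.le
      · rw [indicator_of_notMem hsa, norm_zero]
        exact indicator_nonneg (fun s hs => mul_nonneg (by positivity)
          (majorantDeriv_nonneg ⟨hs.1, hs.2.trans_lt ht.2⟩)) s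
    · have : IntegrableOn (fun s => 2 ^ (w.length + 1) * majorantDeriv s) (Ioc 0 t) :=
        (integrableOn_majorantDeriv le_rfl ht.2).const_mul _
      exact (integrable_indicator_iff measurableSet_Ioc).2 this |>.mono_measure
        Measure.restrict_le_self
    · refine (ae_restrict_iff' measurableSet_Ioo).2 (Eventually.of_forall fun s hs => ?_)
      by_cases hst : s ≤ t
      · rw [indicator_of_mem (show s ∈ Ioc 0 t from ⟨hs.1, hst⟩)]
        refine ((ih hw' hs).const_mul (omega ι c s)).congr' ?_
        filter_upwards [eventually_mem_Ioo_zero hs.1] with a ha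
        rw [indicator_of_mem (show s ∈ Ioc a t from ⟨ha.2, hst⟩)]
      · rw [indicator_of_notMem fun h => hst h.2]
        exact tendsto_const_nhds.congr fun a => (indicator_of_notMem (fun h => hst h.2) _).symm

/-- The filter of intervals `[a, b]` exhausting the unit interval. -/
def unitFilter : Filter (ℝ × ℝ) := 𝓝[>] 0 ×ˢ 𝓝[<] 1

instance : unitFilter.NeBot := by unfold unitFilter; infer_instance

instance : unitFilter.IsCountablyGenerated := by unfold unitFilter; infer_instance

theorem eventually_unitFilter_around {s : ℝ} (hs : s ∈ Ioo (0 : ℝ) 1) :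
    ∀ᶠ p in unitFilter, p.1 ∈ Ioo 0 s ∧ p.2 ∈ Ioo s 1 :=
  prod_mem_prod (Ioo_mem_nhdsGT hs.1) (Ioo_mem_nhdsLT hs.2)

theorem eventually_unitFilter : ∀ᶠ p in unitFilter, p.1 ∈ Ioo (0 : ℝ) 1 ∧ p.2 ∈ Ioo (0 : ℝ) 1 ∧
    p.1 < p.2 := by
  filter_upwards [eventually_unitFilter_around (s := 1 / 2) ⟨by norm_num, by norm_num⟩] with p hp
  obtain ⟨⟨h1, h2⟩, h3, h4⟩ := hp
  exact ⟨⟨h1, by linarith⟩, ⟨by linarith, h4⟩, by linarith⟩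

/-- Convergence of the iterated integrals attached to convergent words. -/
theorem exists_tendsto_iterInt (hι : Function.Injective ι) (w : List (X Γ))
    (hw : w.getLast? ≠ some 0) (hw1 : w.head? ≠ some 1) :
    ∃ z, Tendsto (fun p : ℝ × ℝ => iterInt ι p.1 w p.2) unitFilter (𝓝 z) := by
  cases w with
  | nil => exact ⟨1, tendsto_const_nhds⟩
  | cons c w =>
    have hw' := getLast?_tail_ne hw
    -- The outermost form is not $\omega_1$, so it is at most $K/s$; with the bound by $m(s)$ on the
    -- inner integral this yields $m(s)/s=1/\sqrt{s(1-s)}$, integrable at both ends. For a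
    -- one-letter word the letter is neither $0$ nor $1$, and its form is bounded.
    have hdom : ∃ D : ℝ, 0 ≤ D ∧ ∀ a s, a ∈ Ico (0 : ℝ) 1 → s ∈ Ioo (0 : ℝ) 1 → a ≤ s →
        ‖omega ι c s * iterInt ι a w s‖ ≤ D * (1 / √(s * (1 - s))) := by
      have hc : ∃ K : ℝ, 0 ≤ K ∧ (∀ s ∈ Ioo (0 : ℝ) 1, ‖omega ι c s‖ ≤ K / s) ∧
          (c ≠ 0 → ∀ s ∈ Ioo (0 : ℝ) 1, ‖omega ι c s‖ ≤ K) := by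
        induction c using WithZero.recZeroCoe with
        | zero =>
          refine ⟨1, zero_le_one, fun s hs => ?_, fun h => (h rfl).elim⟩
          rw [omega_zero, norm_div, norm_one, Complex.norm_real, Real.norm_of_nonneg hs.1.le]
        | coe σ =>
          obtain ⟨K, hK, h⟩ := exists_norm_omega_le_of_ne_one ι hι σ
            (fun h => hw1 (by rw [h]; rfl))
          refine ⟨K, hK, fun s hs => ?_, fun _ s hs => h s ⟨hs.1.le, hs.2.le⟩⟩
          exact (h s ⟨hs.1.le, hs.2.le⟩).trans (le_div_self hK hs.1 hs.2.le)
      obtain ⟨K, hK, h1, h2⟩ := hc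
      refine ⟨K * 2 ^ w.length, by positivity, fun a s ha hs has => ?_⟩
      cases w with
      | nil =>
        rw [iterInt_nil, mul_one, List.length_nil, pow_zero, mul_one]
        refine (h2 (by simpa using hw) s hs).trans ?_
        have h3 : 0 < s * (1 - s) := mul_pos hs.1 (by linarith [hs.2])
        refine le_mul_of_one_le_right hK ((one_le_div (Real.sqrt_pos.2 h3)).2 ?_)
        exact Real.sqrt_le_iff.2 ⟨zero_le_one, by nlinarith [hs.1, hs.2]⟩
      | cons d w =>
        rw [norm_mul, ← majorant_div hs]
        calc _ ≤ K / s * (2 ^ (w.length + 1) * majorant s) :=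
              mul_le_mul (h1 s hs) (norm_iterInt_le ι ha d w hw' hs has) (norm_nonneg _)
                (div_nonneg hK hs.1.le)
          _ = _ := by rw [List.length_cons]; ring
    obtain ⟨D, hD, hdom⟩ := hdom
    refine ⟨∫ s in Ioo 0 1, omega ι c s * iterInt ι 0 w s, ?_⟩
    refine Tendsto.congr' (f₁ := fun p : ℝ × ℝ => ∫ s in Ioo 0 1,
      (Ioc p.1 p.2).indicator (fun s => omega ι c s * iterInt ι p.1 w s) s) ?_ ?_
    · filter_upwards [eventually_unitFilter] with p hp
      exact (iterInt_cons_eq_setIntegral ι hp.1.1.le hp.2.2.le hp.2.1.2 c w).symm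
    refine tendsto_integral_filter_of_dominated_convergence
      (fun s => D * (1 / √(s * (1 - s)))) ?_ ?_ ?_ ?_
    · filter_upwards [eventually_unitFilter] with p hp
      exact aestronglyMeasurable_integrand ι ⟨hp.1.1.le, hp.1.2⟩ p.2 c w hw'
    · filter_upwards [eventually_unitFilter] with p hp
      refine (ae_restrict_iff' measurableSet_Ioo).2 (Eventually.of_forall fun s hs => ?_)
      by_cases hsa : s ∈ Ioc p.1 p.2
      · rw [indicator_of_mem hsa]
        exact hdom p.1 s ⟨hp.1.1.le, hp.1.2⟩ hs hsa.1.le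
      · rw [indicator_of_notMem hsa, norm_zero]
        positivity
    · exact integrableOn_inv_sqrt.const_mul D
    · refine (ae_restrict_iff' measurableSet_Ioo).2 (Eventually.of_forall fun s hs => ?_)
      have h := ((tendsto_iterInt_nhdsGT_zero ι w hw' hs).const_mul (omega ι c s)).comp
        (tendsto_fst (f := 𝓝[>] (0 : ℝ)) (g := 𝓝[<] (1 : ℝ)))
      refine h.congr' ?_
      filter_upwards [eventually_unitFilter_around hs] with p hp
      rw [indicator_of_mem (show s ∈ Ioc p.1 p.2 from ⟨hp.1.2, hp.2.1.le⟩)]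
      rfl

end Bounds

/-! ### Multiplying by a power series in one letter, in families. -/

section LetterSeriesAction

variable {k A : Type*} [CommRing k]

/-- A property of families stable under addition passes from the products `p_n Ψ(v)` to the
coefficients of `p • Ψ`. -/
theorem lmul_letterSeries_induction {J : Type*} {P : (J → k) → Prop} (hzero : P fun _ => 0)
    (hadd : ∀ f g, P f → P g → P fun i => f i + g i) (x : A) (p : J → ℕ → k)
    (Ψ : J → List A → k) (w : List A) (h : ∀ v, v <:+ w → ∀ n, P fun i => p i n * Ψ i v) :
    P fun i => lmul (letterSeries x (p i)) (Ψ i) w := by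
  induction w generalizing p with
  | nil => simpa using h [] (List.suffix_refl _) 0
  | cons a w ih =>
    simp only [lmul_letterSeries_cons]
    refine hadd _ _ (h _ (List.suffix_refl _) 0) ?_
    by_cases ha : a = x
    · simp only [ha, if_true]
      exact ih _ fun v hv n => h v (hv.trans (List.suffix_cons a w)) (n + 1)
    · simpa only [ha, if_false] using hzero

theorem letterSeries_of_getLast? (x : A) (q : ℕ → k) {w : List A} (hw : w ≠ [])
    (h : w.getLast? ≠ some x) : letterSeries x q w = 0 := by
  rw [letterSeries_eq_ite, if_neg]
  intro he
  obtain ⟨n, hn⟩ := Nat.exists_eq_succ_of_ne_zero (mt List.length_eq_zero_iff.1 hw)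
  rw [hn, List.replicate_succ'] at he
  rw [he] at h
  simp at h

/-- Right multiplication by a power series in `x` does not change the coefficients at words that do
not end with `x`, up to the constant term. -/
theorem lmul_letterSeries_right_of_getLast? (x : A) (q : ℕ → k) (Ψ : List A → k) (w : List A)
    (h : w.getLast? ≠ some x) : lmul Ψ (letterSeries x q) w = Ψ w * q 0 := by
  induction w generalizing Ψ with
  | nil => rfl
  | cons a w ih =>
    rw [lmul_cons, letterSeries_of_getLast? x q (List.cons_ne_nil a w) h, mul_zero, zero_add,
      ih _ (getLast?_tail_ne h)]

end LetterSeriesAction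

/-! ### Regularised integrals: existence, uniqueness and one-sided limits. -/

section RegInt

variable {Γ : Type*} [CommGroup Γ] (ι : Γ →* ℂˣ)

/-- Iterated integrals over `[a, b]`, normalised so that the coefficients at `x_0` and `x_1`
vanish. -/
def regInt (p : ℝ × ℝ) : List (X Γ) → ℂ :=
  lmul (lmul (letterSeries 1 (expCoeff (-iterInt ι p.1 [1] p.2))) fun w => iterInt ι p.1 w p.2)
    (letterSeries 0 (expCoeff (-iterInt ι p.1 [0] p.2)))

/-- Group-like series without coefficients at `x_0` and `x_1`. -/
def regX (Γ : Type*) [CommGroup Γ] : Set (List (X Γ) → ℂ) :=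
  {Φ | GroupLike noContraction Φ ∧ Φ [0] = 0 ∧ Φ [1] = 0}

theorem expCoeff_zero_right (c : ℂ) : expCoeff c 0 = 1 := by simp [expCoeff]

theorem expCoeff_one_right (c : ℂ) : expCoeff c 1 = c := by simp [expCoeff]

theorem noContraction_ne {A : Type*} (x : A) (a b : A) : noContraction a b ≠ some x := by
  simp [noContraction]

theorem regInt_of_getLast? (p : ℝ × ℝ) (w : List (X Γ)) (hw : w.getLast? ≠ some 0) :
    regInt ι p w = lmul (letterSeries 1 (expCoeff (-iterInt ι p.1 [1] p.2)))
      (fun w => iterInt ι p.1 w p.2) w := by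
  rw [regInt, lmul_letterSeries_right_of_getLast? _ _ _ _ hw, expCoeff_zero_right, mul_one]

theorem regInt_of_convergent (p : ℝ × ℝ) (w : List (X Γ)) (hw : w.getLast? ≠ some 0)
    (hw1 : w.head? ≠ some 1) : regInt ι p w = iterInt ι p.1 w p.2 := by
  rw [regInt_of_getLast? ι p w hw, lmul_letterSeries_of_head _ _ _ _ hw1, expCoeff_zero_right,
    one_mul]

theorem regInt_mem [Finite Γ] {p : ℝ × ℝ} (h1 : p.1 ∈ Ioo (0 : ℝ) 1) (h2 : p.2 ∈ Ioo (0 : ℝ) 1) :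
    regInt ι p ∈ regX Γ := by
  refine ⟨((groupLike_letterSeries_expCoeff (noContraction_ne 1) _).lmul
    (groupLike_iterInt ι h1 h2)).lmul (groupLike_letterSeries_expCoeff (noContraction_ne 0) _),
    ?_, ?_⟩
  · simp [regInt, lmul_cons, letterSeries_cons, expCoeff_zero_right, expCoeff_one_right, iterInt_nil]
  · rw [regInt_of_getLast? ι p _ (by simp), lmul_letterSeries_cons]
    simp [expCoeff_zero_right, expCoeff_one_right, iterInt_nil]

theorem isRegIntegralSeries_iff (I : Series ℂ (X Γ)) : IsRegIntegralSeries ι I ↔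
    (I : List (X Γ) → ℂ) ∈ regX Γ ∧ ∀ w : List (X Γ), w.head? ≠ some 1 → w.getLast? ≠ some 0 →
      Tendsto (fun p : ℝ × ℝ => iterInt ι p.1 w p.2) unitFilter (𝓝 (I w)) := by
  unfold IsRegIntegralSeries
  rw [isGroupLike_iff isDualTo_delta]
  exact ⟨fun h => ⟨⟨h.1, h.2.2⟩, h.2.1⟩, fun h => ⟨h.1.1, h.2, h.1.2⟩⟩

theorem evalAt_mem_span_regX (w : List (X Γ)) : evalAt (regX Γ) w ∈
    Submodule.span ℂ (evalAt (regX Γ) '' {w | w.head? ≠ some 1 ∧ w.getLast? ≠ some 0}) :=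
  evalAt_mem_span_of_shuffle (one_ne_zero : (1 : X Γ) ≠ 0) (fun _ hΦ => hΦ) w

theorem IsRegIntegralSeries.unique {I I' : Series ℂ (X Γ)} (hI : IsRegIntegralSeries ι I)
    (hI' : IsRegIntegralSeries ι I') : I = I' := by
  rw [isRegIntegralSeries_iff] at hI hI'
  have h : ∀ w : List (X Γ), I (FreeMonoid.ofList w) = I' (FreeMonoid.ofList w) := fun w =>
    eq_of_evalAt_mem_span hI.1 hI'.1
      (fun w hw => tendsto_nhds_unique (hI.2 w hw.1 hw.2) (hI'.2 w hw.1 hw.2)) w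
      (evalAt_mem_span_regX w)
  exact funext h

variable [Finite Γ]

theorem eventually_regInt_mem : ∀ᶠ p in unitFilter, regInt ι p ∈ regX Γ := by
  filter_upwards [eventually_unitFilter] with p hp using regInt_mem ι hp.1 hp.2.1

theorem exists_isRegIntegralSeries (hι : Function.Injective ι) :
    ∃ I : Series ℂ (X Γ), IsRegIntegralSeries ι I ∧
      ∀ w : List (X Γ), Tendsto (fun p => regInt ι p w) unitFilter (𝓝 (I w)) := by
  have hconv : ∀ w ∈ {w : List (X Γ) | w.head? ≠ some 1 ∧ w.getLast? ≠ some 0},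
      ∃ z, Tendsto (fun p => regInt ι p w) unitFilter (𝓝 z) := by
    intro w hw
    obtain ⟨z, hz⟩ := exists_tendsto_iterInt ι hι w hw.2 hw.1
    exact ⟨z, hz.congr fun p => (regInt_of_convergent ι p w hw.2 hw.1).symm⟩
  choose I hI using fun w => exists_tendsto_of_evalAt_mem_span (eventually_regInt_mem ι) hconv w
    (evalAt_mem_span_regX w)
  refine ⟨I, (isRegIntegralSeries_iff ι I).2 ⟨⟨?_, ?_, ?_⟩, fun w hw1 hw => ?_⟩, hI⟩
  · exact GroupLike.of_tendsto ((eventually_regInt_mem ι).mono fun p hp => hp.1) hI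
  · refine tendsto_nhds_unique (hI _) (tendsto_const_nhds.congr' ?_)
    filter_upwards [eventually_regInt_mem ι] with p hp using hp.2.1.symm
  · refine tendsto_nhds_unique (hI _) (tendsto_const_nhds.congr' ?_)
    filter_upwards [eventually_regInt_mem ι] with p hp using hp.2.2.symm
  · exact (hI w).congr fun p => regInt_of_convergent ι p w hw hw1

theorem existsUnique_isRegIntegralSeries (hι : Function.Injective ι) :
    ∃! I : Series ℂ (X Γ), IsRegIntegralSeries ι I := by
  obtain ⟨I, hI, -⟩ := exists_isRegIntegralSeries ι hι
  exact ⟨I, hI, fun I' hI' => hI'.unique ι hI⟩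

theorem IsRegIntegralSeries.tendsto (hι : Function.Injective ι) {I : Series ℂ (X Γ)}
    (hI : IsRegIntegralSeries ι I) (w : List (X Γ)) :
    Tendsto (fun p => regInt ι p w) unitFilter (𝓝 (I w)) := by
  obtain ⟨I', hI', h⟩ := exists_isRegIntegralSeries ι hι
  rw [hI.unique ι hI']
  exact h w

theorem tendsto_lmul_letterSeries {k A J : Type*} [CommRing k] [TopologicalSpace k]
    [IsTopologicalRing k] {l : Filter J} (x : A) {p : J → ℕ → k} {q : ℕ → k} {Ψ : J → List A → k}
    {Ψ' : List A → k} (w : List A) (hp : ∀ n, Tendsto (fun i => p i n) l (𝓝 (q n)))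
    (hΨ : ∀ v, v <:+ w → Tendsto (fun i => Ψ i v) l (𝓝 (Ψ' v))) :
    Tendsto (fun i => lmul (letterSeries x (p i)) (Ψ i) w) l
      (𝓝 (lmul (letterSeries x q) Ψ' w)) := by
  -- `Option J` adjoins to the family an index `none` carrying the limit, which makes convergence to
  -- that value a property stable under sums. The same device is used below for rates, Abel means
  -- and derivatives.
  have := lmul_letterSeries_induction (J := Option J)
    (P := fun f => Tendsto (fun i => f (some i)) l (𝓝 (f none))) tendsto_const_nhds
    (fun f g hf hg => hf.add hg) x (fun i => i.elim q p) (fun i => i.elim Ψ' Ψ) w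
    (fun v hv n => (hp n).mul (hΨ v hv))
  exact this

theorem getLast?_suffix_ne {A : Type*} {x : A} {v w : List A} (hv : v <:+ w)
    (h : w.getLast? ≠ some x) : v.getLast? ≠ some x := by
  obtain ⟨u, rfl⟩ := hv
  cases v with
  | nil => simp
  | cons a v => rwa [List.getLast?_append_of_ne_nil _ (List.cons_ne_nil a v)] at h

/-- Regularised integrals from `0`. -/
theorem IsRegIntegralSeries.tendsto_left (hι : Function.Injective ι) {I : Series ℂ (X Γ)}
    (hI : IsRegIntegralSeries ι I) (w : List (X Γ)) (hw : w.getLast? ≠ some 0) :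
    Tendsto (fun b => lmul (letterSeries 1 (expCoeff (-iterInt ι 0 [1] b)))
      (fun w => iterInt ι 0 w b) w) (𝓝[<] 1) (𝓝 (I w)) := by
  have h1 := hI.tendsto ι hι w
  have h2 : ∀ b ∈ Ioo (0 : ℝ) 1, Tendsto (fun a => regInt ι (a, b) w) (𝓝[>] 0)
      (𝓝 (lmul (letterSeries 1 (expCoeff (-iterInt ι 0 [1] b))) (fun w => iterInt ι 0 w b) w)) := by
    intro b hb
    simp only [regInt_of_getLast? ι _ w hw]
    refine tendsto_lmul_letterSeries 1 w (fun n => ?_) fun v hv =>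
      tendsto_iterInt_nhdsGT_zero ι v (getLast?_suffix_ne hv hw) hb
    exact ((tendsto_iterInt_nhdsGT_zero ι [1] (by simp) hb).neg.pow n).const_mul _
  -- The joint limit is turned into an iterated one: for fixed $b$ the limit $a\to0$ stays in a
  -- closed neighbourhood of `I w`.
  refine (closed_nhds_basis (I w)).tendsto_right_iff.2 fun U hU => ?_
  have h3 : ∀ᶠ p in 𝓝[<] (1 : ℝ) ×ˢ 𝓝[>] (0 : ℝ), regInt ι p.swap w ∈ U :=
    (h1.comp tendsto_prod_swap) hU.1
  filter_upwards [h3.curry, Ioo_mem_nhdsLT (show (0 : ℝ) < 1 from zero_lt_one)] with b hb hb'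
  exact hU.2.mem_of_tendsto (h2 b hb') hb

end RegInt

/-! ### Termwise integration and Abel summation of power series. -/

section PowerSeriesExpansion

theorem summable_mul_pow_of_norm_le {β : ℕ → ℂ} {C r : ℝ} (hβ : ∀ n : ℕ, ‖β n‖ ≤ C * ((n : ℝ) + 1))
    (hr0 : 0 ≤ r) (hr : r < 1) : Summable fun n => ‖β n‖ * r ^ n := by
  have h1 : Summable fun n : ℕ => ((n : ℝ) + 1) * r ^ n := by
    have h := (summable_pow_mul_geometric_of_norm_lt_one (R := ℝ) 1 (r := r)
      (by rwa [Real.norm_of_nonneg hr0])).add (summable_geometric_of_lt_one hr0 hr)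
    refine h.congr fun n => ?_
    simp; ring
  refine Summable.of_nonneg_of_le (fun n => by positivity) (fun n => ?_) (h1.mul_left C)
  rw [← mul_assoc]
  exact mul_le_mul_of_nonneg_right (hβ n) (by positivity)

theorem summable_of_norm_le {β : ℕ → ℂ} {C : ℝ} (hβ : ∀ n : ℕ, ‖β n‖ ≤ C * ((n : ℝ) + 1))
    {x : ℂ} (hx : ‖x‖ < 1) : Summable fun n => β n * x ^ n := by
  refine Summable.of_norm ((summable_mul_pow_of_norm_le hβ (norm_nonneg x) hx).congr fun n => ?_)
  rw [norm_mul, norm_pow]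

/-- Termwise integration of a power series. -/
theorem hasSum_integral_of_norm_le {β : ℕ → ℂ} {C : ℝ} (hβ : ∀ n : ℕ, ‖β n‖ ≤ C * ((n : ℝ) + 1))
    {g : ℝ → ℂ} {t : ℝ} (ht : t ∈ Ico (0 : ℝ) 1)
    (hg : ∀ s ∈ Ioc 0 t, HasSum (fun n => β n * (s : ℂ) ^ n) (g s)) :
    HasSum (fun n : ℕ => β n * (t : ℂ) ^ (n + 1) / ((n : ℂ) + 1)) (∫ s in (0 : ℝ)..t, g s) := by
  have h := intervalIntegral.hasSum_integral_of_dominated_convergence (μ := volume) (a := 0) (b := t)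
    (F := fun n s => β n * (s : ℂ) ^ n) (f := g) (fun n _ => ‖β n‖ * t ^ n) ?_ ?_ ?_ ?_ ?_
  · refine h.congr_fun fun n => ?_
    rw [intervalIntegral.integral_const_mul]
    have : ∫ s in (0 : ℝ)..t, (s : ℂ) ^ n = (t : ℂ) ^ (n + 1) / ((n : ℂ) + 1) := by
      have h : ∫ s in (0 : ℝ)..t, ((s ^ n : ℝ) : ℂ) = ((∫ s in (0 : ℝ)..t, s ^ n : ℝ) : ℂ) :=
        intervalIntegral.integral_ofReal
      rw [integral_pow] at h
      simpa using h
    rw [this]; ring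
  · exact fun n => (continuous_const.mul (Complex.continuous_ofReal.pow n)).aestronglyMeasurable
  · refine fun n => Eventually.of_forall fun s hs => ?_
    rw [uIoc_of_le ht.1] at hs
    rw [norm_mul, norm_pow, Complex.norm_real, Real.norm_of_nonneg hs.1.le]
    exact mul_le_mul_of_nonneg_left (pow_le_pow_left₀ hs.1.le hs.2 n) (norm_nonneg _)
  · exact Eventually.of_forall fun s _ => summable_mul_pow_of_norm_le hβ ht.1 ht.2
  · exact intervalIntegrable_const
  · refine Eventually.of_forall fun s hs => ?_
    rw [uIoc_of_le ht.1] at hs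
    exact hg s hs

/-- The generating series of the partial sums. -/
theorem one_sub_mul_tsum_partialSum {c S : ℕ → ℂ} (hS0 : S 0 = c 0)
    (hS : ∀ n, S (n + 1) = S n + c (n + 1)) {x : ℂ} (h : Summable fun n => S n * x ^ n) :
    HasSum (fun n => c n * x ^ n) ((1 - x) * ∑' n, S n * x ^ n) := by
  have h1 : HasSum (fun n => S (n + 1) * x ^ (n + 1)) (∑' n, S n * x ^ n - S 0) := by
    have := (hasSum_nat_add_iff' 1).2 h.hasSum
    simpa using this
  have h2 := h1.sub (h.hasSum.mul_left x)
  have h3 : HasSum (fun n => c (n + 1) * x ^ (n + 1))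
      (∑' n, S n * x ^ n - S 0 - x * ∑' n, S n * x ^ n) := by
    refine h2.congr_fun fun n => ?_
    rw [hS, pow_succ]; ring
  have h4 := (hasSum_nat_add_iff (f := fun n => c n * x ^ n) 1).1 h3
  have h5 : (1 - x) * ∑' n, S n * x ^ n = ∑' n, S n * x ^ n - S 0 - x * ∑' n, S n * x ^ n +
      ∑ i ∈ Finset.range 1, c i * x ^ i := by
    rw [Finset.sum_range_one, hS0]; ring
  rwa [h5]

end PowerSeriesExpansion

/-! ### Words in $Y$ read as words in $X$. -/

section WordX

variable {Γ : Type*}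

/-- The word in `X` that a word in `Y` stands for. -/
def wordX : List (Y Γ) → List (X Γ)
  | [] => []
  | p :: w => List.replicate ((p.1 : ℕ) - 1) 0 ++ (p.2 : X Γ) :: wordX w

theorem toX_ofList (w : List (Y Γ)) :
    toX (FreeMonoid.ofList w) = FreeMonoid.ofList (wordX w) := by
  induction w with
  | nil => rfl
  | cons p w ih =>
    have hpow : ∀ n : ℕ, (x 0 : FreeMonoid (X Γ)) ^ n = FreeMonoid.ofList (List.replicate n 0) := by
      intro n
      induction n with
      | zero => rfl
      | succ n ih => rw [pow_succ', ih]; rfl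
    rw [FreeMonoid.ofList_cons, map_mul, ih]
    have : toX (FreeMonoid.of p) = x 0 ^ ((p.1 : ℕ) - 1) * x (p.2 : X Γ) := FreeMonoid.lift_eval_of _ _
    rw [this, hpow, mul_assoc]
    rfl

theorem getLast?_wordX (w : List (Y Γ)) : (wordX w).getLast? ≠ some 0 := by
  induction w with
  | nil => simp [wordX]
  | cons p w ih =>
    rw [wordX, List.getLast?_append_of_ne_nil _ (List.cons_ne_nil _ _)]
    cases h : wordX w with
    | nil => simp
    | cons c v => rw [List.getLast?_cons_cons, ← h]; exact ih

end WordX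

/-! ### Polylogarithms as Abel means of truncated sums. -/

section Expansion

variable {Γ : Type*} [CommGroup Γ] (ι : Γ →* ℂˣ)

/-- The coefficients of the power series expansion of a multiple polylogarithm. -/
def sumCoeff : List (Y Γ) → ℕ → ℂ
  | [], n => if n = 0 then 1 else 0
  | p :: w, n => sumFactor ι p n * iterSum ι w n

/-- The cutoff $n_1<N$ is strict, so the partial sum of the coefficients through degree $n$ is the
truncated sum at $n+1$. The base case covers the empty word, whose only coefficient is in degree
$0$. -/
theorem sumCoeff_zero (w : List (Y Γ)) : iterSum ι w 1 = sumCoeff ι w 0 := by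
  cases w with
  | nil => simp [iterSum, sumCoeff]
  | cons p w => simp [iterSum_cons, sumCoeff]

theorem iterSum_succ_succ (w : List (Y Γ)) (n : ℕ) :
    iterSum ι w (n + 1 + 1) = iterSum ι w (n + 1) + sumCoeff ι w (n + 1) := by
  cases w with
  | nil => simp [iterSum, sumCoeff]
  | cons p w => rw [iterSum_cons_succ]; rfl

theorem wordX_replicate (n : ℕ) :
    wordX (List.replicate n (yOne 0)) = List.replicate n (1 : X Γ) := by
  induction n with
  | zero => rfl
  | succ n ih => rw [List.replicate_succ, wordX, ih]; rfl

/-- Integration against `dt/t`. -/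
theorem hasSum_iterInt_replicate_zero {α : ℕ → ℂ} {C : ℝ} (hα : ∀ n : ℕ, ‖α n‖ ≤ C * ((n : ℝ) + 1))
    (hα0 : α 0 = 0) (v : List (X Γ)) (h : ∀ t ∈ Ico (0 : ℝ) 1,
      HasSum (fun n => α n * (t : ℂ) ^ n) (iterInt ι 0 v t)) (j : ℕ) :
    ∀ t ∈ Ico (0 : ℝ) 1, HasSum (fun n => α n / (n : ℂ) ^ j * (t : ℂ) ^ n)
      (iterInt ι 0 (List.replicate j 0 ++ v) t) := by
  induction j with
  | zero => simpa using h
  | succ j ih =>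
    intro t ht
    have hb : ∀ n : ℕ, ‖α (n + 1) / ((n + 1 : ℕ) : ℂ) ^ j‖ ≤ (2 * C) * ((n : ℝ) + 1) := by
      intro n
      have hC : 0 ≤ C := by simpa using (norm_nonneg _).trans (hα 0)
      have h1 : (1 : ℝ) ≤ ((n + 1 : ℕ) : ℝ) := by exact_mod_cast Nat.succ_le_succ (Nat.zero_le n)
      rw [norm_div, norm_pow, Complex.norm_natCast]
      refine (div_le_self (norm_nonneg _) (one_le_pow₀ h1)).trans ((hα (n + 1)).trans ?_)
      push_cast
      nlinarith [(Nat.cast_nonneg n : (0 : ℝ) ≤ n)]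
    have h1 := hasSum_integral_of_norm_le hb ht
      (g := fun s => omega ι 0 s * iterInt ι 0 (List.replicate j 0 ++ v) s) fun s hs => ?_
    · rw [← hasSum_nat_add_iff' 1]
      simp only [Finset.range_one, Finset.sum_singleton, hα0, zero_div, zero_mul, sub_zero]
      refine h1.congr_fun fun n => ?_
      push_cast; rw [pow_succ _ j, div_mul_eq_div_div]; ring
    · have hs1 : s < 1 := hs.2.trans_lt ht.2
      have h2 := (hasSum_nat_add_iff' 1).2 (ih s ⟨hs.1.le, hs1⟩)
      simp only [Finset.range_one, Finset.sum_singleton, hα0, zero_div, zero_mul, sub_zero] at h2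
      have hs0 : (s : ℂ) ≠ 0 := by exact_mod_cast hs.1.ne'
      rw [omega_zero]
      refine (h2.mul_left (1 / (s : ℂ))).congr_fun fun n => ?_
      rw [pow_succ]; field_simp

variable [Finite Γ]

theorem exists_norm_iterSum_le_linear (w : List (Y Γ)) :
    ∃ C : ℝ, 0 ≤ C ∧ ∀ N : ℕ, ‖iterSum ι w N‖ ≤ C * ((N : ℝ) + 1) := by
  obtain ⟨C, hC, h⟩ := exists_norm_iterSum_le ι w
  refine ⟨C, hC, fun N => (h N).trans (mul_le_mul_of_nonneg_left ?_ hC)⟩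
  have : (1 : ℝ) ≤ (N : ℝ) + 1 := by linarith [(Nat.cast_nonneg N : (0 : ℝ) ≤ N)]
  exact (Real.rpow_le_rpow_of_exponent_le this (by norm_num)).trans (Real.rpow_one _).le

theorem exists_norm_iterSum_succ_le_linear (w : List (Y Γ)) :
    ∃ C : ℝ, 0 ≤ C ∧ ∀ N : ℕ, ‖iterSum ι w (N + 1)‖ ≤ C * ((N : ℝ) + 1) := by
  obtain ⟨C, hC, h⟩ := exists_norm_iterSum_le_linear ι w
  refine ⟨2 * C, by positivity, fun N => (h (N + 1)).trans ?_⟩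
  push_cast
  nlinarith [(Nat.cast_nonneg N : (0 : ℝ) ≤ N)]

theorem tsum_sumCoeff (w : List (Y Γ)) {z : ℂ} (hz : ‖z‖ < 1) :
    HasSum (fun n => sumCoeff ι w n * z ^ n) ((1 - z) * ∑' n, iterSum ι w (n + 1) * z ^ n) := by
  obtain ⟨C, -, h⟩ := exists_norm_iterSum_succ_le_linear ι w
  exact one_sub_mul_tsum_partialSum (S := fun n => iterSum ι w (n + 1)) (sumCoeff_zero ι w)
    (iterSum_succ_succ ι w) (summable_of_norm_le h hz)

theorem norm_pow_mul_le (τ : Γ) {a : ℂ} {C : ℝ} (n : ℕ) (h : ‖a‖ ≤ C) : ‖(ι τ : ℂ) ^ n * a‖ ≤ C := by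
  rwa [norm_mul, norm_pow, norm_character, one_pow, one_mul]

/-- Integration against `ω_τ`. -/
theorem hasSum_iterInt_coe (τ : Γ) (w : List (Y Γ)) (v : List (X Γ))
    (h : ∀ t ∈ Ico (0 : ℝ) 1,
      HasSum (fun n => (ι τ : ℂ) ^ n * sumCoeff ι w n * (t : ℂ) ^ n) (iterInt ι 0 v t)) :
    ∀ t ∈ Ico (0 : ℝ) 1, HasSum (fun n => (ι τ : ℂ) ^ n * (iterSum ι w n / n) * (t : ℂ) ^ n)
      (iterInt ι 0 ((τ : X Γ) :: v) t) := by
  intro t ht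
  obtain ⟨C, hC, hb⟩ := exists_norm_iterSum_succ_le_linear ι w
  have h1 := hasSum_integral_of_norm_le (β := fun n => (ι τ : ℂ) ^ (n + 1) * iterSum ι w (n + 1))
    (C := C) (fun n => norm_pow_mul_le ι τ _ (hb n)) ht
    (g := fun s => omega ι (τ : X Γ) s * iterInt ι 0 v s) fun s hs => ?_
  · rw [← hasSum_nat_add_iff' 1]
    simp only [Finset.range_one, Finset.sum_singleton, Nat.cast_zero, div_zero, mul_zero, zero_mul,
      sub_zero]
    refine h1.congr_fun fun n => ?_
    push_cast; ring
  · have hs1 : s < 1 := hs.2.trans_lt ht.2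
    set q : ℂ := (ι τ : ℂ) * s with hq
    have hqn : ‖q‖ < 1 := by
      rw [hq, norm_mul, norm_character, one_mul, Complex.norm_real, Real.norm_of_nonneg hs.1.le]
      exact hs1
    have h2 := tsum_sumCoeff ι w hqn
    have h3 : iterInt ι 0 v s = (1 - q) * ∑' n, iterSum ι w (n + 1) * q ^ n := by
      refine (h s ⟨hs.1.le, hs1⟩).unique (h2.congr_fun fun n => ?_)
      rw [hq, mul_pow]; ring
    -- From $1/(\tau^{-1}-s)=\tau/(1-\tau s)$: the form cancels the factor $1-q$ and turns
    -- coefficients into partial sums.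
    have h4 : omega ι (τ : X Γ) s * iterInt ι 0 v s =
        (ι τ : ℂ) * ∑' n, iterSum ι w (n + 1) * q ^ n := by
      have hq1 : 1 - q ≠ 0 := fun h => by
        rw [← sub_eq_zero.1 h, norm_one] at hqn
        exact lt_irrefl _ hqn
      have hτ : (ι τ : ℂ) ≠ 0 := Units.ne_zero _
      have : (ι τ : ℂ)⁻¹ - s = (ι τ : ℂ)⁻¹ * (1 - q) := by rw [hq]; field_simp
      rw [h3, omega_coe, this]
      field_simp
    rw [h4]
    refine ((summable_of_norm_le hb hqn).hasSum.mul_left _).congr_fun fun n => ?_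
    rw [hq, mul_pow]; ring

/-- The power series expansion of multiple polylogarithms. -/
theorem hasSum_iterInt_wordX (w : List (Y Γ)) (g : Γ) : ∀ t ∈ Ico (0 : ℝ) 1,
    HasSum (fun n => (ι g : ℂ) ^ n * sumCoeff ι w n * (t : ℂ) ^ n)
      (iterInt ι 0 (wordX (psAux g w)) t) := by
  -- `g` is the product of the characters of the outer letters. The inner integral must carry the
  -- power $(g\sigma)^n$ for $\omega_{g\sigma}$ to produce the partial sums; this is why running
  -- products, the inverse of $q_s$ on words, occur.
  induction w generalizing g with
  | nil =>
    intro t _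
    have := hasSum_ite_eq (0 : ℕ) (1 : ℂ)
    refine this.congr_fun fun n => ?_
    by_cases hn : n = 0 <;> simp [sumCoeff, hn]
  | cons p w ih =>
    obtain ⟨s, σ⟩ := p
    obtain ⟨C, hC, hb⟩ := exists_norm_iterSum_le_linear ι w
    have h1 := hasSum_iterInt_coe ι (g * σ) w _ (ih (g * σ))
    have h2 := hasSum_iterInt_replicate_zero ι (C := C) (fun n => ?_) (by simp) _ h1 ((s : ℕ) - 1)
    · intro t ht
      refine (h2 t ht).congr_fun fun n => ?_
      have : (n : ℂ) ^ (s : ℕ) = n * (n : ℂ) ^ ((s : ℕ) - 1) := by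
        rw [← pow_succ', Nat.sub_add_cancel s.pos]
      simp only [sumCoeff, sumFactor, map_mul, Units.val_mul, mul_pow, this]
      rcases Nat.eq_zero_or_pos n with rfl | hn
      · simp
      · have : (n : ℂ) ≠ 0 := by exact_mod_cast hn.ne'
        field_simp
    · refine norm_pow_mul_le ι _ n ?_
      rw [norm_div, Complex.norm_natCast]
      rcases Nat.eq_zero_or_pos n with rfl | hn
      · simpa using hC
      · exact (div_le_self (norm_nonneg _) (by exact_mod_cast hn)).trans (hb n)

/-- Multiple polylogarithms as Abel means of iterated sums. -/
theorem iterInt_wordX_eq (w : List (Y Γ)) {z : ℝ} (hz : z ∈ Ico (0 : ℝ) 1) :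
    HasSum (fun n : ℕ => (1 - (z : ℂ)) * (iterSum ι w (n + 1) * (z : ℂ) ^ n))
      (iterInt ι 0 (wordX (psAux 1 w)) z) := by
  have hzn : ‖(z : ℂ)‖ < 1 := by rw [Complex.norm_real, Real.norm_of_nonneg hz.1]; exact hz.2
  have h1 := hasSum_iterInt_wordX ι w 1 z hz
  simp only [map_one, Units.val_one, one_pow, one_mul] at h1
  rw [h1.unique (tsum_sumCoeff ι w hzn)]
  obtain ⟨C, -, hb⟩ := exists_norm_iterSum_succ_le_linear ι w
  exact (summable_of_norm_le hb hzn).hasSum.mul_left _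

end Expansion

/-! ### An Abelian estimate, and logarithms against powers. -/

section Abel

theorem rpow_le_rpow_of_le_one {ε s t : ℝ} (h0 : 0 < ε) (h1 : ε ≤ 1) (hst : s ≤ t) :
    ε ^ t ≤ ε ^ s := Real.rpow_le_rpow_of_exponent_ge h0 h1 hst

/-- An Abelian estimate. -/
theorem norm_le_of_hasSum_abel {d : ℕ → ℂ} {C : ℝ}
    (hd : ∀ n : ℕ, ‖d n‖ ≤ C * ((n : ℝ) + 1) ^ (-(1 / 4) : ℝ)) {z : ℝ} (hz : z ∈ Ico (0 : ℝ) 1)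
    {S : ℂ} (h : HasSum (fun n : ℕ => (1 - (z : ℂ)) * (d n * (z : ℂ) ^ n)) S) :
    ‖S‖ ≤ 3 * C * (1 - z) ^ (1 / 8 : ℝ) := by
  have hC : 0 ≤ C := by simpa using (norm_nonneg _).trans (hd 0)
  set ε := 1 - z with hε
  have h0 : 0 < ε := by rw [hε]; linarith [hz.2]
  have h1 : ε ≤ 1 := by rw [hε]; linarith [hz.1]
  -- Cut at about $\varepsilon^{-1/2}$: the terms before contribute at most $\varepsilon MC$, and
  -- those after satisfy $(n+1)^{-1/4}\le\varepsilon^{1/8}$.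
  set M : ℕ := ⌈ε ^ (-(1 / 2) : ℝ)⌉₊ with hM
  have hfin : HasSum (fun n : ℕ => if n < M then ε * C else 0) (M * (ε * C)) := by
    have : HasSum (fun n : ℕ => if n < M then ε * C else 0)
        (∑ n ∈ Finset.range M, if n < M then ε * C else 0) :=
      hasSum_sum_of_ne_finset_zero fun n hn => if_neg (by simpa using hn)
    rwa [Finset.sum_congr rfl fun n hn => if_pos (Finset.mem_range.1 hn), Finset.sum_const,
      Finset.card_range, nsmul_eq_mul] at this
  have hgeo : HasSum (fun n : ℕ => ε * C * ε ^ (1 / 8 : ℝ) * z ^ n)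
      (ε * C * ε ^ (1 / 8 : ℝ) * ε⁻¹) := (hasSum_geometric_of_lt_one hz.1 hz.2).mul_left _
  rw [← h.tsum_eq]
  refine (tsum_of_norm_bounded (hfin.add hgeo) fun n => ?_).trans ?_
  · have hz1 : ‖1 - (z : ℂ)‖ = ε := by
      rw [← Complex.ofReal_one, ← Complex.ofReal_sub, Complex.norm_real, Real.norm_of_nonneg h0.le]
    rw [norm_mul, norm_mul, norm_pow, Complex.norm_real, Real.norm_of_nonneg hz.1, hz1]
    have hn : (0 : ℝ) < (n : ℝ) + 1 := by positivity
    have hzn : 0 ≤ z ^ n := pow_nonneg hz.1 n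
    split_ifs with hnM
    · have h2 : ((n : ℝ) + 1) ^ (-(1 / 4) : ℝ) ≤ 1 :=
        Real.rpow_le_one_of_one_le_of_nonpos (by linarith [(Nat.cast_nonneg n : (0 : ℝ) ≤ n)])
          (by norm_num)
      have h3 : ‖d n‖ * z ^ n ≤ C * 1 := mul_le_mul
        ((hd n).trans (mul_le_of_le_one_right hC h2)) (pow_le_one₀ hz.1 hz.2.le) hzn hC
      calc ε * (‖d n‖ * z ^ n) ≤ ε * (C * 1) := mul_le_mul_of_nonneg_left h3 h0.le
        _ ≤ ε * C + ε * C * ε ^ (1 / 8 : ℝ) * z ^ n := by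
          rw [mul_one]
          exact le_add_of_nonneg_right (mul_nonneg (by positivity) hzn)
    · have h2 : ε ^ (-(1 / 2) : ℝ) ≤ (n : ℝ) + 1 := by
        have : (M : ℝ) ≤ n := by exact_mod_cast not_lt.1 hnM
        linarith [Nat.le_ceil (ε ^ (-(1 / 2) : ℝ))]
      have h3 : ((n : ℝ) + 1) ^ (-(1 / 4) : ℝ) ≤ ε ^ (1 / 8 : ℝ) := by
        have := Real.rpow_le_rpow_of_nonpos (Real.rpow_pos_of_pos h0 _) h2
          (by norm_num : (-(1 / 4) : ℝ) ≤ 0)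
        rwa [← Real.rpow_mul h0.le, show (-(1 / 2) : ℝ) * (-(1 / 4)) = 1 / 8 by norm_num] at this
      rw [zero_add]
      calc ε * (‖d n‖ * z ^ n) ≤ ε * ((C * ε ^ (1 / 8 : ℝ)) * z ^ n) := by
            refine mul_le_mul_of_nonneg_left (mul_le_mul_of_nonneg_right ?_ hzn) h0.le
            exact (hd n).trans (mul_le_mul_of_nonneg_left h3 hC)
        _ = _ := by ring
  -- The constant $3$: $M\varepsilon\le\varepsilon^{1/2}+\varepsilon\le2\varepsilon^{1/8}$ from the
  -- initial terms, and $\varepsilon^{1/8}$ from the tail, whose geometric sum is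
  -- $\varepsilon^{-1}$.
  · have h2 : (M : ℝ) ≤ ε ^ (-(1 / 2) : ℝ) + 1 :=
      (Nat.ceil_lt_add_one (Real.rpow_nonneg h0.le _)).le
    have h3 : ε * ε ^ (-(1 / 2) : ℝ) ≤ ε ^ (1 / 8 : ℝ) := by
      nth_rewrite 1 [← Real.rpow_one ε]
      rw [← Real.rpow_add h0]
      exact rpow_le_rpow_of_le_one h0 h1 (by norm_num)
    have h4 : ε ≤ ε ^ (1 / 8 : ℝ) := by
      nth_rewrite 1 [← Real.rpow_one ε]
      exact rpow_le_rpow_of_le_one h0 h1 (by norm_num)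
    have h5 : ε * C * ε ^ (1 / 8 : ℝ) * ε⁻¹ = C * ε ^ (1 / 8 : ℝ) := by field_simp
    rw [h5]
    have h6 : (M : ℝ) * (ε * C) ≤ (ε ^ (-(1 / 2) : ℝ) + 1) * (ε * C) :=
      mul_le_mul_of_nonneg_right h2 (by positivity)
    have h7 : C * (ε * ε ^ (-(1 / 2) : ℝ) + ε) ≤ C * (ε ^ (1 / 8 : ℝ) + ε ^ (1 / 8 : ℝ)) :=
      mul_le_mul_of_nonneg_left (add_le_add h3 h4) hC
    linarith

/-- The exponent $1/16$ is chosen below the saving $1/8$ of the Abelian estimate. -/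
theorem exists_neg_log_pow_le (j : ℕ) : ∃ C : ℝ, 0 ≤ C ∧ ∀ ε : ℝ, 0 < ε → ε ≤ 1 →
    (-Real.log ε) ^ j ≤ C * ε ^ (-(1 / 16) : ℝ) := by
  set δ : ℝ := 1 / 16 / (j + 1) with hδ
  have hδ0 : 0 < δ := by positivity
  refine ⟨(1 / δ) ^ j, by positivity, fun ε h0 h1 => ?_⟩
  have h2 : -Real.log ε ≤ 1 / δ * ε ^ (-δ) := by
    have := Real.log_le_rpow_div (inv_nonneg.2 h0.le) hδ0
    rwa [Real.log_inv, Real.inv_rpow h0.le, ← Real.rpow_neg h0.le, div_eq_mul_one_div,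
      mul_comm] at this
  have h3 : 0 ≤ -Real.log ε := by linarith [Real.log_nonpos h0.le h1]
  calc (-Real.log ε) ^ j ≤ (1 / δ * ε ^ (-δ)) ^ j := pow_le_pow_left₀ h3 h2 j
    _ = (1 / δ) ^ j * ε ^ (-δ * j) := by rw [mul_pow, Real.rpow_mul_natCast h0.le]
    _ ≤ _ := by
      refine mul_le_mul_of_nonneg_left (rpow_le_rpow_of_le_one h0 h1 ?_) (by positivity)
      rw [neg_mul, neg_le_neg_iff, hδ, div_mul_eq_mul_div, div_le_iff₀ (by positivity)]
      linarith

end Abel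

/-! ### Comparison of regularised sums and regularised integrals. -/

section Comparison

variable {Γ : Type*} [CommGroup Γ] (ι : Γ →* ℂˣ)

theorem psAux_replicate (n : ℕ) :
    psAux 1 (List.replicate n (yOne 0)) = List.replicate n (yOne (Γ := Γ) 0) := by
  induction n with
  | zero => rfl
  | succ n ih =>
    rw [List.replicate_succ, yOne, psAux, mul_one]
    exact congrArg _ ih

/-- The shuffle product of $x$ and $x^n$ is $(n+1)x^{n+1}$, which gives the recursion for $c^n/n!$.
-/
theorem GroupLike.apply_replicate {A : Type*} {Φ : List A → ℂ} (hΦ : GroupLike noContraction Φ)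
    (x : A) (n : ℕ) : Φ (List.replicate n x) = expCoeff (Φ [x]) n := by
  have hq : ∀ (n : ℕ) (Φ : List A → ℂ), qshPair noContraction Φ [x] (List.replicate n x) =
      ((n : ℂ) + 1) * Φ (List.replicate (n + 1) x) := by
    intro n
    induction n with
    | zero => simp
    | succ n ih =>
      intro Φ
      rw [List.replicate_succ, qshPair_cons_cons, ih]
      simp [noContraction, List.replicate_succ]
      ring
  induction n with
  | zero => rw [expCoeff_zero_right]; exact hΦ.1
  | succ n ih =>
    have h := hq n Φ
    rw [hΦ.2, ih] at h
    refine mul_left_cancel₀ (Nat.cast_add_one_ne_zero n) (h.symm.trans ?_)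
    simp only [expCoeff, Nat.factorial_succ, pow_succ]
    have h1 : ((n : ℂ) + 1) ≠ 0 := Nat.cast_add_one_ne_zero n
    have h2 : (n.factorial : ℂ) ≠ 0 := by exact_mod_cast n.factorial_ne_zero
    simp
    field_simp

/-- Removing a leading $y_{1,1}$ removes a leading $x_1$ and leaves the running product equal to
$1$. Any other first letter gives a word not starting with $x_1$, where neither factor acts. -/
theorem lmul_wordX (p : ℕ → ℂ) (Ψ : List (X Γ) → ℂ) (w : List (Y Γ)) :
    lmul (letterSeries (yOne 0) p) (fun w => Ψ (wordX (psAux 1 w))) w =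
      lmul (letterSeries 1 p) Ψ (wordX (psAux 1 w)) := by
  induction w generalizing p Ψ with
  | nil => rfl
  | cons q w ih =>
    obtain ⟨s, σ⟩ := q
    by_cases h : ((s, σ) : Y Γ) = yOne 0
    · obtain ⟨rfl, rfl⟩ := Prod.ext_iff.1 h
      have h1 : wordX (psAux 1 (((0 : ℕ).succPNat, 1) :: w)) =
          (1 : X Γ) :: wordX (psAux (1 : Γ) w) := by
        rw [psAux, mul_one]; rfl
      have h2 := ih (fun n => p (n + 1)) Ψ
      rw [lmul_letterSeries_cons, if_pos h, h2]
      have h3 : wordX (psAux 1 ((yOne 0 : Y Γ) :: w)) = (1 : X Γ) :: wordX (psAux (1 : Γ) w) := h1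
      change p 0 * Ψ (wordX (psAux 1 ((yOne 0 : Y Γ) :: w))) + _ =
        lmul (letterSeries 1 p) Ψ (wordX (psAux 1 ((yOne 0 : Y Γ) :: w)))
      rw [h3, lmul_letterSeries_cons, if_pos rfl]
    · rw [lmul_letterSeries_of_head _ _ _ _ (by simpa using h),
        lmul_letterSeries_of_head]
      rw [psAux, one_mul, wordX]
      intro h'
      apply h
      rcases Nat.eq_zero_or_pos ((s : ℕ) - 1) with h0 | h0
      · simp only [h0, List.replicate_zero, List.nil_append, List.head?_cons, Option.some.injEq] at h'
        have h1 : σ = 1 := WithZero.coe_inj.1 h'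
        have h2 : s = (0 : ℕ).succPNat := PNat.eq (by
          have := s.pos
          change (s : ℕ) = 1
          omega)
        rw [h1, h2]; rfl
      · obtain ⟨m, hm⟩ := Nat.exists_eq_succ_of_ne_zero h0.ne'
        simp [hm, List.replicate_succ] at h'

/-- The exponents combine to leave a decaying bound. -/
theorem exists_norm_lmul_le {J A : Type*} {x : A} {b₁ b₂ : J → ℝ} (hb₁ : ∀ i, 0 ≤ b₁ i)
    (p : J → ℕ → ℂ) (Ψ : J → List (A) → ℂ) (hp : ∀ n, ∃ C, 0 ≤ C ∧ ∀ i, ‖p i n‖ ≤ C * b₁ i)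
    (hΨ : ∀ w, ∃ C, ∀ i, ‖Ψ i w‖ ≤ C * b₂ i) (w : List (A)) :
    ∃ C, ∀ i, ‖lmul (letterSeries x (p i)) (Ψ i) w‖ ≤ C * (b₁ i * b₂ i) := by
  refine lmul_letterSeries_induction (P := fun f => ∃ C : ℝ, ∀ i, ‖f i‖ ≤ C * (b₁ i * b₂ i))
    ⟨0, by simp⟩ (fun f g hf hg => ?_) x p Ψ w fun v _ n => ?_
  · obtain ⟨C, hC⟩ := hf
    obtain ⟨D, hD⟩ := hg
    exact ⟨C + D, fun i => by
      rw [add_mul]; exact (norm_add_le _ _).trans (add_le_add (hC i) (hD i))⟩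
  · obtain ⟨C, hC0, hC⟩ := hp n
    obtain ⟨D, hD⟩ := hΨ v
    refine ⟨C * D, fun i => ?_⟩
    rw [norm_mul]
    calc _ ≤ (C * b₁ i) * (D * b₂ i) := mul_le_mul (hC i) (hD i) (norm_nonneg _)
          (mul_nonneg hC0 (hb₁ i))
      _ = _ := by ring

/-- The quotient of `L` by its part supported on the powers of `y_{1,1}`. -/
def strippedSum (L : List (Y Γ) → ℂ) : List (Y Γ) → ℂ :=
  lmul (powSeries (yOne 0) (expPS (corrPS fun n => riemannZeta n))⁻¹) L

theorem lmul_strippedSum (L : List (Y Γ) → ℂ) :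
    lmul (powSeries (yOne 0) (expPS (corrPS fun n => riemannZeta n))) (strippedSum L) = L := by
  rw [strippedSum, ← lmul_assoc, lmul_powSeries, PowerSeries.mul_inv_cancel, lmul_one_left]
  have := coeff_zero_expPS (corrPS fun n => riemannZeta n)
  rw [PowerSeries.coeff_zero_eq_constantCoeff_apply] at this
  rw [this]
  exact one_ne_zero

theorem iterSum_eq_lmul_regSum (N : ℕ) : (fun w => iterSum ι w N) =
    lmul (letterSeries (yOne 0) (expCoeff (iterSum ι [yOne 0] N))) (regSum ι N) := by
  rw [regSum, ← lmul_assoc, expCoeff_mul_expCoeff, add_neg_cancel, lmul_expCoeff_zero]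

/-- The truncated series and its part on powers of $y_{1,1}$ share the divergent factor
$\exp(H_Ny_{1,1})$, with $H_N$ the harmonic sum. Once it is pulled out on the left, the bracket
involves only convergent regularised quantities. -/
theorem iterSum_sub_eq (L : List (Y Γ) → ℂ) (N : ℕ) (w : List (Y Γ)) :
    iterSum ι w N - lmul (letterSeries (yOne 0) fun m => iterSum ι (List.replicate m (yOne 0)) N)
      (strippedSum L) w = lmul (letterSeries (yOne 0) (expCoeff (iterSum ι [yOne 0] N)))
        (fun v => regSum ι N v + -1 * lmul (letterSeries (yOne 0)
          fun m => regSum ι N (List.replicate m (yOne 0))) (strippedSum L) v) w := by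
  have h1 : (letterSeries (yOne (Γ := Γ) 0) fun m => iterSum ι (List.replicate m (yOne 0)) N) =
      lmul (letterSeries (yOne 0) (expCoeff (iterSum ι [yOne 0] N)))
        (letterSeries (yOne 0) fun m => regSum ι N (List.replicate m (yOne 0))) := by
    rw [lmul_letterSeries_letterSeries]
    refine congrArg _ (funext fun m => ?_)
    rw [← lmul_letterSeries_replicate]
    exact congrFun (iterSum_eq_lmul_regSum ι N) _
  rw [lmul_add_right, lmul_smul_right, h1, lmul_assoc, neg_one_mul, ← sub_eq_add_neg,
    ← iterSum_eq_lmul_regSum]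

variable [Finite Γ]

theorem iterInt_replicate_one {z : ℝ} (hz : z ∈ Ioo (0 : ℝ) 1) (n : ℕ) :
    iterInt ι 0 (List.replicate n 1) z = expCoeff (iterInt ι 0 [1] z) n := by
  have hlast : (List.replicate n (1 : X Γ)).getLast? ≠ some 0 := by
    intro h
    have := List.eq_of_mem_replicate (List.mem_of_getLast? h)
    exact zero_ne_one this
  have h1 := tendsto_iterInt_nhdsGT_zero ι _ hlast hz
  have h2 := tendsto_iterInt_nhdsGT_zero ι [1] (by simp) hz
  refine tendsto_nhds_unique h1 (((h2.pow n).const_mul _).congr' ?_)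
  filter_upwards [eventually_mem_Ioo_zero hz.1] with a ha
  exact ((groupLike_iterInt ι ⟨ha.1, ha.2.trans hz.2⟩ hz).apply_replicate 1 n).symm

theorem norm_iterInt_one_le {z : ℝ} (hz : z ∈ Ioo (0 : ℝ) 1) :
    ‖iterInt ι 0 [1] z‖ ≤ -Real.log (1 - z) := by
  have hd : ∀ t ∈ uIcc 0 z, HasDerivAt (fun t => -Real.log (1 - t)) (1 / (1 - t)) t := by
    intro t ht
    rw [uIcc_of_le hz.1.le] at ht
    have h1 : (1 - t) ≠ 0 := by linarith [ht.2, hz.2]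
    refine (((hasDerivAt_const t (1 : ℝ)).sub (hasDerivAt_id t)).log h1).neg.congr_deriv ?_
    simp [neg_div]
  have hc : ContinuousOn (fun t : ℝ => 1 / (1 - t)) (uIcc 0 z) := by
    refine continuousOn_const.div (continuousOn_const.sub continuousOn_id) fun t ht => ?_
    rw [uIcc_of_le hz.1.le] at ht
    have : t < 1 := ht.2.trans_lt hz.2
    linarith
  have hint := hc.intervalIntegrable (μ := volume)
  calc ‖iterInt ι 0 [1] z‖ ≤ ∫ t in (0 : ℝ)..z, 1 / (1 - t) := by
        refine intervalIntegral.norm_integral_le_of_norm_le hz.1.le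
          (Eventually.of_forall fun t ht => ?_) hint
        rw [iterInt_nil, mul_one]
        exact norm_omega_coe_le ι 1 ⟨ht.1.le, ht.2.trans_lt hz.2⟩
    _ = -Real.log (1 - z) := by
        rw [intervalIntegral.integral_eq_sub_of_hasDerivAt hd hint]; simp

variable {L : Series ℂ (Y Γ)}

/-- The coefficients of $\exp(H_Ny_{1,1})$ are $O(N^{1/4})$ and the bracket multiplying it is
$O(N^{-1/2})$. -/
theorem exists_norm_iterSum_sub_le (hι : Function.Injective ι) (hL : IsRegSumSeries ι L)
    (w : List (Y Γ)) : ∃ C : ℝ, ∀ N : ℕ,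
    ‖iterSum ι w N - lmul (letterSeries (yOne 0) fun m => iterSum ι (List.replicate m (yOne 0)) N)
      (strippedSum L) w‖ ≤ C * ((N : ℝ) + 1) ^ (-(1 / 4) : ℝ) := by
  have h := exists_norm_lmul_le (x := yOne (Γ := Γ) 0)
    (b₁ := fun N : ℕ => ((N : ℝ) + 1) ^ (1 / 4 : ℝ))
    (b₂ := fun N : ℕ => ((N : ℝ) + 1) ^ (-(1 / 2) : ℝ)) (fun N => by positivity)
    (fun N => expCoeff (iterSum ι [yOne 0] N))
    (fun N v => regSum ι N v + -1 * lmul (letterSeries (yOne 0)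
          fun m => regSum ι N (List.replicate m (yOne 0))) (strippedSum L) v) (fun n => ?_)
    (fun v => ?_) w
  · obtain ⟨C, hC⟩ := h
    refine ⟨C, fun N => ?_⟩
    refine (congrArg norm (iterSum_sub_eq ι L N w)).trans_le ((hC N).trans (le_of_eq ?_))
    rw [← Real.rpow_add (by positivity)]
    norm_num
  · obtain ⟨C, hC, h⟩ := exists_harm_pow_le n (δ := 1 / 4) (by norm_num)
    refine ⟨‖algebraMap ℚ ℂ (1 / (n.factorial : ℚ))‖ * C, by positivity, fun N => ?_⟩
    rw [expCoeff, norm_mul, norm_pow, mul_assoc]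
    refine mul_le_mul_of_nonneg_left ((pow_le_pow_left₀ (norm_nonneg _) ?_ n).trans (h N))
      (norm_nonneg _)
    simpa using norm_iterSum_le ι [yOne 0] N
  · have h1 := hL.hasRate ι hι
    -- The part on powers of $y_{1,1}$ tends to the corresponding part $E$ of `L`, and $E$ times the
    -- stripped series is `L`, so the two terms of the bracket have the same limit.
    have h2 : HasRate (fun N => lmul (letterSeries (yOne 0)
        fun m => regSum ι N (List.replicate m (yOne 0))) (strippedSum L) v) (L v) := by
      have := lmul_letterSeries_induction (J := Option ℕ)
        (P := fun f => HasRate (fun N => f (some N)) (f none)) HasRate.zero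
        (fun f g hf hg => hf.add hg) (yOne 0)
        (fun i m => i.elim (L (List.replicate m (yOne 0)))
          fun N => regSum ι N (List.replicate m (yOne 0))) (fun _ => strippedSum L) v
        (fun v _ n => ?_)
      · have h3 : (letterSeries (yOne (Γ := Γ) 0) fun m => L (List.replicate m (yOne 0))) =
            powSeries (yOne 0) (expPS (corrPS fun n => riemannZeta n)) :=
          congrArg _ (funext fun m => hL.apply_replicate ι m)
        have h4 := congrFun (lmul_strippedSum L) v
        rw [← h3] at h4
        rw [← h4]
        exact this
      · have := (h1 (List.replicate n (yOne 0))).const_mul (strippedSum L v)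
        simp only [mul_comm (strippedSum L v)] at this
        exact this
    obtain ⟨C, hC⟩ := (h1 v).add (h2.const_mul (-1))
    refine ⟨C, fun N => ?_⟩
    have := hC N
    rwa [neg_one_mul (L v), add_neg_cancel, sub_zero] at this

/-- The regularisation relation for the truncated objects. -/
theorem exists_norm_iterInt_sub_le (hι : Function.Injective ι) (hL : IsRegSumSeries ι L)
    (w : List (Y Γ)) : ∃ C : ℝ, ∀ z : Ioo (0 : ℝ) 1,
    ‖iterInt ι 0 (wordX (psAux 1 w)) z - lmul (letterSeries (yOne 0)
      (expCoeff (iterInt ι 0 [1] z))) (strippedSum L) w‖ ≤ C * (1 - (z : ℝ)) ^ (1 / 8 : ℝ) := by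
  obtain ⟨C, hC⟩ := exists_norm_iterSum_sub_le ι hι hL w
  have hC0 : 0 ≤ C := by simpa using (norm_nonneg _).trans (hC 0)
  refine ⟨3 * C, fun z => ?_⟩
  obtain ⟨z, hz⟩ := z
  have hz' : z ∈ Ico (0 : ℝ) 1 := ⟨hz.1.le, hz.2⟩
  refine norm_le_of_hasSum_abel (d := fun N => iterSum ι w (N + 1) -
    lmul (letterSeries (yOne 0) fun m => iterSum ι (List.replicate m (yOne 0)) (N + 1))
      (strippedSum L) w) (fun N => ?_) hz' ?_
  · refine (hC (N + 1)).trans (mul_le_mul_of_nonneg_left ?_ hC0)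
    refine Real.rpow_le_rpow_of_nonpos (by positivity) ?_ (by norm_num)
    push_cast; linarith
  · have h1 := iterInt_wordX_eq ι w hz'
    -- Abel means are linear, so they act on the left factor alone: the sums at $y_{1,1}^m$ become
    -- the polylogarithms at $x_1^m$, the coefficients of $\exp(\mathrm{Li}_1(z)x_1)$.
    have h2 := lmul_letterSeries_induction (J := Option ℕ)
        (P := fun f => HasSum (fun N : ℕ => (1 - (z : ℂ)) * (f (some N) * (z : ℂ) ^ N)) (f none))
        (by simp)
        (fun f g hf hg => (hf.add hg).congr_fun fun N => by ring) (yOne 0)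
        (fun i m => i.elim (expCoeff (iterInt ι 0 [1] z) m)
          fun N => iterSum ι (List.replicate m (yOne 0)) (N + 1)) (fun _ => strippedSum L) w
        (fun v _ n => ?_)
    · refine (h1.sub h2).congr_fun fun N => ?_
      simp only [Option.elim_some]
      ring
    · have h3 := iterInt_wordX_eq ι (List.replicate n (yOne 0)) hz'
      rw [psAux_replicate, wordX_replicate, iterInt_replicate_one ι hz] at h3
      refine (h3.mul_right (strippedSum L v)).congr_fun fun N => ?_
      simp only [Option.elim_some]
      ring

/-- The stripped series of regularised sums consists of regularised integrals. -/
theorem strippedSum_eq (hι : Function.Injective ι) (hL : IsRegSumSeries ι L)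
    {I : Series ℂ (X Γ)} (hI : IsRegIntegralSeries ι I) (w : List (Y Γ)) :
    strippedSum L w = I (FreeMonoid.ofList (wordX (psAux 1 w))) := by
  have h1 := hI.tendsto_left ι hι (wordX (psAux 1 w)) (getLast?_wordX _)
  refine tendsto_nhds_unique ?_ h1
  -- Multiplication by $\exp(-\mathrm{Li}_1(z)y_{1,1})$ loses $(1-z)^{-1/16}$ from the error
  -- $(1-z)^{1/8}$, leaving $(1-z)^{1/16}$.
  obtain ⟨C, hC⟩ := exists_norm_lmul_le (x := yOne (Γ := Γ) 0)
    (b₁ := fun z : Ioo (0 : ℝ) 1 => (1 - (z : ℝ)) ^ (-(1 / 16) : ℝ))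
    (b₂ := fun z : Ioo (0 : ℝ) 1 => (1 - (z : ℝ)) ^ (1 / 8 : ℝ))
    (fun z => Real.rpow_nonneg (by linarith [z.2.2]) _)
    (fun z => expCoeff (-iterInt ι 0 [1] z))
    (fun z v => iterInt ι 0 (wordX (psAux 1 v)) z - lmul (letterSeries (yOne 0)
      (expCoeff (iterInt ι 0 [1] z))) (strippedSum L) v) (fun n => by
        obtain ⟨C, hC, h⟩ := exists_neg_log_pow_le n
        refine ⟨‖algebraMap ℚ ℂ (1 / (n.factorial : ℚ))‖ * C, by positivity, fun z => ?_⟩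
        rw [expCoeff, norm_mul, norm_pow, norm_neg, mul_assoc]
        refine mul_le_mul_of_nonneg_left ((pow_le_pow_left₀ (norm_nonneg _)
          (norm_iterInt_one_le ι z.2) n).trans (h _ ?_ ?_)) (norm_nonneg _)
        · linarith [z.2.2]
        · linarith [z.2.1])
    (exists_norm_iterInt_sub_le ι hι hL) w
  have hlim : Tendsto (fun z : ℝ => C * (1 - z) ^ (1 / 16 : ℝ)) (𝓝[<] 1) (𝓝 0) := by
    have h2 : Tendsto (fun z : ℝ => C * (1 - z) ^ (1 / 16 : ℝ)) (𝓝 1)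
        (𝓝 (C * (1 - 1) ^ (1 / 16 : ℝ))) :=
      ((tendsto_const_nhds.sub tendsto_id).rpow_const (Or.inr (by norm_num))).const_mul C
    rw [sub_self, Real.zero_rpow (by norm_num), mul_zero] at h2
    exact h2.mono_left nhdsWithin_le_nhds
  rw [tendsto_iff_norm_sub_tendsto_zero]
  refine squeeze_zero' (Eventually.of_forall fun _ => norm_nonneg _) ?_ hlim
  filter_upwards [Ioo_mem_nhdsLT (show (0 : ℝ) < 1 from zero_lt_one)] with z hz
  have hz0 : 0 < 1 - z := by linarith [hz.2]
  have h2 := hC ⟨z, hz⟩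
  simp only [sub_eq_add_neg (iterInt ι 0 _ z)] at h2
  have h3 : ∀ v, -lmul (letterSeries (yOne 0) (expCoeff (iterInt ι 0 [1] z))) (strippedSum L) v =
      -1 * lmul (letterSeries (yOne 0) (expCoeff (iterInt ι 0 [1] z))) (strippedSum L) v :=
    fun v => (neg_one_mul _).symm
  simp only [h3] at h2
  -- The two exponentials cancel in front of the stripped series, and the other term becomes the
  -- regularised integral from $0$ to $z$.
  rw [lmul_add_right, lmul_smul_right, ← lmul_assoc, expCoeff_mul_expCoeff, neg_add_cancel,
    lmul_expCoeff_zero, lmul_wordX (Ψ := fun w => iterInt ι 0 w z), neg_one_mul, ← sub_eq_add_neg,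
    ← Real.rpow_add hz0, show (-(1 / 16) + 1 / 8 : ℝ) = 1 / 16 by norm_num] at h2
  exact h2

/-- The regularisation relation. -/
theorem regularisation (hι : Function.Injective ι) (hL : IsRegSumSeries ι L)
    {I : Series ℂ (X Γ)} (hI : IsRegIntegralSeries ι I) :
    L = mul (exp (corrLog fun n => riemannZeta n)) (qs (piY I)) := by
  have h : strippedSum L = qs (piY I) := funext fun w => by
    rw [strippedSum_eq ι hι hL hI]
    exact congrArg I (toX_ofList (psAux 1 w)).symm
  rw [exp_corrLog, ← h]
  exact ((mul_eq_lmul _ _).trans (lmul_strippedSum L)).symm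

end Comparison

/-! ### Double shuffle relations for the integrals. -/

section DoubleShuffle

variable {Γ : Type*} [CommGroup Γ] [Finite Γ] (ι : Γ →* ℂˣ) {I : Series ℂ (X Γ)}
  {L : Series ℂ (Y Γ)}

/-- Stripping acts only on words starting with $y_{1,1}$, so the zeta values survive. -/
theorem strippedSum_yOne (hL : IsRegSumSeries ι L) (n : ℕ) (hn : 1 ≤ n) :
    strippedSum L [yOne n] = riemannZeta (n + 1 : ℕ) := by
  have hne : [(yOne n : Y Γ)].head? ≠ some (yOne 0) := by
    intro h
    have h1 : n.succPNat = (0 : ℕ).succPNat := (Prod.ext_iff.1 (Option.some.inj h)).1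
    have h2 : n + 1 = 1 := congrArg PNat.val h1
    omega
  have h1 := congrFun (lmul_strippedSum L) [yOne n]
  rw [powSeries, lmul_letterSeries_of_head _ _ _ _ hne, coeff_zero_expPS, one_mul] at h1
  exact h1.trans (hL.apply_yOne ι n hn)

theorem piY_y_one (hι : Function.Injective ι) (hL : IsRegSumSeries ι L)
    (hI : IsRegIntegralSeries ι I) (n : ℕ) (hn : 1 ≤ n) :
    piY I (y n.succPNat 1) = riemannZeta (n + 1 : ℕ) := by
  rw [← strippedSum_yOne ι hL n hn, strippedSum_eq ι hι hL hI]
  have h : psAux (1 : Γ) [yOne n] = [yOne n] := by rw [yOne, psAux, mul_one, psAux]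
  rw [h]
  exact congrArg I (toX_ofList [yOne n])

/-- For $m\ge2$ the coefficients entering the correction factor are $\zeta(m)$, so the definition of
`star` reproduces the regularisation relation. -/
theorem star_eq (hι : Function.Injective ι) (hL : IsRegSumSeries ι L)
    (hI : IsRegIntegralSeries ι I) : star I = L := by
  rw [regularisation ι hι hL hI, star]
  congr 2
  unfold corrLog
  funext w
  by_cases h : 2 ≤ w.length ∧ w = y 1 1 ^ w.length
  · have h0 : 0 < w.length := by omega
    have h1 := piY_y_one ι hι hL hI (w.length - 1) (by omega)
    have h2 : (w.length - 1).succPNat = ⟨w.length, h0⟩ := PNat.eq (Nat.sub_add_cancel h0)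
    rw [h2, Nat.sub_add_cancel h0] at h1
    rw [if_pos h, if_pos h]
    exact congrArg _ ((dif_pos h0).trans h1)
  · rw [if_neg h, if_neg h]

theorem mem_DMR (hι : Function.Injective ι) (hL : IsRegSumSeries ι L)
    (hI : IsRegIntegralSeries ι I) : I ∈ DMR Γ ℂ :=
  ⟨hI.1.1, hI.2.2.1, hI.2.2.2, hI.1, by rw [star_eq ι hι hL hI]; exact hL.1⟩

end DoubleShuffle

/-! ### Weight one relations. -/

section WeightOne

variable {Γ : Type*} [CommGroup Γ] [Finite Γ] (ι : Γ →* ℂˣ) {I : Series ℂ (X Γ)}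

/-- On the unit circle away from $1$ the real part is less than $1$, so $1-zt$ has positive real
part and the principal logarithm is a primitive along the whole segment. -/
theorem one_sub_mul_mem_slitPlane {z : ℂ} (hz : ‖z‖ = 1) (hz1 : z ≠ 1) {t : ℝ}
    (ht : t ∈ Icc (0 : ℝ) 1) : 1 - z * t ∈ Complex.slitPlane := by
  have hre : z.re < 1 := by
    refine lt_of_le_of_ne (hz ▸ Complex.re_le_norm z) fun h => hz1 ?_
    have h1 : z.im = 0 := by
      have := Complex.sq_norm z
      rw [hz, Complex.normSq_apply, h] at this
      nlinarith [mul_self_nonneg z.im, this]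
    exact Complex.ext h h1
  left
  have : (1 - z * t).re = 1 - z.re * t := by simp
  rw [this]
  rcases ht.1.eq_or_lt with h | h
  · simp [← h]
  · nlinarith [ht.2]

/-- The integral of `dt / (σ⁻¹ - t)` for `σ ≠ 1`. -/
theorem IsRegIntegralSeries.apply_letter (hι : Function.Injective ι)
    (hI : IsRegIntegralSeries ι I) {σ : Γ} (hσ : σ ≠ 1) :
    I (x (σ : X Γ)) = -Complex.log (1 - (ι σ : ℂ)) := by
  have hz : ‖(ι σ : ℂ)‖ = 1 := norm_character ι σ
  have hz1 : (ι σ : ℂ) ≠ 1 := fun h => hσ (hι (Units.ext (by rw [h, map_one, Units.val_one])))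
  have hd : ∀ t ∈ Icc (0 : ℝ) 1, HasDerivAt (fun t : ℝ => -Complex.log (1 - (ι σ : ℂ) * t))
      (omega ι (σ : X Γ) t) t := by
    intro t ht
    have h1 := one_sub_mul_mem_slitPlane hz hz1 ht
    have h2 : HasDerivAt (fun t : ℝ => 1 - (ι σ : ℂ) * t) (-(ι σ : ℂ)) t := by
      simpa using ((hasDerivAt_id t).ofReal_comp.const_mul (ι σ : ℂ)).const_sub 1
    refine (h2.clog_real h1).neg.congr_deriv ?_
    have h3 := Complex.slitPlane_ne_zero h1
    have h4 : (ι σ : ℂ) ≠ 0 := (ι σ).ne_zero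
    have h5 : (ι σ : ℂ)⁻¹ - t ≠ 0 := by
      intro h
      apply h3
      rw [← sub_eq_zero.1 h, mul_inv_cancel₀ h4, sub_self]
    rw [omega_coe]
    field_simp
  have hlim := hI.2.1 (x (σ : X Γ))
    (by
      intro h
      exact hσ (WithZero.coe_inj.1 (Option.some.inj h)))
    (by
      intro h
      exact WithZero.coe_ne_zero (Option.some.inj h))
  refine tendsto_nhds_unique hlim ?_
  have h0 : Tendsto (fun t : ℝ => -Complex.log (1 - (ι σ : ℂ) * t)) (𝓝[>] 0) (𝓝 0) := by
    have := (hd 0 (by simp)).continuousAt.tendsto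
    simp only [Complex.ofReal_zero, mul_zero, sub_zero, Complex.log_one, neg_zero] at this
    exact this.mono_left nhdsWithin_le_nhds
  have h1 : Tendsto (fun t : ℝ => -Complex.log (1 - (ι σ : ℂ) * t)) (𝓝[<] 1)
      (𝓝 (-Complex.log (1 - (ι σ : ℂ)))) := by
    have := (hd 1 (by simp)).continuousAt.tendsto
    simp only [Complex.ofReal_one, mul_one] at this
    exact this.mono_left nhdsWithin_le_nhds
  have h2 := (h1.comp tendsto_snd).sub (h0.comp (tendsto_fst (f := 𝓝[>] (0 : ℝ)) (g := 𝓝[<] (1 : ℝ))))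
  rw [sub_zero] at h2
  refine h2.congr' ?_
  filter_upwards [eventually_unitFilter] with p hp
  have hsub : uIcc p.1 p.2 ⊆ Icc 0 1 := uIcc_subset_Icc ⟨hp.1.1.le, hp.1.2.le⟩ ⟨hp.2.1.1.le, hp.2.1.2.le⟩
  have h3 := intervalIntegral.integral_eq_sub_of_hasDerivAt (fun t ht => hd t (hsub ht))
    (ContinuousOn.intervalIntegrable ((continuousOn_omega ι (σ : X Γ)).mono
      (ordConnected_Ioo.uIcc_subset hp.1 hp.2.1)))
  refine h3.symm.trans ?_
  change _ = iterInt ι p.1 [(σ : X Γ)] p.2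
  rw [iterInt_cons]
  simp only [iterInt_nil, mul_one]

/-- $1-e^{i\theta}=2\sin(\theta/2)\,e^{i(\theta-\pi)/2}$ with a positive modulus and an angle in
$(-\pi/2,\pi/2)$. -/
theorem arg_one_sub_exp {θ : ℝ} (h0 : 0 < θ) (h1 : θ < 2 * Real.pi) :
    (1 - Complex.exp (θ * Complex.I)).arg = (θ - Real.pi) / 2 := by
  have hs : 0 < 2 * Real.sin (θ / 2) :=
    mul_pos two_pos (Real.sin_pos_of_pos_of_lt_pi (by linarith) (by linarith))
  have h : 1 - Complex.exp (θ * Complex.I) = ((2 * Real.sin (θ / 2) : ℝ) : ℂ) *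
      (Complex.cos (((θ - Real.pi) / 2 : ℝ) : ℂ) +
        Complex.sin (((θ - Real.pi) / 2 : ℝ) : ℂ) * Complex.I) := by
    have e1 : (θ - Real.pi) / 2 = θ / 2 - Real.pi / 2 := by ring
    have e2 : Real.cos θ = 1 - 2 * Real.sin (θ / 2) ^ 2 := by
      rw [← Real.cos_sq_add_sin_sq (θ / 2), show θ = 2 * (θ / 2) by ring, Real.cos_two_mul,
        show 2 * (θ / 2) / 2 = θ / 2 by ring, ← Real.cos_sq_add_sin_sq (θ / 2)]
      ring
    have e3 : Real.sin θ = 2 * Real.sin (θ / 2) * Real.cos (θ / 2) := by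
      rw [← Real.sin_two_mul]; congr 1; ring
    rw [← Complex.ofReal_cos, ← Complex.ofReal_sin, e1, Real.cos_sub_pi_div_two,
      Real.sin_sub_pi_div_two, Complex.exp_mul_I, ← Complex.ofReal_cos, ← Complex.ofReal_sin, e2, e3]
    push_cast
    ring
  rw [h, Complex.arg_mul_cos_add_sin_mul_I hs ⟨by linarith [Real.pi_pos], by linarith [Real.pi_pos]⟩]

/-- The two arguments of the logarithm are conjugate, so the difference is $-2i\arg(1-e^{i\theta})$.
-/
theorem log_conj_sub_log {θ : ℝ} (h0 : 0 < θ) (h1 : θ < 2 * Real.pi) :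
    -Complex.log (1 - Complex.exp (θ * Complex.I)) +
      Complex.log (1 - (Complex.exp (θ * Complex.I))⁻¹) = (Real.pi - θ) * Complex.I := by
  have h2 := arg_one_sub_exp h0 h1
  have h3 : 1 - (Complex.exp (θ * Complex.I))⁻¹ =
      (starRingEnd ℂ) (1 - Complex.exp (θ * Complex.I)) := by
    rw [map_sub, map_one, ← Complex.exp_conj, ← Complex.exp_neg]
    simp
  rw [h3, Complex.log_conj _ (by rw [h2]; linarith [Real.pi_pos])]
  apply Complex.ext
  · simp
  · have h4 : (Complex.log (1 - Complex.exp (θ * Complex.I))).im = (θ - Real.pi) / 2 := by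
      rw [Complex.log_im, h2]
    simp only [Complex.add_im, Complex.neg_im, Complex.conj_im, h4]
    simp
    ring

theorem IsRegIntegralSeries.apply_sub_apply_inv (hι : Function.Injective ι)
    (hI : IsRegIntegralSeries ι I) {ξ : Γ}
    (hξ : (ι ξ : ℂ) = Complex.exp (2 * Real.pi * Complex.I / (Nat.card Γ : ℂ))) {j : ℕ}
    (hj : 1 ≤ j) (hj2 : 2 * j ≤ Nat.card Γ) :
    I (x ((ξ ^ j : Γ) : X Γ)) - I (x (((ξ ^ j)⁻¹ : Γ) : X Γ)) =
      ((Nat.card Γ : ℂ) - 2 * j) / Nat.card Γ * (Real.pi * Complex.I) := by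
  have hn : (0 : ℝ) < Nat.card Γ := by exact_mod_cast (by omega : 0 < Nat.card Γ)
  have hnC : (Nat.card Γ : ℂ) ≠ 0 := by exact_mod_cast hn.ne'
  have hjR : (0 : ℝ) < j := by exact_mod_cast hj
  have hj2R : (2 : ℝ) * j ≤ Nat.card Γ := by exact_mod_cast hj2
  set θ : ℝ := 2 * Real.pi * j / Nat.card Γ with hθ
  have h0 : 0 < θ := by positivity
  have h1 : θ < 2 * Real.pi := by
    rw [hθ, div_lt_iff₀ hn]
    nlinarith [Real.pi_pos]
  have hexp : (ι (ξ ^ j) : ℂ) = Complex.exp (θ * Complex.I) := by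
    rw [map_pow, Units.val_pow_eq_pow_val, hξ, ← Complex.exp_nat_mul]
    congr 1
    rw [hθ]
    push_cast
    ring
  -- Otherwise $\theta$ would be a multiple of $2\pi$ strictly between $0$ and $2\pi$.
  have hne : ξ ^ j ≠ 1 := by
    intro h
    have h2 := log_conj_sub_log h0 h1
    have h3 := arg_one_sub_exp h0 h1
    have h4 : Complex.exp (θ * Complex.I) = 1 := by rw [← hexp, h, map_one, Units.val_one]
    rw [h4, sub_self, Complex.arg_zero] at h3
    rw [Complex.exp_eq_one_iff] at h4
    obtain ⟨m, hm⟩ := h4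
    have h5 : θ = 2 * Real.pi * m := by
      have := congrArg Complex.im hm
      simp at this
      linarith
    have h6 : (0 : ℝ) < m := by
      by_contra h7
      nlinarith [Real.pi_pos]
    have h7 : (1 : ℝ) ≤ m := by exact_mod_cast h6
    nlinarith [Real.pi_pos]
  rw [hI.apply_letter ι hι hne, hI.apply_letter ι hι (inv_ne_one.2 hne), map_inv,
    Units.val_inv_eq_inv_val, hexp, sub_neg_eq_add, log_conj_sub_log h0 h1, hθ]
  push_cast
  field_simp

theorem mem_DMRP (hι : Function.Injective ι) {L : Series ℂ (Y Γ)} (hL : IsRegSumSeries ι L)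
    (hI : IsRegIntegralSeries ι I) : I ∈ DMRP ι ℂ := by
  refine ⟨mem_DMR ι hι hL hI, fun ξ hξ j hj hj2 => ?_⟩
  have h1 := hI.apply_sub_apply_inv ι hι hξ le_rfl (by omega : 2 * 1 ≤ Nat.card Γ)
  rw [pow_one] at h1
  rw [hI.apply_sub_apply_inv ι hι hξ hj hj2, h1]
  -- For $n=2$ only $j=1$ occurs and both sides are $0$, the quotient $0/0$ being $0$.
  rcases (by omega : 2 ≤ Nat.card Γ).eq_or_lt with h2 | h2
  · obtain rfl : j = 1 := by omega
    rw [← h2]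
    simp
  · have hn : (Nat.card Γ : ℂ) ≠ 0 := by exact_mod_cast (by omega : Nat.card Γ ≠ 0)
    have hn2 : (Nat.card Γ : ℂ) - 2 ≠ 0 := by
      rw [sub_ne_zero]
      exact_mod_cast h2.ne'
    rw [eq_ratCast]
    push_cast
    field_simp

end WeightOne

/-! ### Linear substitutions of letters. -/

section Substitution

open FreeMonoid (ofList of)

variable {k A B : Type*} [CommRing k] [Fintype A]

/-- The substitution `a ↦ ∑_b M_{ab} b`. -/
def subst (M : A → B → k) (Φ : List A → k) : List B → k
  | [] => Φ []
  | b :: w => ∑ a, M a b * subst M (fun v => Φ (a :: v)) w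

theorem subst_cons (M : A → B → k) (Φ : List A → k) (b : B) (w : List B) :
    subst M Φ (b :: w) = ∑ a, M a b * subst M (fun v => Φ (a :: v)) w := rfl

/-- A property of families stable under linear combinations passes from the coefficients of a series
to those of its image under a substitution. -/
theorem subst_induction {J : Type*} {P : (J → k) → Prop} (hzero : P fun _ => 0)
    (hadd : ∀ f g, P f → P g → P fun i => f i + g i) (hsmul : ∀ c f, P f → P fun i => c * f i)
    (M : A → B → k) (Φ : J → List A → k) (w : List B) (h : ∀ v, P fun i => Φ i v) :
    P fun i => subst M (Φ i) w := by
  induction w generalizing Φ with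
  | nil => exact h []
  | cons b w ih =>
    have hs : ∀ s : Finset A, P fun i => ∑ a ∈ s, M a b * subst M (fun v => Φ i (a :: v)) w := by
      intro s
      induction s using Finset.induction_on with
      | empty => simpa using hzero
      | insert a s ha ihs =>
        simp only [Finset.sum_insert ha]
        exact hadd _ _ (hsmul _ _ (ih _ fun v => h (a :: v))) ihs
    exact hs _

variable (M : A → B → k)

theorem subst_add (Φ Ψ : List A → k) (w : List B) :
    subst M (fun v => Φ v + Ψ v) w = subst M Φ w + subst M Ψ w := by
  induction w generalizing Φ Ψ with
  | nil => rfl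
  | cons b w ih => simp only [subst_cons, ih, mul_add, Finset.sum_add_distrib]

theorem subst_smul (c : k) (Φ : List A → k) (w : List B) :
    subst M (fun v => c * Φ v) w = c * subst M Φ w := by
  induction w generalizing Φ with
  | nil => rfl
  | cons b w ih =>
    simp only [subst_cons, ih, Finset.mul_sum]
    exact Finset.sum_congr rfl fun a _ => mul_left_comm _ _ _

theorem subst_zero (w : List B) : subst M (fun _ => 0) w = 0 := by
  induction w with
  | nil => rfl
  | cons b w ih => simp [subst_cons, ih]

theorem lmul_sum_left {J : Type*} (s : Finset J) (c : J → k) (Φ : J → List B → k) (Ψ : List B → k)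
    (w : List B) : lmul (fun v => ∑ i ∈ s, c i * Φ i v) Ψ w = ∑ i ∈ s, c i * lmul (Φ i) Ψ w := by
  induction s using Finset.induction_on with
  | empty => simpa using lmul_zero_left Ψ w
  | insert i s hi ih => simp only [Finset.sum_insert hi, lmul_add_left, lmul_smul_left, ih]

theorem subst_lmul (Φ Ψ : List A → k) : subst M (lmul Φ Ψ) = lmul (subst M Φ) (subst M Ψ) := by
  funext w
  induction w generalizing Φ with
  | nil => rfl
  | cons b w ih =>
    rw [lmul_cons]
    simp only [subst_cons, lmul_cons, subst_add, subst_smul, ih, lmul_sum_left, mul_add,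
      Finset.sum_add_distrib, Finset.mul_sum]
    refine congrArg₂ _ (Finset.sum_congr rfl fun a _ => mul_left_comm _ _ _) rfl

theorem subst_letterSeries {x : A} {y : B} {c : k} (h : M x y = c) (h' : ∀ b, b ≠ y → M x b = 0)
    (p : ℕ → k) : subst M (letterSeries x p) = letterSeries y fun n => c ^ n * p n := by
  funext w
  induction w generalizing p with
  | nil => simp [subst]
  | cons b w ih =>
    rw [subst_cons, Finset.sum_eq_single x]
    · simp only [letterSeries_cons, if_true, ih]
      split_ifs with hb
      · rw [hb, h, ← letterSeries_smul]
        refine congrFun (congrArg _ (funext fun n => ?_)) w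
        ring
      · rw [h' b hb, zero_mul]
    · intro a _ ha
      simp only [letterSeries_cons, if_neg ha, subst_zero, mul_zero]
    · intro hx
      exact absurd (Finset.mem_univ x) hx

/-- A linear combination of letters. -/
def IsLinear (p : MonoidAlgebra k (FreeMonoid B)) : Prop :=
  ∀ Z : MonoidAlgebra k (FreeMonoid B), (p * Z).coeff (ofList []) = 0 ∧
    ∀ b v, (p * Z).coeff (ofList (b :: v)) = p.coeff (of b) * Z.coeff (ofList v)

theorem isLinear_single (b : B) (c : k) : IsLinear (MonoidAlgebra.single (of b) c) := by
  refine fun Z => ⟨?_, fun a v => ?_⟩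
  · refine MonoidAlgebra.coeff_single_mul_of_forall_mul_ne _ _ fun d h => ?_
    exact List.cons_ne_nil b d h
  · rw [MonoidAlgebra.coeff_single, Finsupp.single_apply]
    by_cases h : b = a
    · subst h
      rw [if_pos rfl]
      exact MonoidAlgebra.coeff_single_mul_mul Z c (of b) (ofList v)
    · rw [if_neg (fun h' => h (FreeMonoid.of_injective h')), zero_mul]
      refine MonoidAlgebra.coeff_single_mul_of_forall_mul_ne _ _ fun d h' => h ?_
      exact (List.cons.inj h').1

theorem isLinear_sum {J : Type*} (s : Finset J) (p : J → MonoidAlgebra k (FreeMonoid B))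
    (h : ∀ i ∈ s, IsLinear (p i)) : IsLinear (∑ i ∈ s, p i) := by
  refine fun Z => ⟨?_, fun b v => ?_⟩
  · rw [Finset.sum_mul, coeff_sum_apply]
    exact Finset.sum_eq_zero fun i hi => (h i hi Z).1
  · rw [Finset.sum_mul, coeff_sum_apply, coeff_sum_apply, Finset.sum_mul]
    exact Finset.sum_congr rfl fun i hi => (h i hi Z).2 b v

/-- The words of a given length. -/
def wordsOfLength (A : Type*) [Fintype A] : ℕ → Finset (List A)
  | 0 => {[]}
  | n + 1 => (Finset.univ ×ˢ wordsOfLength A n).image fun p => p.1 :: p.2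

theorem mem_wordsOfLength (w : List A) : w ∈ wordsOfLength A w.length := by
  induction w with
  | nil => exact Finset.mem_singleton_self _
  | cons a w ih =>
    exact Finset.mem_image.2 ⟨(a, w), Finset.mem_product.2 ⟨Finset.mem_univ _, ih⟩, rfl⟩

theorem sum_wordsOfLength_succ (n : ℕ) (F : List A → k) :
    ∑ w ∈ wordsOfLength A (n + 1), F w = ∑ a, ∑ w ∈ wordsOfLength A n, F (a :: w) := by
  rw [wordsOfLength, Finset.sum_image, Finset.sum_product]
  rintro ⟨a, v⟩ _ ⟨b, w⟩ _ h
  exact Prod.ext (List.cons.inj h).1 (List.cons.inj h).2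

/-- Letters go to linear forms, so length is preserved and only words as long as `w` contribute to
its coefficient; over a finite alphabet the formal sum is then a finite one. -/
theorem extend_eq_subst {f : A → MonoidAlgebra k (FreeMonoid B)} (hf : ∀ a, IsLinear (f a))
    (Φ : Series k A) (w : List B) :
    extend f Φ (ofList w) = subst (A := A) (fun a b => (f a).coeff (of b)) Φ w := by
  have hcons : ∀ (a : A) (v : List A), FreeMonoid.lift f (ofList (a :: v)) =
      f a * FreeMonoid.lift f (ofList v) := by
    intro a v
    rw [FreeMonoid.ofList_cons, map_mul, FreeMonoid.lift_eval_of]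
  have hnil : FreeMonoid.lift f (ofList ([] : List A)) = 1 := map_one _
  have hlen : ∀ (v : List A) (w : List B), (FreeMonoid.lift f (ofList v)).coeff (ofList w) ≠ 0 →
      v.length = w.length := by
    intro v
    induction v with
    | nil =>
      intro w h
      rw [hnil, MonoidAlgebra.one_def, MonoidAlgebra.coeff_single, Finsupp.single_apply] at h
      cases w with
      | nil => rfl
      | cons b w => exact absurd (if_neg (List.cons_ne_nil b w).symm) h
    | cons a v ih =>
      intro w h
      rw [hcons] at h
      cases w with
      | nil => exact absurd (hf a _).1 h
      | cons b w =>
        rw [(hf a _).2] at h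
        exact congrArg (· + 1) (ih w (right_ne_zero_of_mul h))
  have hsum : ∀ (w : List B) (Ψ : List A → k), ∑ v ∈ wordsOfLength A w.length,
      Ψ v * (FreeMonoid.lift f (ofList v)).coeff (ofList w) =
      subst (fun a b => (f a).coeff (of b)) Ψ w := by
    intro w
    induction w with
    | nil =>
      intro Ψ
      rw [List.length_nil, wordsOfLength, Finset.sum_singleton, hnil, MonoidAlgebra.one_def,
        MonoidAlgebra.coeff_single, Finsupp.single_apply]
      exact (congrArg _ (if_pos rfl)).trans (mul_one _)
    | cons b w ih =>
      intro Ψ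
      rw [List.length_cons, sum_wordsOfLength_succ, subst_cons]
      refine Finset.sum_congr rfl fun a _ => ?_
      rw [← ih, Finset.mul_sum]
      refine Finset.sum_congr rfl fun v _ => ?_
      rw [hcons, (hf a _).2]
      ring
  refine Eq.trans ?_ (hsum w Φ)
  refine finsum_eq_sum_of_support_subset (α := List A) _ fun v hv => ?_
  have h := hlen v w fun h => hv (by
    change Φ (ofList v) * _ = 0
    exact (congrArg _ h).trans (mul_zero _))
  rw [← h]
  exact mem_wordsOfLength v

end Substitution

/-! ### The substitutions $p^d_*$ and $i_d^*$ as matrices. -/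

section PushPull

open FreeMonoid (ofList of)

instance finite_withZero (G : Type*) [Finite G] : Finite (WithZero G) :=
  inferInstanceAs (Finite (Option G))

instance fintype_withZero (G : Type*) [Finite G] : Fintype (WithZero G) := Fintype.ofFinite _

variable {G G' k : Type*} [CommGroup G] [CommGroup G'] [CommRing k]
  (φ : G →* G')

/-- The matrix of `push φ`. -/
def pushMatrix (k : Type*) [CommRing k] (a : X G) (b : X G') : k :=
  WithZero.recZeroCoe (if b = 0 then (Nat.card φ.ker : k) else 0)
    (fun σ => if b = (φ σ : X G') then 1 else 0) a

/-- The matrix of `pull φ`. -/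
def pullMatrix (k : Type*) [CommRing k] (a : X G') (b : X G) : k :=
  if a = WithZero.map' φ b then 1 else 0

theorem coeff_gen {A : Type*} (a b : A) [Decidable (b = a)] :
    (gen a : MonoidAlgebra k (FreeMonoid A)).coeff (of b) = if b = a then 1 else 0 := by
  rw [gen, MonoidAlgebra.coeff_single, Finsupp.single_apply]
  exact if_congr (FreeMonoid.of_injective.eq_iff.trans eq_comm) rfl rfl

theorem push_eq_subst [Finite G] (Φ : Series k (X G)) (w : List (X G')) :
    push φ Φ (ofList w) = subst (A := X G) (pushMatrix φ k) Φ w := by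
  have h := extend_eq_subst (k := k) (A := X G) (B := X G')
    (f := WithZero.recZeroCoe (MonoidAlgebra.single (x 0) (Nat.card φ.ker : k))
      fun σ => gen (φ σ : X G')) (fun a => ?_) Φ w
  · refine h.trans ?_
    congr 1
    funext a b
    induction a using WithZero.recZeroCoe with
    | zero =>
      change (MonoidAlgebra.single (x 0) (Nat.card φ.ker : k)).coeff (of b) = _
      rw [MonoidAlgebra.coeff_single, Finsupp.single_apply]
      exact if_congr (FreeMonoid.of_injective.eq_iff.trans eq_comm) rfl rfl
    | coe σ => exact coeff_gen (k := k) (φ σ : X G') b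
  · induction a using WithZero.recZeroCoe with
    | zero => exact isLinear_single _ _
    | coe σ => exact isLinear_single _ _

theorem pull_eq_subst [Finite G] [Finite G'] (Φ : Series k (X G')) (w : List (X G)) :
    pull φ Φ (ofList w) = subst (A := X G') (pullMatrix φ k) Φ w := by
  have hsum : ∀ σ : G', (∑ᶠ (τ : G) (_ : φ τ = σ), (gen (τ : X G) : MonoidAlgebra k _)) =
      ∑ τ ∈ (Set.toFinite {τ : G | φ τ = σ}).toFinset, gen (τ : X G) := fun σ =>
    finsum_mem_eq_finite_toFinset_sum _ (Set.toFinite {τ : G | φ τ = σ})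
  have h := extend_eq_subst (k := k) (A := X G') (B := X G)
    (f := WithZero.recZeroCoe (gen 0) fun σ => ∑ᶠ (τ : G) (_ : φ τ = σ), gen (τ : X G))
    (fun a => ?_) Φ w
  · refine h.trans ?_
    congr 1
    funext a b
    induction a using WithZero.recZeroCoe with
    | zero =>
      refine (coeff_gen 0 b).trans ?_
      unfold pullMatrix
      induction b using WithZero.recZeroCoe with
      | zero => simp
      | coe τ => simp
    | coe σ =>
      change (∑ᶠ (τ : G) (_ : φ τ = σ), (gen (τ : X G) : MonoidAlgebra k _)).coeff (of b) = _
      rw [hsum, coeff_sum_apply]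
      simp only [coeff_gen]
      unfold pullMatrix
      induction b using WithZero.recZeroCoe with
      | zero => simp
      | coe τ =>
        simp only [WithZero.coe_inj, Finset.sum_ite_eq, WithZero.map'_coe]
        refine if_congr ?_ rfl rfl
        simp [eq_comm]
  · induction a using WithZero.recZeroCoe with
    | zero => exact isLinear_single _ _
    | coe σ =>
      change IsLinear (∑ᶠ (τ : G) (_ : φ τ = σ), (gen (τ : X G) : MonoidAlgebra k _))
      rw [hsum]
      exact isLinear_sum _ _ fun τ _ => isLinear_single _ _

theorem subst_pullMatrix [Finite G'] (Φ : List (X G') → k) (w : List (X G)) :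
    subst (pullMatrix φ k) Φ w = Φ (w.map (WithZero.map' φ)) := by
  induction w generalizing Φ with
  | nil => rfl
  | cons b w ih =>
    rw [subst_cons, Finset.sum_eq_single (WithZero.map' φ b)]
    · rw [ih, pullMatrix, if_pos rfl, one_mul]; rfl
    · intro a _ ha
      rw [pullMatrix, if_neg ha, zero_mul]
    · intro h
      exact absurd (Finset.mem_univ _) h

theorem sum_pushMatrix_zero [Finite G] (F : X G → k) :
    ∑ a, pushMatrix φ k a 0 * F a = Nat.card φ.ker * F 0 := by
  rw [Finset.sum_eq_single 0]
  · change (if (0 : X G') = 0 then (Nat.card φ.ker : k) else 0) * _ = _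
    rw [if_pos rfl]
  · intro a _ ha
    induction a using WithZero.recZeroCoe with
    | zero => exact absurd rfl ha
    | coe σ =>
      change (if (0 : X G') = (φ σ : X G') then (1 : k) else 0) * _ = _
      rw [if_neg WithZero.coe_ne_zero.symm, zero_mul]
  · intro h
    exact absurd (Finset.mem_univ _) h

theorem sum_pushMatrix_coe [Finite G] (F : X G → k) (σ : G') :
    ∑ a, pushMatrix φ k a (σ : X G') * F a =
      ∑ τ ∈ (Set.toFinite {τ : G | φ τ = σ}).toFinset, F (τ : X G) := by
  symm
  refine Finset.sum_of_injOn (fun τ : G => (τ : X G)) (WithZero.coe_injective.injOn)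
    (fun _ _ => Finset.mem_coe.2 (Finset.mem_univ _)) (fun a _ ha => ?_) fun τ hτ => ?_
  · induction a using WithZero.recZeroCoe with
    | zero =>
      change (if (σ : X G') = 0 then (Nat.card φ.ker : k) else 0) * _ = _
      rw [if_neg WithZero.coe_ne_zero, zero_mul]
    | coe τ =>
      change (if (σ : X G') = (φ τ : X G') then (1 : k) else 0) * _ = _
      rw [if_neg, zero_mul]
      intro h
      exact ha ⟨τ, by simpa using (WithZero.coe_inj.1 h).symm, rfl⟩
  · have h : φ τ = σ := by simpa using hτ
    change _ = (if (σ : X G') = (φ τ : X G') then (1 : k) else 0) * _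
    rw [h, if_pos rfl, one_mul]

end PushPull

/-! ### Partial fractions of $1/(s-z^d)$. -/

section LogDerivative

open Polynomial in
-- Two monic polynomials of the same degree that agree at as many distinct points as their degree
-- are equal.
theorem X_pow_sub_C_eq_prod {J : Type*} {S : Finset J} (hS : 0 < S.card) {r : J → ℂ}
    (hr : Set.InjOn r S) {s : ℂ} (hs : ∀ i ∈ S, r i ^ S.card = s) :
    (Polynomial.X ^ S.card - C s : ℂ[X]) = ∏ i ∈ S, (Polynomial.X - C (r i)) := by
  have hcard : (S.image r).card = S.card := Finset.card_image_of_injOn hr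
  refine eq_of_degree_sub_lt_of_eval_finset_eq (S.image r) ?_ fun z hz => ?_
  · rw [hcard, ← degree_X_pow_sub_C hS s]
    refine degree_sub_lt_left ?_ (X_pow_sub_C_ne_zero hS s) ?_
    · rw [degree_X_pow_sub_C hS, degree_prod]
      simp
    · rw [leadingCoeff_X_pow_sub_C hS, (monic_prod_X_sub_C r S).leadingCoeff]
  · obtain ⟨i, hi, rfl⟩ := Finset.mem_image.1 hz
    rw [eval_prod, Finset.prod_eq_zero hi (by simp)]
    simp [hs i hi]

/-- Logarithmic derivative of $z^d-s=\prod_i(z-r_i)$, with signs reversed. -/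
theorem sum_one_div_sub {J : Type*} {S : Finset J} (hS : 0 < S.card) {r : J → ℂ}
    (hr : Set.InjOn r S) {s : ℂ} (hs : ∀ i ∈ S, r i ^ S.card = s) {z : ℂ}
    (hz : ∀ i ∈ S, r i - z ≠ 0) :
    ∑ i ∈ S, 1 / (r i - z) = S.card * z ^ (S.card - 1) * (1 / (s - z ^ S.card)) := by
  have hprod : (fun w => ∏ i ∈ S, (w - r i)) = fun w : ℂ => w ^ S.card - s := by
    funext w
    have := congrArg (Polynomial.eval w) (X_pow_sub_C_eq_prod hS hr hs)
    rw [Polynomial.eval_prod] at this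
    simpa using this.symm
  have h := logDeriv_prod (𝕜 := ℂ) (s := S) (f := fun i w => w - r i) (x := z)
    (fun i hi h => hz i hi (by rw [← neg_sub, h, neg_zero]))
    (fun i _ => (differentiableAt_id).sub_const _)
  rw [hprod] at h
  have h1 : logDeriv (fun w : ℂ => w ^ S.card - s) z =
      S.card * z ^ (S.card - 1) / (z ^ S.card - s) := by
    rw [logDeriv_apply, ((hasDerivAt_pow S.card z).sub_const s).deriv]
  have h2 : ∀ i, logDeriv (fun w : ℂ => w - r i) z = 1 / (z - r i) := fun i => by
    rw [logDeriv_apply, ((hasDerivAt_id' z).sub_const (r i)).deriv]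
  simp only [h1, h2] at h
  rw [← neg_sub, one_div_neg_eq_neg_one_div, mul_neg, mul_one_div, h, ← Finset.sum_neg_distrib]
  refine Finset.sum_congr rfl fun i _ => ?_
  rw [← neg_sub, one_div_neg_eq_neg_one_div]

end LogDerivative

/-! ### Iterated integrals under $t\mapsto t^d$. -/

section Distribution

variable {Γ : Type*} [CommGroup Γ] [Finite Γ] (ι : Γ →* ℂˣ) {d : ℕ}

/-- A finite group embedded in $\mathbb C^*$ is cyclic, so it has exactly $d$ elements killed by a
divisor $d$ of its order. This gives the coefficient of $x_0$ in $p^d_*$. -/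
theorem card_ker_powMonoidHom (hι : Function.Injective ι) (hd : d ∣ Nat.card Γ) :
    Nat.card (powMonoidHom d : Γ →* Γ).rangeRestrict.ker = d := by
  have : IsCyclic Γ := isCyclic_of_injective_ringHom ((Units.coeHom ℂ).comp ι)
    (Units.val_injective.comp hι)
  rw [MonoidHom.ker_rangeRestrict, IsCyclic.card_powMonoidHom_ker, Nat.gcd_eq_right hd]

theorem card_fiber_powMonoidHom (hι : Function.Injective ι) (hd : d ∣ Nat.card Γ)
    (σ : (powMonoidHom d : Γ →* Γ).range) :
    (Set.toFinite {τ : Γ | (powMonoidHom d : Γ →* Γ).rangeRestrict τ = σ}).toFinset.card = d := by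
  rw [← Set.ncard_eq_toFinset_card _ (Set.toFinite _)]
  refine Eq.trans ?_ (card_ker_powMonoidHom ι hι hd)
  exact Nat.card_congr
    ((powMonoidHom d : Γ →* Γ).rangeRestrict.fiberEquivKerOfSurjective
      (MonoidHom.rangeRestrict_surjective _) σ)

theorem inv_sub_ne_zero (σ : Γ) {t : ℝ} (ht : t ∈ Ioo (0 : ℝ) 1) : (ι σ : ℂ)⁻¹ - t ≠ 0 := by
  rw [← norm_pos_iff]
  exact (sub_pos.2 ht.2).trans_le (one_sub_le_norm_sub ι σ t ht.1.le)

/-- The change of variables `t ↦ t ^ d` on the forms. -/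
theorem sum_pushMatrix_omega (hι : Function.Injective ι) (hd : d ∣ Nat.card Γ)
    (c : X (powMonoidHom d : Γ →* Γ).range) {t : ℝ} (ht : t ∈ Ioo (0 : ℝ) 1) :
    ∑ e, pushMatrix (powMonoidHom d : Γ →* Γ).rangeRestrict ℂ e c * omega ι e t =
      d * (t : ℂ) ^ (d - 1) *
        omega ι (WithZero.map' (powMonoidHom d : Γ →* Γ).range.subtype c) (t ^ d) := by
  have hd0 : 0 < d := Nat.pos_of_dvd_of_pos hd Nat.card_pos
  induction c using WithZero.recZeroCoe with
  | zero =>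
    rw [sum_pushMatrix_zero, card_ker_powMonoidHom ι hι hd, map_zero, omega_zero, omega_zero]
    have h0 : (t : ℂ) ≠ 0 := by exact_mod_cast ht.1.ne'
    obtain ⟨m, rfl⟩ := Nat.exists_eq_succ_of_ne_zero hd0.ne'
    push_cast
    rw [pow_succ]
    field_simp
  | coe σ =>
    have hcard := card_fiber_powMonoidHom ι hι hd σ
    rw [sum_pushMatrix_coe, WithZero.map'_coe, omega_coe]
    simp only [omega_coe]
    set S := (Set.toFinite {τ : Γ | (powMonoidHom d : Γ →* Γ).rangeRestrict τ = σ}).toFinset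
    -- The $d$ elements $\tau$ with $\tau^d=\sigma$ have inverses running over the roots of
    -- $X^d=\sigma^{-1}$.
    have h := sum_one_div_sub (S := S) (r := fun τ => (ι τ : ℂ)⁻¹) (s := (ι (σ : Γ) : ℂ)⁻¹)
      (z := t) (by rwa [hcard])
      (fun τ _ τ' _ h => hι (Units.ext (inv_injective h)))
      (fun τ hτ => by
        have h1 : (powMonoidHom d : Γ →* Γ).rangeRestrict τ = σ := by simpa [S] using hτ
        have h2 : τ ^ d = σ := congrArg Subtype.val h1
        rw [hcard, inv_pow, ← h2, map_pow, Units.val_pow_eq_pow_val])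
      (fun τ _ => inv_sub_ne_zero ι τ ht)
    rw [hcard] at h
    rw [h]
    push_cast
    rfl

theorem HasDerivAt.subst {A B : Type*} [Fintype A] (M : A → B → ℂ) {Φ : ℝ → List A → ℂ}
    {Φ' : List A → ℂ} {t : ℝ} (h : ∀ v, HasDerivAt (fun t => Φ t v) (Φ' v) t) (w : List B) :
    HasDerivAt (fun t => Racinet.subst M (Φ t) w) (Racinet.subst M Φ' w) t :=
  subst_induction (J := Option ℝ) (P := fun f => HasDerivAt (fun t => f (some t)) (f none) t)
    (hasDerivAt_const t 0) (fun _ _ hf hg => hf.add hg) (fun c _ hf => hf.const_mul c) M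
    (fun i => i.elim Φ' Φ) w h

theorem pow_mem_Ioo {t : ℝ} (ht : t ∈ Ioo (0 : ℝ) 1) (hd : d ≠ 0) : t ^ d ∈ Ioo (0 : ℝ) 1 :=
  ⟨pow_pos ht.1 d, pow_lt_one₀ ht.1.le ht.2 hd⟩

/-- The change of variables `t ↦ t ^ d` in iterated integrals. -/
theorem subst_pushMatrix_iterInt (hι : Function.Injective ι) (hd : d ∣ Nat.card Γ) {a b : ℝ}
    (ha : a ∈ Ioo (0 : ℝ) 1) (hb : b ∈ Ioo (0 : ℝ) 1)
    (w : List (X (powMonoidHom d : Γ →* Γ).range)) :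
    subst (pushMatrix (powMonoidHom d : Γ →* Γ).rangeRestrict ℂ) (fun w => iterInt ι a w b) w =
      iterInt ι (a ^ d) (w.map (WithZero.map' (powMonoidHom d : Γ →* Γ).range.subtype)) (b ^ d) := by
  have hd0 : d ≠ 0 := (Nat.pos_of_dvd_of_pos hd Nat.card_pos).ne'
  set M := pushMatrix (powMonoidHom d : Γ →* Γ).rangeRestrict ℂ
  set inc := WithZero.map' (powMonoidHom d : Γ →* Γ).range.subtype
  induction w generalizing b with
  | nil => rfl
  | cons c w ih =>
    have h1 : ∀ t ∈ Ioo (0 : ℝ) 1, HasDerivAt (fun t => subst M (fun w => iterInt ι a w t) (c :: w))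
        (d * (t : ℂ) ^ (d - 1) * omega ι (inc c) (t ^ d) *
          iterInt ι (a ^ d) (w.map inc) (t ^ d)) t := by
      intro t ht
      have h := HasDerivAt.fun_sum (u := Finset.univ) fun e (_ : e ∈ Finset.univ) =>
        (HasDerivAt.subst M (fun v => hasDerivAt_iterInt ι ha ht e v) w).const_mul (M e c)
      refine h.congr_deriv ?_
      simp only [subst_smul, ← mul_assoc]
      rw [← Finset.sum_mul, sum_pushMatrix_omega ι hι hd c ht, ih ht]
    have h2 : ∀ t ∈ Ioo (0 : ℝ) 1, HasDerivAt
        (fun t : ℝ => iterInt ι (a ^ d) (inc c :: w.map inc) (t ^ d))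
        (d * (t : ℂ) ^ (d - 1) * omega ι (inc c) (t ^ d) *
          iterInt ι (a ^ d) (w.map inc) (t ^ d)) t := by
      intro t ht
      have h := (hasDerivAt_iterInt ι (pow_mem_Ioo ha hd0) (pow_mem_Ioo ht hd0) (inc c)
        (w.map inc)).scomp t (hasDerivAt_pow d t)
      refine h.congr_deriv ?_
      rw [Complex.real_smul]
      push_cast
      ring
    -- Both sides have the same derivative in the upper end and vanish when it equals `a`.
    have hconst := isOpen_Ioo.is_const_of_deriv_eq_zero isPreconnected_Ioo
      (fun t ht => ((h1 t ht).sub (h2 t ht)).differentiableAt.differentiableWithinAt)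
      (fun t ht => ((h1 t ht).sub (h2 t ht)).deriv.trans (sub_self _)) hb ha
    refine sub_eq_zero.1 (hconst.trans ?_)
    simp [subst_cons, iterInt_cons_self, subst_zero]

end Distribution

/-! ### The distribution relations in the limit. -/

section DistributionRelation

variable {Γ : Type*} [CommGroup Γ] [Finite Γ] (ι : Γ →* ℂˣ) {d : ℕ} {I : Series ℂ (X Γ)}

theorem exp_smulX1 {G : Type*} [CommGroup G] (c : ℂ) :
    (exp (smulX1 c) : Series ℂ (X G)) = letterSeries (A := X G) 1 (expCoeff c) := by
  have h1 : ∀ w : List (X G), smulX1 c (FreeMonoid.ofList w) =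
      powSeries (A := X G) 1 (PowerSeries.C c * PowerSeries.X) w := by
    intro w
    rw [powSeries, letterSeries_eq_ite]
    unfold smulX1
    by_cases h : w = [1]
    · refine (if_pos (congrArg FreeMonoid.ofList h)).trans ?_
      simp [h]
    · refine (if_neg (fun h' => h h')).trans ?_
      split_ifs with h2
      · have h3 : w.length ≠ 1 := fun h3 => h (by rw [h2, h3]; rfl)
        rw [PowerSeries.coeff_C_mul, PowerSeries.coeff_X, if_neg h3, mul_zero]
      · rfl
  have h2 : smulX1 c = powSeries (A := X G) 1 (PowerSeries.C c * PowerSeries.X) := funext h1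
  have h3 : (fun n => (expPS (PowerSeries.C c * PowerSeries.X)).coeff n) = expCoeff c := by
    funext n
    rw [expPS, PowerSeries.coeff_mk, Finset.sum_eq_single_of_mem n (by simp)]
    · rw [mul_pow, ← map_pow, PowerSeries.coeff_C_mul, PowerSeries.coeff_X_pow, if_pos rfl, mul_one,
        expCoeff]
    · intro m _ hm
      rw [mul_pow, ← map_pow, PowerSeries.coeff_C_mul, PowerSeries.coeff_X_pow, if_neg hm.symm,
        mul_zero, mul_zero]
  rw [h2, ← h3]
  exact exp_powSeries _ _

theorem pow_mul_expCoeff (c t : ℂ) : (fun n => c ^ n * expCoeff t n) = expCoeff (c * t) := by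
  funext n
  rw [expCoeff, expCoeff, mul_pow]
  ring

theorem subst_pushMatrix_letterSeries {G G' : Type*} [CommGroup G] [CommGroup G'] [Finite G]
    (φ : G →* G') (t : ℂ) : subst (pushMatrix φ ℂ) (letterSeries 1 (expCoeff t)) =
      letterSeries 1 (expCoeff t) := by
  rw [subst_letterSeries (y := 1) (c := 1), pow_mul_expCoeff, one_mul]
  · exact if_pos (congrArg _ (map_one φ)).symm
  · exact fun b hb => if_neg fun h => hb (h.trans (congrArg _ (map_one φ)))

theorem subst_pushMatrix_letterSeries_zero {G G' : Type*} [CommGroup G] [CommGroup G'] [Finite G]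
    (φ : G →* G') (t : ℂ) : subst (pushMatrix φ ℂ) (letterSeries 0 (expCoeff t)) =
      letterSeries 0 (expCoeff (Nat.card φ.ker * t)) := by
  rw [subst_letterSeries (y := 0) (c := (Nat.card φ.ker : ℂ)), pow_mul_expCoeff]
  · change (if (0 : X G') = 0 then (Nat.card φ.ker : ℂ) else 0) = _
    rw [if_pos rfl]
  · exact fun b hb => if_neg hb

theorem subst_pullMatrix_letterSeries {G G' : Type*} [CommGroup G] [CommGroup G'] [Finite G']
    {φ : G →* G'} (hφ : Function.Injective φ) {a : X G'} {b : X G} (h : WithZero.map' φ b = a)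
    (t : ℂ) : subst (pullMatrix φ ℂ) (letterSeries a (expCoeff t)) =
      letterSeries b (expCoeff t) := by
  rw [subst_letterSeries (y := b) (c := 1), pow_mul_expCoeff, one_mul]
  · exact if_pos h.symm
  · exact fun c hc => if_neg fun h' => hc (WithZero.map'_injective_iff.2 hφ (h'.symm.trans h.symm))

/-- The distribution relation for regularised integrals over a segment. -/
theorem subst_pushMatrix_regInt (hι : Function.Injective ι) (hd : d ∣ Nat.card Γ) {p : ℝ × ℝ}
    (h1 : p.1 ∈ Ioo (0 : ℝ) 1) (h2 : p.2 ∈ Ioo (0 : ℝ) 1) :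
    subst (pushMatrix (powMonoidHom d : Γ →* Γ).rangeRestrict ℂ) (regInt ι p) =
      lmul (letterSeries 1 (expCoeff (iterInt ι (p.1 ^ d) [1] (p.2 ^ d) - iterInt ι p.1 [1] p.2)))
        (subst (pullMatrix (powMonoidHom d : Γ →* Γ).range.subtype ℂ)
          (regInt ι (p.1 ^ d, p.2 ^ d))) := by
  have hinj := (powMonoidHom d : Γ →* Γ).range.subtype_injective
  have hm : subst (pushMatrix (powMonoidHom d : Γ →* Γ).rangeRestrict ℂ)
      (fun w => iterInt ι p.1 w p.2) =
      subst (pullMatrix (powMonoidHom d : Γ →* Γ).range.subtype ℂ)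
        (fun w => iterInt ι (p.1 ^ d) w (p.2 ^ d)) := by
    funext w
    rw [subst_pushMatrix_iterInt ι hι hd h1 h2, subst_pullMatrix]
  -- The normalisations at $x_0$ match because $d\int_a^b dt/t=\int_{a^d}^{b^d}dt/t$; only those at
  -- $x_1$ differ.
  have h0 : (d : ℂ) * iterInt ι p.1 [0] p.2 = iterInt ι (p.1 ^ d) [0] (p.2 ^ d) := by
    have h := subst_pushMatrix_iterInt ι hι hd h1 h2 [0]
    rw [subst_cons] at h
    have h3 := sum_pushMatrix_zero (powMonoidHom d : Γ →* Γ).rangeRestrict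
      (fun e => iterInt ι p.1 [e] p.2)
    rw [card_ker_powMonoidHom ι hι hd] at h3
    rw [← h3]
    refine h.trans ?_
    rw [List.map_cons, List.map_nil, map_zero]
  rw [regInt, regInt, subst_lmul, subst_lmul, subst_lmul, subst_lmul,
    subst_pushMatrix_letterSeries, subst_pushMatrix_letterSeries_zero,
    subst_pullMatrix_letterSeries hinj (map_one _), subst_pullMatrix_letterSeries hinj (map_zero _), hm,
    card_ker_powMonoidHom ι hι hd, mul_neg, h0, ← lmul_assoc, ← lmul_assoc, expCoeff_mul_expCoeff]
  congr 5
  ring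

theorem Filter.Tendsto.subst {J A B : Type*} [Fintype A] (M : A → B → ℂ) {Φ : J → List A → ℂ}
    {Φ' : List A → ℂ} {l : Filter J} (h : ∀ v, Tendsto (fun t => Φ t v) l (𝓝 (Φ' v)))
    (w : List B) : Tendsto (fun t => Racinet.subst M (Φ t) w) l (𝓝 (Racinet.subst M Φ' w)) :=
  subst_induction (J := Option J) (P := fun f => Tendsto (fun t => f (some t)) l (𝓝 (f none)))
    tendsto_const_nhds (fun _ _ hf hg => hf.add hg) (fun c _ hf => hf.const_mul c) M
    (fun i => i.elim Φ' Φ) w h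

theorem tendsto_pow_unitFilter (hd : d ≠ 0) :
    Tendsto (fun p : ℝ × ℝ => (p.1 ^ d, p.2 ^ d)) unitFilter unitFilter := by
  refine Tendsto.prodMap (f := fun t : ℝ => t ^ d) (g := fun t : ℝ => t ^ d) ?_ ?_
  · refine tendsto_nhdsWithin_iff.2 ⟨?_, ?_⟩
    · have h := (continuous_pow (M := ℝ) d).tendsto 0
      rw [zero_pow hd] at h
      exact h.mono_left nhdsWithin_le_nhds
    · filter_upwards [self_mem_nhdsWithin] with t ht using pow_pos (mem_Ioi.1 ht) d
  · refine tendsto_nhdsWithin_iff.2 ⟨?_, ?_⟩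
    · have h := (continuous_pow (M := ℝ) d).tendsto 1
      rw [one_pow] at h
      exact h.mono_left nhdsWithin_le_nhds
    · filter_upwards [Ioo_mem_nhdsLT (zero_lt_one (α := ℝ))] with t ht
      exact pow_lt_one₀ ht.1.le ht.2 hd

theorem distribution (hι : Function.Injective ι) (hd : d ∣ Nat.card Γ)
    (hI : IsRegIntegralSeries ι I) : Distribution I d := by
  have hd0 : d ≠ 0 := (Nat.pos_of_dvd_of_pos hd Nat.card_pos).ne'
  have hinj := (powMonoidHom d : Γ →* Γ).range.subtype_injective
  set φ := (powMonoidHom d : Γ →* Γ).rangeRestrict with hφ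
  set inc := (powMonoidHom d : Γ →* Γ).range.subtype with hinc
  have hpush := fun w => Filter.Tendsto.subst (pushMatrix φ ℂ) (hI.tendsto ι hι) w
  have hpull := fun w => (Filter.Tendsto.subst (pullMatrix inc ℂ) (hI.tendsto ι hι) w).comp
    (tendsto_pow_unitFilter hd0)
  -- The exponent is read off as the coefficient at $x_1$ of the left side, since the pulled-back
  -- series has constant term $1$ and no coefficient at $x_1$. The divergent integrals in it then
  -- need no separate limit.
  have hev : ∀ᶠ p in unitFilter, subst (pushMatrix φ ℂ) (regInt ι p) =
      lmul (letterSeries 1 (expCoeff (subst (pushMatrix φ ℂ) (regInt ι p) [1])))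
        (subst (pullMatrix inc ℂ) (regInt ι (p.1 ^ d, p.2 ^ d))) := by
    filter_upwards [eventually_unitFilter] with p hp
    have hp1 := pow_mem_Ioo hp.1 hd0
    have hp2 := pow_mem_Ioo hp.2.1 hd0
    have h := subst_pushMatrix_regInt ι hι hd hp.1 hp.2.1
    have h1 := congrFun h [1]
    have hreg := regInt_mem ι (p := (p.1 ^ d, p.2 ^ d)) hp1 hp2
    have h2 : subst (pullMatrix inc ℂ) (regInt ι (p.1 ^ d, p.2 ^ d)) [] = 1 := hreg.1.1
    have h3 : subst (pullMatrix inc ℂ) (regInt ι (p.1 ^ d, p.2 ^ d)) [1] = 0 := by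
      rw [subst_pullMatrix, List.map_cons, List.map_nil, map_one]
      exact hreg.2.2
    rw [lmul_letterSeries_cons, if_pos rfl, lmul_nil, letterSeries_nil, h2, h3, mul_zero, zero_add,
      mul_one, zero_add, expCoeff_one_right] at h1
    rw [h1]
    exact h
  have hlim : ∀ w : List (X (powMonoidHom d : Γ →* Γ).range), subst (A := X Γ) (pushMatrix φ ℂ) I w =
      lmul (letterSeries 1 (expCoeff (subst (A := X Γ) (pushMatrix φ ℂ) I [1])))
        (subst (A := X Γ) (pullMatrix inc ℂ) I) w := by
    intro w
    refine tendsto_nhds_unique (hpush w) ?_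
    have h := tendsto_lmul_letterSeries 1 w
      (fun n => ((hpush [1]).pow n).const_mul (algebraMap ℚ ℂ (1 / (n.factorial : ℚ))))
      (fun v _ => hpull v)
    refine h.congr' ?_
    filter_upwards [hev] with p hp using (congrFun hp w).symm
  -- The letters sent to $x_1$ are the $x_\sigma$ with $\sigma^d=1$.
  have hone : subst (A := X Γ) (pushMatrix φ ℂ) I [1] =
      ∑ᶠ (σ : Γ) (_ : σ ^ d = 1), I (x (σ : X Γ)) := by
    have h := sum_pushMatrix_coe φ (fun e => I (x e)) 1
    refine (Eq.trans ?_ h).trans ?_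
    · rfl
    · rw [← finsum_mem_eq_finite_toFinset_sum (fun τ : Γ => I (x (τ : X Γ)))]
      refine finsum_congr fun σ => finsum_congr_Prop ?_ fun _ => rfl
      exact propext Subtype.ext_iff
  unfold Distribution
  have h1 : push φ I = subst (A := X Γ) (pushMatrix φ ℂ) I := funext fun w => push_eq_subst φ I w
  have h2 : pull inc I = subst (A := X Γ) (pullMatrix inc ℂ) I := funext fun w => pull_eq_subst inc I w
  refine Eq.trans h1 ?_
  refine Eq.trans ?_ (mul_eq_lmul _ _).symm
  rw [h2, exp_smulX1, ← hone]
  exact funext hlim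

theorem mem_DMRD (hι : Function.Injective ι) {L : Series ℂ (Y Γ)} (hL : IsRegSumSeries ι L)
    (hI : IsRegIntegralSeries ι I) : I ∈ DMRD ι ℂ :=
  ⟨mem_DMRP ι hι hL hI, fun _ hd => distribution ι hι hd hI⟩

end DistributionRelation

end

end Racinet


/-! ### The theorem. -/

theorem mainTheorem5 {Γ : Type*} [CommGroup Γ] [Finite Γ] (ι : Γ →* ℂˣ)
    (hι : Function.Injective ι) :
    (∃! I : Racinet.Series ℂ (Racinet.X Γ), Racinet.IsRegIntegralSeries ι I) ∧
    (∃! L : Racinet.Series ℂ (Racinet.Y Γ), Racinet.IsRegSumSeries ι L) ∧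
    ∀ (I : Racinet.Series ℂ (Racinet.X Γ)) (L : Racinet.Series ℂ (Racinet.Y Γ)),
      Racinet.IsRegIntegralSeries ι I → Racinet.IsRegSumSeries ι L →
        L = Racinet.mul (Racinet.exp (Racinet.corrLog fun n => riemannZeta n))
              (Racinet.qs (Racinet.piY I)) ∧
        I ∈ Racinet.DMRD ι ℂ :=
  ⟨Racinet.existsUnique_isRegIntegralSeries ι hι, Racinet.existsUnique_isRegSumSeries ι hι,
    fun _ _ hI hL => ⟨Racinet.regularisation ι hι hL hI, Racinet.mem_DMRD ι hι hL hI⟩⟩
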